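/- Let $F$ be a non-archimedean local field of characteristic zero with residue field of cardinality $q$, let $F^u$ be its maximal unramified extension and $\Gamma_u=\mathrm{Gal}(F^u/F)$. Let $G$ be a connected reductive $F$-group and $T\subset G$ a maximal $F$-torus which splits over $F^u$ and is elliptic (that is, $T$ modulo the center of $G$ is $F$-anisotropic). Let $Z(F)$ be the center of $G(F)$, let $W=N(G(F^u),T(F^u))^{\Gamma_u}/T(F)$, where $N(A,B)$ is the normalizer of $B$ in $A$, and let $T(F)_{0,s}$ be the set of those $\gamma\in T(F)$ which are strongly regular (the centralizer of $\gamma$ in $G$ is $T$) and topologically semisimple (of finite order prime to the residue characteristic). A character $\chi_1:T(F)\to\mathbb{C}^*$ has depth zero if it is trivial on the pro-unipotent radical $T(F)_{0+}=\{t\in T(F): |x(t)-1|<1 \text{ for all } x\in X^*(T)\}$; for $n\in W$ put $(n_*\chi_1)(t)=\chi_1(n^{-1}tn)$. (1) For every (reduced) root datum $\Psi$ there is a number $q_0$, depending only on $\Psi$, such that for every $F$ with $q>q_0$, every $(G,T)$ as above with absolute root datum $\Psi$, and every depth-zero character $\chi_1$ of $T(F)$, the function $\sum_{n\in W}n_*\chi_1$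 is not identically zero on $Z(F)T(F)_{0,s}$. (2) Suppose that $\Psi$ is the root datum of $\mathrm{PGSp}(4)$ (for example $G=\mathrm{PGSp}(4)$). If $T=T_1$ is a torus on whose character lattice the Frobenius acts by $-1$, the conclusion of (1) holds whenever $q>46$. If $T=T_2$ is a torus on whose character lattice the Frobenius acts by an automorphism with square $-1$ (that is, by $(a,b)\mapsto(-b,a)$ in a suitable basis), it holds whenever $q>3$. -/

import Mathlib

/-! ### Non-archimedean local fields of characteristic zero

A non-archimedean local field of characteristic zero is a field `F` of characteristic zero with a
nontrivial ultrametric norm for which closed balls are compact. The extension of the norm to the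
algebraic closure is `spectralNorm F (AlgebraicClosure F)`. -/

section LocalField

open scoped NormedField Valued

/-- The cardinality `q` of the residue field of `F`. -/
noncomputable def residueCard (F : Type*) [NontriviallyNormedField F] [IsUltrametricDist F] : ℕ :=
  Nat.card 𝓀[F]

end LocalField

/-- A finite extension `E / F` inside the algebraic closure is unramified if the norm takes the
same nonzero values on `E` as on `F` (ramification index one; the residue field is finite, hence
the residue extension is automatically separable). -/
def IsFiniteUnramified (F : Type*) [NontriviallyNormedField F]
    (E : IntermediateField F (AlgebraicClosure F)) : Prop :=
  FiniteDimensional F E ∧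
    ∀ x ∈ E, x ≠ 0 → ∃ y : F, spectralNorm F (AlgebraicClosure F) x = ‖y‖

/-- The maximal unramified extension `F^u` of `F`: the compositum of all finite unramified
extensions inside the algebraic closure. -/
noncomputable def maxUnramified (F : Type*) [NontriviallyNormedField F] :
    IntermediateField F (AlgebraicClosure F) :=
  sSup {E | IsFiniteUnramified F E}

/-- The absolute value on `F^u` extending that of `F`. -/
noncomputable def absU (F : Type*) [NontriviallyNormedField F] (x : maxUnramified F) : ℝ :=
  spectralNorm F (AlgebraicClosure F) (x : AlgebraicClosure F)

/-- The Galois group `Γ_u = Gal(F^u / F)`. -/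
abbrev GalU (F : Type*) [NontriviallyNormedField F] : Type _ :=
  maxUnramified F ≃ₐ[F] maxUnramified F

/-- `s` is the (arithmetic) Frobenius element of `Γ_u`: it induces `x ↦ x ^ q` on the residue
field of `F^u`. -/
def IsFrobenius {F : Type*} [NontriviallyNormedField F] [IsUltrametricDist F]
    (s : GalU F) : Prop :=
  ∀ x : maxUnramified F, absU F x ≤ 1 → absU F (s x - x ^ residueCard F) < 1

/-- The entrywise action of `Γ_u` on `GL_n(F^u)`. -/
noncomputable def galGL {F : Type*} [NontriviallyNormedField F] {n : ℕ} (s : GalU F) :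
    Matrix.GeneralLinearGroup (Fin n) (maxUnramified F) →*
      Matrix.GeneralLinearGroup (Fin n) (maxUnramified F) :=
  Matrix.GeneralLinearGroup.map (s : maxUnramified F →+* maxUnramified F)

/-- The group `GL_n(F)`, as the subgroup of `Γ_u`-fixed points of `GL_n(F^u)`. -/
noncomputable def fixedGL (F : Type*) [NontriviallyNormedField F] (n : ℕ) :
    Subgroup (Matrix.GeneralLinearGroup (Fin n) (maxUnramified F)) where
  carrier := {g | ∀ s : GalU F, galGL s g = g}
  mul_mem' := fun ha hb s => by rw [map_mul, ha s, hb s]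
  one_mem' := fun s => map_one _
  inv_mem' := fun ha s => by rw [map_inv, ha s]

/-! ### Split connected reductive groups with a split maximal torus -/

/-- A connected reductive group `G` over a field `K` of characteristic zero together with a
`K`-split maximal torus `T` with root datum `P` (`X` is the character lattice of `T`, `Y` the
cocharacter lattice), embedded as a closed subgroup of `GL_n`.

The data are those of the Lie algebra of such a pair. The space `K ^ n` has a basis of
`T`-weight vectors (the columns of `basis`) with weights `wt`, and these weights generate `X`, so
that `T → GL_n` is a closed embedding. All matrices `e i` are written in this basis:
`e i` is a root vector for the root `P.root i`, the bracket of the root vectors for a root and its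
negative is the corresponding coroot (viewed in the Lie algebra of `T`), and
the bracket of any other two root vectors is a multiple of a root vector for the sum of the two
roots, or zero. Thus the Lie algebra of `T` and the `e i` span the Lie algebra of `G`. In
characteristic zero every split connected reductive subgroup of `GL_n` with a split maximal torus
is given by such data, and conversely; its points are described in `SplitReductive.points`. -/
structure SplitReductive {ι X Y : Type*} [AddCommGroup X] [AddCommGroup Y]
    (P : RootDatum ι X Y) (K : Type*) [Field K] (n : ℕ) where
  /-- the weights of the torus on the weight basis -/
  wt : Fin n → X
  /-- the weights generate the character lattice -/
  closure_wt : AddSubgroup.closure (Set.range wt) = ⊤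
  /-- the matrix whose columns are the weight vectors -/
  basis : Matrix.GeneralLinearGroup (Fin n) K
  /-- the root vectors, in the weight basis -/
  e : ι → Matrix (Fin n) (Fin n) K
  /-- `e i` has weight `P.root i` -/
  wt_eq : ∀ i a b, e i a b ≠ 0 → wt a = wt b + P.root i
  /-- `[e_α, e_{-α}]` is the coroot `α^∨` -/
  bracket_neg : ∀ i j, P.root j = -P.root i →
    e i * e j - e j * e i =
      Matrix.diagonal fun a => ((P.toLinearMap (wt a) (P.coroot i) : ℤ) : K)
  /-- `[e_α, e_β]` is a multiple of `e_{α+β}` if `α + β` is a root, and zero if it is neither a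
  root nor zero -/
  bracket_add : ∀ i j, P.root i + P.root j ≠ 0 →
    (∃ k, ∃ c : K, P.root k = P.root i + P.root j ∧ e i * e j - e j * e i = c • e k) ∨
      e i * e j - e j * e i = 0

namespace SplitReductive

variable {ι X Y : Type*} [AddCommGroup X] [AddCommGroup Y] {P : RootDatum ι X Y}
  {K : Type*} [Field K] {n : ℕ} (S : SplitReductive P K n)

/-- The embedding `T(L) = Hom(X, Lˣ) → GL_n(L)`: the point `t` acts on the `a`-th weight vector
by the scalar `t (wt a)`. -/
noncomputable def torusHom (L : Type*) [Field L] [Algebra K L] :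
    (Multiplicative X →* Lˣ) →* Matrix.GeneralLinearGroup (Fin n) L where
  toFun t :=
    let B := Matrix.GeneralLinearGroup.map (algebraMap K L) S.basis
    B * Units.map (Matrix.diagonalRingHom (Fin n) L : (Fin n → L) →* Matrix (Fin n) (Fin n) L)
      (MulEquiv.piUnits.symm fun a => t (Multiplicative.ofAdd (S.wt a))) * B⁻¹
  map_one' := by
    have : (MulEquiv.piUnits.symm fun a => (1 : Multiplicative X →* Lˣ)
        (Multiplicative.ofAdd (S.wt a)) : (Fin n → L)ˣ) = 1 := by
      ext; rfl
    simp only [this, map_one, mul_one, mul_inv_cancel]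
  map_mul' t u := by
    have : (MulEquiv.piUnits.symm fun a => (t * u) (Multiplicative.ofAdd (S.wt a)) :
        (Fin n → L)ˣ) =
        MulEquiv.piUnits.symm (fun a => t (Multiplicative.ofAdd (S.wt a))) *
        MulEquiv.piUnits.symm (fun a => u (Multiplicative.ofAdd (S.wt a))) := by
      rw [← map_mul]; rfl
    simp only [this, map_mul]
    group

/-- The group `T(L)` of `L`-points of the maximal torus, as a subgroup of `GL_n(L)`. -/
noncomputable def torus (L : Type*) [Field L] [Algebra K L] :
    Subgroup (Matrix.GeneralLinearGroup (Fin n) L) :=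
  (S.torusHom L).range

/-- The group `G(L)` of `L`-points, for an extension `L` of `K` (of characteristic zero):
it is generated by `T(L)` and by the root groups, which consist of the exponentials
`exp(c e_α)`, `c ∈ L`, of the (nilpotent) multiples of the root vectors. -/
noncomputable def points (L : Type*) [Field L] [CharZero L] [Algebra K L] :
    Subgroup (Matrix.GeneralLinearGroup (Fin n) L) :=
  Subgroup.closure
    ((S.torus L : Set (Matrix.GeneralLinearGroup (Fin n) L)) ∪
      {g | ∃ (i : ι) (c : L),
        (g : Matrix (Fin n) (Fin n) L) =
          (Matrix.GeneralLinearGroup.map (algebraMap K L) S.basis : Matrix (Fin n) (Fin n) L) *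
            IsNilpotent.exp (c • (S.e i).map (algebraMap K L)) *
          ((Matrix.GeneralLinearGroup.map (algebraMap K L) S.basis)⁻¹ :
            Matrix.GeneralLinearGroup (Fin n) L)})

end SplitReductive

/-! ### Unramified groups and unramified maximal tori -/

/-- A connected reductive group `G` over the local field `F` together with a maximal torus `T`
of `G`, defined over `F` and split over `F^u` (an unramified torus), with absolute root datum `P`,
realised as an `F`-subgroup of `GL_n`. It is a pair over `F^u` which is stable under `Γ_u`.
The action of `Γ_u` on the character lattice `X` of `T` is `gal`: one has
`(s x)(s t) = s (x t)` for `s ∈ Γ_u`, `x ∈ X`, `t ∈ T(F^u)`. -/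
structure UnramifiedPair {ι X Y : Type*} [AddCommGroup X] [AddCommGroup Y]
    (P : RootDatum ι X Y) (F : Type*) [NontriviallyNormedField F] [CharZero F] (n : ℕ) extends
    SplitReductive P (maxUnramified F) n where
  /-- the action of `Γ_u` on the character lattice of the torus -/
  gal : GalU F →* (X ≃ₗ[ℤ] X)
  /-- `T` is stable under `Γ_u`, which acts on `T(F^u) = Hom(X, F^uˣ)` through its actions
  on `X` and on `F^u` -/
  galGL_torusHom : ∀ (s : GalU F) (t t' : Multiplicative X →* (maxUnramified F)ˣ),
    (∀ x : X, ((t' (Multiplicative.ofAdd (gal s x)) : (maxUnramified F)ˣ) : maxUnramified F) =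
      s (t (Multiplicative.ofAdd x) : (maxUnramified F)ˣ)) →
    galGL s (toSplitReductive.torusHom (maxUnramified F) t) =
      toSplitReductive.torusHom (maxUnramified F) t'
  /-- `G` is stable under `Γ_u` -/
  galGL_points : ∀ (s : GalU F), ∀ g ∈ toSplitReductive.points (maxUnramified F),
    galGL s g ∈ toSplitReductive.points (maxUnramified F)

namespace UnramifiedPair

variable {ι X Y : Type*} [AddCommGroup X] [AddCommGroup Y] {P : RootDatum ι X Y}
  {F : Type*} [NontriviallyNormedField F] [CharZero F] {n : ℕ} (D : UnramifiedPair P F n)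

/-- The group `G(F)`, as a subgroup of `GL_n(F^u)`. -/
noncomputable def ratPoints : Subgroup (Matrix.GeneralLinearGroup (Fin n) (maxUnramified F)) :=
  D.points (maxUnramified F) ⊓ fixedGL F n

/-- The group `T(F)`, as a subgroup of `GL_n(F^u)`. -/
noncomputable def ratTorus : Subgroup (Matrix.GeneralLinearGroup (Fin n) (maxUnramified F)) :=
  D.torus (maxUnramified F) ⊓ fixedGL F n

/-- The torus `T` is elliptic: every cocharacter of `T` which is defined over `F` is central in
`G`, that is, `T` modulo the center of `G` is anisotropic over `F`. -/
def IsElliptic : Prop :=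
  ∀ y : Y, (∀ (s : GalU F) (x : X), P.toLinearMap (D.gal s x) y = P.toLinearMap x y) →
    ∀ i, P.toLinearMap (P.root i) y = 0

/-- The group `N(G(F^u), T(F^u))^{Γ_u}`. -/
noncomputable def ratNormalizer :
    Subgroup (Matrix.GeneralLinearGroup (Fin n) (maxUnramified F)) :=
  Subgroup.normalizer
    (D.torus (maxUnramified F) : Set (Matrix.GeneralLinearGroup (Fin n) (maxUnramified F))) ⊓
    D.ratPoints

/-- The Weyl group `W = N(G(F^u), T(F^u))^{Γ_u} / T(F)` (as a set of cosets). -/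
abbrev Weyl : Type _ := D.ratNormalizer ⧸ D.ratTorus.subgroupOf D.ratNormalizer

theorem conj_mem_ratTorus (m : D.ratNormalizer) (t : D.ratTorus) :
    (m : Matrix.GeneralLinearGroup (Fin n) (maxUnramified F))⁻¹ * t * m ∈ D.ratTorus := by
  refine ⟨?_, ?_⟩
  · exact (Subgroup.mem_normalizer_iff''.1 m.2.1 _).1 t.2.1
  · exact (fixedGL F n).mul_mem ((fixedGL F n).mul_mem ((fixedGL F n).inv_mem m.2.2.2) t.2.2) m.2.2.2

/-- The value `(n_* χ)(t) = χ(n⁻¹ t n)`. -/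
noncomputable def conjChar (χ : D.ratTorus →* ℂˣ) (m : D.ratNormalizer) (t : D.ratTorus) : ℂ :=
  (χ ⟨_, D.conj_mem_ratTorus m t⟩ : ℂˣ)

theorem conjChar_eq_of_rel (χ : D.ratTorus →* ℂˣ) (t : D.ratTorus) (m m' : D.ratNormalizer)
    (h : QuotientGroup.leftRel (D.ratTorus.subgroupOf D.ratNormalizer) m m') :
    D.conjChar χ m t = D.conjChar χ m' t := by
  rw [QuotientGroup.leftRel_apply, Subgroup.mem_subgroupOf] at h
  set c : D.ratTorus := ⟨_, h⟩ with hc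
  have hm : (⟨_, D.conj_mem_ratTorus m' t⟩ : D.ratTorus) =
      c⁻¹ * ⟨_, D.conj_mem_ratTorus m t⟩ * c := by
    ext1
    simp [hc, mul_assoc]
  unfold conjChar
  rw [hm, map_mul, map_mul, map_inv, mul_comm, mul_inv_cancel_left]

/-- The function `∑_{n ∈ W} n_* χ` on `T(F)`. -/
noncomputable def weylSum (χ : D.ratTorus →* ℂˣ) (t : D.ratTorus) : ℂ :=
  ∑ᶠ w : D.Weyl, Quotient.liftOn' w (fun m => D.conjChar χ m t) (D.conjChar_eq_of_rel χ t)

/-- A character of `T(F)` has depth zero if it is trivial on the pro-unipotent radical `T(F)_{0+}`,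
the group of all `t ∈ T(F)` such that `|x(t) - 1| < 1` for all characters `x` of `T`. (Such a
character is continuous, since this subgroup is open.) -/
def IsDepthZero (χ : D.ratTorus →* ℂˣ) : Prop :=
  ∀ (t : Multiplicative X →* (maxUnramified F)ˣ)
    (ht : D.torusHom (maxUnramified F) t ∈ D.ratTorus),
    (∀ x : X, absU F (((t (Multiplicative.ofAdd x) : (maxUnramified F)ˣ) : maxUnramified F) - 1)
      < 1) → χ ⟨_, ht⟩ = 1

/-- An element `γ` of `T(F)` is strongly regular if its centralizer in `G` (over the algebraic
closure) is `T`. -/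
def IsStronglyRegular (γ : D.ratTorus) : Prop :=
  ∀ g ∈ D.points (AlgebraicClosure F),
    Commute g (Matrix.GeneralLinearGroup.map
      (algebraMap (maxUnramified F) (AlgebraicClosure F)) γ) →
    g ∈ D.torus (AlgebraicClosure F)

/-- An element `γ` of `T(F)` is topologically semisimple if it has finite order prime to the
residue characteristic. -/
def IsTopSemisimple [IsUltrametricDist F] (γ : D.ratTorus) : Prop :=
  IsOfFinOrder γ ∧ (orderOf γ).Coprime (residueCard F)

/-- The set `T(F)_{0,s}` of strongly regular topologically semisimple elements of `T(F)`. -/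
def regularSet [IsUltrametricDist F] : Set D.ratTorus :=
  {γ | D.IsStronglyRegular γ ∧ D.IsTopSemisimple γ}

/-- The subset `Z(F) T(F)_{0,s}` of `T(F)`, where `Z(F)` is the center of `G(F)`. -/
def centralRegularSet [IsUltrametricDist F] : Set D.ratTorus :=
  {t | ∃ z ∈ D.ratPoints, (∀ g ∈ D.ratPoints, Commute z g) ∧ ∃ γ ∈ D.regularSet,
    (t : Matrix.GeneralLinearGroup (Fin n) (maxUnramified F)) = z * γ}

end UnramifiedPair

/-! ### The root datum of `PGSp(4)` -/

/-- `P` is the root datum of `PGSp(4)`. The standard maximal torus of `GSp(4)` consists of the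
matrices `diag(x₁, x₂, x₃, x₄)` with `x₁ x₄ = x₂ x₃`. With `α = x₁ / x₂` and `β = x₂ / x₃` the
roots are `±α`, `±β`, `±(α + β)`, `±(2α + β)`, and the simple roots `α`, `β` form a basis of
the character lattice of the image of this torus in the adjoint group `PGSp(4)`.
(The roots determine the coroots.) -/
def IsRootDatumPGSp4 {ι X Y : Type*} [AddCommGroup X] [AddCommGroup Y]
    (P : RootDatum ι X Y) : Prop :=
  ∃ α β : X, LinearIndependent ℤ ![α, β] ∧ Submodule.span ℤ {α, β} = ⊤ ∧
    Set.range P.root =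
      {α, -α, β, -β, α + β, -(α + β), (2 : ℤ) • α + β, -((2 : ℤ) • α + β)}

/-!
Let `φ` be a Frobenius element, and write the action of `Γ_u` on the character lattice `X` as `gal`.
A homomorphism `t` from `X` to the roots of unity of `F^u` of order prime to the residue
characteristic is a rational point of `T` if `t (gal φ x) = t x ^ q` for all `x`
(`UnramifiedPair.torusHom_mem_ratTorus`). The group `H` of these points, the lift of the finite
torus over the residue field, is dual to the finite group `X / (gal φ - q) X`, and its elements are
topologically semisimple. An element of `H` is strongly regular if no root is trivial on it and if
no nontrivial element of the Weyl group fixes it (`SplitReductive.mem_torus_of_commute`). Let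
`B ⊆ H` contain all elements which do not satisfy this. Restricted to `H`, the Weyl sum is a sum
of characters of `H`. If it vanished outside `B`, then by orthogonality `|H| ≤ |W| |B|`
(`exists_sum_ne_zero`). Hence the theorem follows from `|W| |B| < |H|`
(`UnramifiedPair.exists_weylSum_ne_zero`); neither the depth of the character nor the ellipticity
of the torus plays a role.

To bound `B`, cover it by the kernels in `H` of finitely many `x ∈ X`. By duality such a kernel has
`|H| / r` elements, where `r x ∈ (gal φ - q) X` (`FrobCoinvariants.exists_card_mul_eq`).

* In general the `x` are the differences of roots: an element of `H` that separates the roots is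
  strongly regular. As `gal φ` permutes the roots and has finite order, say `d`, summing a geometric
  series gives `r ∑ q ^ (d - 1 - m) (gal φ) ^ m x = (1 - q ^ d) y`, and the pairing of this with the
  coroots shows that `r ≥ (q - 1) / C` for a constant `C` depending on the root datum only
  (`sub_one_le_mul_of_eq`). Since `|W|` is bounded by the number of self-maps of the set of roots,
  this gives the first part.
* For `PGSp(4)` the roots are `±e₁`, `±e₂`, `±e₁ ± e₂` for a basis `e₁`, `e₂` of `X`; the group `W`
  has at most eight elements, and the `x` are `2 e₁`, `2 e₂`, `e₁ + e₂`, `e₁ - e₂`. If `gal φ` is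
  `-1`, the respective `r` are at least `m / 2`, `m / 2`, `m`, `m` with `m = q + 1`, and the trivial
  character is in all four kernels, so that `|B| + 3 ≤ 6 |H| / m`; this suffices for `m ≥ 48`. If
  `gal φ` has square `-1`, all four kernels lie in that of `2 e₁`, for which `r ≥ (q ^ 2 + 1) / 2`,
  and `16 < q ^ 2 + 1`.

The description of the strongly regular elements rests on the structure of the group. A matrix that
normalizes the Lie algebra and is upper unipotent for a functional on `X` is a product of root
elements (`SplitReductive.mem_rootGroup_of_unipotent`); this yields the Bruhat decomposition
(`SplitReductive.mem_bruhatSet_of_mem_grp`) and shows that the torus is its own centralizer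
(`SplitReductive.mem_tor_of_hasType_one`). Elements which normalize the torus or commute with a
regular element of it permute the weight spaces through an automorphism of `X`
(`SplitReductive.exists_hasType`), which permutes the roots and is determined by its action on them
(`SplitReductive.HasType.eq_one_of_root`).

The extension `F^u` is generated by the roots of unity of order prime to the residue characteristic
(`maxUnramified_eq_adjoin`), and the Galois group acts on those of order `q ^ d - 1` through the
powers of `ζ ↦ ζ ^ q` (`algEquiv_apply_eq_pow`, `exists_algEquiv_apply_eq_pow`).
-/

/-! ### Root data and simple roots -/

section

open Module IsAddIndecomposable

namespace RootPairing

variable {ι X Y : Type*} [AddCommGroup X] [AddCommGroup Y]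

section Lattice

theorem exists_dual_ne_zero_of_free [Module.Free ℤ X] [Module.Finite ℤ X] {κ : Type*} [Finite κ]
    (v : κ → X) (hv : ∀ k, v k ≠ 0) : ∃ f : Dual ℤ X, ∀ k, f (v k) ≠ 0 := by
  classical
  have := Fintype.ofFinite κ
  let b := Module.finBasis ℤ X
  -- evaluation of the coordinate polynomial of `x` at an integer `c` is linear in `x`
  let p (x : X) : Polynomial ℤ :=
    ∑ i, Polynomial.C (b.repr x i) * Polynomial.X ^ (i : ℕ)
  have hp : ∀ x, p x = 0 → x = 0 := by
    intro x hx
    apply b.repr.injective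
    ext i
    have := congrArg (fun r => Polynomial.coeff r (i : ℕ)) hx
    simpa [p, Polynomial.finsetSum_coeff, Polynomial.coeff_X_pow, Fin.val_inj] using this
  have hprod : ∏ k, p (v k) ≠ 0 :=
    Finset.prod_ne_zero_iff.2 fun k _ h => hv k (hp _ h)
  obtain ⟨c, hc⟩ : ∃ c : ℤ, (∏ k, p (v k)).eval c ≠ 0 := by
    by_contra! h
    exact hprod (Polynomial.funext fun r => by simpa using h r)
  refine ⟨∑ i : Fin (finrank ℤ X), (c ^ (i : ℕ)) • b.coord i, fun k hk => ?_⟩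
  rw [Polynomial.eval_prod, Finset.prod_ne_zero_iff] at hc
  apply hc k (Finset.mem_univ _)
  rw [← hk]
  simp [p, Polynomial.eval_finsetSum, mul_comm]

/-- An element which every functional vanishing on a subgroup kills has a nonzero multiple in it. -/
theorem exists_smul_mem_of_forall_dual [Module.Finite ℤ X] (R : Submodule ℤ X) (x : X)
    (h : ∀ f : Dual ℤ X, (∀ r ∈ R, f r = 0) → f x = 0) : ∃ m : ℤ, m ≠ 0 ∧ m • x ∈ R := by
  let Q := X ⧸ R
  let T := Submodule.torsion ℤ Q
  have : Module.Free ℤ (Q ⧸ T) := inferInstance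
  have hx : (T.mkQ (R.mkQ x)) = 0 := by
    rw [← Module.forall_dual_apply_eq_zero_iff ℤ]
    intro φ
    exact h (φ ∘ₗ T.mkQ ∘ₗ R.mkQ) fun r hr => by
      rw [LinearMap.comp_apply, LinearMap.comp_apply, R.mkQ_apply,
        (Submodule.Quotient.mk_eq_zero R).2 hr, map_zero, map_zero]
  rw [Submodule.mkQ_apply, Submodule.Quotient.mk_eq_zero] at hx
  obtain ⟨⟨m, hm⟩, hm'⟩ := hx
  refine ⟨m, nonZeroDivisors.ne_zero hm, ?_⟩
  rw [← Submodule.Quotient.mk_eq_zero R]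
  simpa using hm'

end Lattice

variable (P : RootDatum ι X Y)

include P in
theorem isTorsionFree_left : IsAddTorsionFree X := by
  have := Module.IsReflexive.of_isPerfPair P.toLinearMap
  exact .of_isTorsionFree ℤ X

include P in
theorem free_left [Module.Finite ℤ X] : Module.Free ℤ X := by
  have := Module.IsReflexive.of_isPerfPair P.toLinearMap
  infer_instance

variable [Finite ι]

/-- An element of the character lattice which is orthogonal to all coroots vanishes if all
functionals killing the roots kill it. -/
theorem eq_zero_of_forall_coroot [Module.Finite ℤ X] (x : X)
    (hx : ∀ i, P.toLinearMap x (P.coroot i) = 0)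
    (h : ∀ f : Dual ℤ X, (∀ i, f (P.root i) = 0) → f x = 0) : x = 0 := by
  have := Fintype.ofFinite ι
  have := P.isTorsionFree_left
  obtain ⟨m, hm, hmx⟩ := exists_smul_mem_of_forall_dual (P.rootSpan ℤ) x fun f hf =>
    h f fun i => hf _ (Submodule.subset_span ⟨i, rfl⟩)
  by_contra hne
  have hne' : (⟨m • x, hmx⟩ : P.rootSpan ℤ) ≠ 0 := by
    simpa [Subtype.ext_iff] using ⟨hne, hm⟩
  have h0 := P.posRootForm_posForm_pos_of_ne_zero ℤ hne'
  -- a multiple of `x` is in the root span, where the canonical form is positive definite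
  have h1 := P.algebraMap_posRootForm_posForm ℤ ⟨m • x, hmx⟩ ⟨m • x, hmx⟩
  rw [rootForm_apply_apply] at h1
  simp [RootPairing.coroot', hx] at h1
  rw [P.posRootForm_eq] at h0
  exact h0.ne' h1

variable [P.IsReduced] (f : Dual ℤ X) (hf : ∀ i, f (P.root i) ≠ 0)

/-- The simple roots of the positive system cut out by a functional that vanishes on no root. -/
abbrev simpleRoots : Set ι := baseOf P.root (f : X →+ ℤ)

variable {P f}

omit [Finite ι] [P.IsReduced] in
theorem pos_of_mem_simpleRoots {i : ι} (hi : i ∈ P.simpleRoots f) : 0 < f (P.root i) := hi.1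

omit [P.IsReduced] in
theorem exists_nat_combination {j : ι} (hj : 0 < f (P.root j)) :
    ∃ l ∈ Finsupp.supported ℕ ℕ (P.simpleRoots f),
      Finsupp.linearCombination ℕ P.root l = P.root j := by
  have h := (AddSubmonoid.mem_closure_image_pos_iff P.root (f : X →+ ℤ) j (P.ne_zero j)).2 hj
  rw [← AddSubmonoid.closure_image_isAddIndecomposable_baseOf,
    ← Submodule.span_nat_eq_addSubmonoidClosure, Submodule.mem_toAddSubmonoid,
    Finsupp.mem_span_image_iff_linearCombination] at h
  exact h

omit [Finite ι] [P.IsReduced] in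
theorem root_reflectionPerm_self' (j : ι) : P.root (P.reflectionPerm j j) = -P.root j := by
  simp

include hf

/-- A simple reflection permutes the positive roots other than the simple one. -/
theorem pos_reflection {i j : ι} (hi : i ∈ P.simpleRoots f) (hj : 0 < f (P.root j))
    (hij : i ≠ j) : 0 < f (P.root (P.reflectionPerm i j)) := by
  classical
  by_contra hneg
  let := P.indexNeg
  -- if `s_i β` were negative, then `β + (-s_i β)` would be a combination of simple roots with
  -- nonnegative coefficients and at the same time a multiple of the `i`-th one, hence so would be `β`
  have hneg' : 0 < f (P.root (-P.reflectionPerm i j)) := by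
    have := hf (P.reflectionPerm i j)
    rw [indexNeg_neg, root_reflectionPerm_self', map_neg]
    omega
  obtain ⟨l, hl, hlj⟩ := exists_nat_combination hj
  obtain ⟨m, hm, hmj⟩ := exists_nat_combination hneg'
  have hind := P.linearIndepOn_root_baseOf' f hf
  rw [linearIndepOn_iff] at hind
  let c : ι → ℤ := fun k => (l k : ℤ) + m k
  let n : ι →₀ ℤ := l.mapRange (Nat.cast : ℕ → ℤ) rfl + m.mapRange (Nat.cast : ℕ → ℤ) rfl -
    Finsupp.single i (P.pairing j i)
  have hcast : ∀ l : ι →₀ ℕ, Finsupp.linearCombination ℤ P.root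
      (l.mapRange (Nat.cast : ℕ → ℤ) rfl) = Finsupp.linearCombination ℕ P.root l := by
    intro l
    simp [Finsupp.linearCombination_apply, Finsupp.sum_mapRange_index]
  have hn : n = 0 := by
    apply hind
    · refine Submodule.sub_mem _ (Submodule.add_mem _ ?_ ?_) (Finsupp.single_mem_supported _ _ hi)
      · exact fun k hk => hl (Finsupp.support_mapRange hk)
      · exact fun k hk => hm (Finsupp.support_mapRange hk)
    · simp only [n, map_add, map_sub, hcast, hlj, hmj, Finsupp.linearCombination_single]
      rw [indexNeg_neg, root_reflectionPerm_self', root_reflectionPerm, reflection_apply]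
      simp [RootPairing.coroot', root_coroot_eq_pairing]
  have hl0 : ∀ k, k ≠ i → l k = 0 := by
    intro k hk
    have := DFunLike.congr_fun hn k
    simp [n, hk.symm] at this
    omega
  have hroot : P.root j = (l i) • P.root i := by
    rw [← hlj, Finsupp.linearCombination_apply]
    exact Finsupp.sum_eq_single i (fun k _ hk => by simp [hl0 k hk]) (by simp)
  have hdep : ¬ LinearIndependent ℤ ![P.root i, P.root j] := by
    rw [LinearIndependent.pair_iff]
    push Not
    exact ⟨l i, -1, by simp [hroot], by simp⟩
  rcases IsReduced.eq_or_eq_neg i j hdep with h | h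
  · exact hij (P.root.injective h)
  · have h1 := pos_of_mem_simpleRoots hi
    rw [h, map_neg] at h1
    omega

omit hf [P.IsReduced] in
theorem exists_mem_simpleRoots_pairing_pos {j : ι} (hj : 0 < f (P.root j)) :
    ∃ i ∈ P.simpleRoots f, 0 < P.pairing j i := by
  by_contra! hcon
  obtain ⟨l, hl, hlj⟩ := exists_nat_combination hj
  have h2 := P.root_coroot_two j
  nth_rewrite 1 [← hlj] at h2
  rw [Finsupp.linearCombination_apply, Finsupp.sum, map_sum, LinearMap.sum_apply] at h2
  have : ∑ k ∈ l.support, P.toLinearMap (l k • P.root k) (P.coroot j) ≤ 0 := by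
    refine Finset.sum_nonpos fun k hk => ?_
    have h3 : ¬ 0 < P.pairingIn ℤ k j := by
      rw [P.zero_lt_pairingIn_iff']
      have h5 : P.pairingIn ℤ j k = P.pairing j k := by
        simpa using P.algebraMap_pairingIn ℤ j k
      rw [h5]
      exact (hcon k (hl hk)).not_gt
    have h4 : P.pairingIn ℤ k j = P.pairing k j := by
      simpa using P.algebraMap_pairingIn ℤ k j
    rw [h4] at h3
    rw [map_nsmul, LinearMap.smul_apply, root_coroot_eq_pairing]
    exact smul_nonpos_of_nonneg_of_nonpos (Nat.zero_le _) (not_lt.1 h3)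
  omega

/-- Every root is obtained from simple roots by simple reflections. -/
theorem induction_simpleRoots {p : ι → Prop}
    (h₁ : ∀ i ∈ P.simpleRoots f, p i)
    (h₂ : ∀ i j, i ∈ P.simpleRoots f → p j → p (P.reflectionPerm i j)) (j : ι) : p j := by
  -- descent on the value of `f`, which a simple reflection with positive pairing lowers
  have hpos : ∀ N : ℕ, ∀ j, 0 < f (P.root j) → f (P.root j) ≤ N → p j := by
    intro N
    induction N with
    | zero => intro j h0 h1; push_cast at h1; omega
    | succ N ih =>
      intro j h0 h1
      obtain ⟨i, hi, hij⟩ := exists_mem_simpleRoots_pairing_pos h0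
      rcases eq_or_ne i j with rfl | hne
      · exact h₁ i hi
      have h3 := pos_reflection hf hi h0 hne
      have h4 : p (P.reflectionPerm i j) := by
        refine ih _ h3 ?_
        have := pos_of_mem_simpleRoots hi
        simp only [root_reflectionPerm, reflection_apply, map_sub, map_smul, smul_eq_mul,
          RootPairing.coroot', LinearMap.flip_apply, root_coroot_eq_pairing] at h3 ⊢
        push_cast at h1
        nlinarith
      simpa using h₂ i _ hi h4
  have hpos' : ∀ j, 0 < f (P.root j) → p j := fun j hj =>
    hpos (f (P.root j)).toNat j hj (Int.self_le_toNat _)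
  -- a negative root `-β` is reached from `β` by running the descent of `β` to a simple root and
  -- reflecting there
  have hneg : ∀ N : ℕ, ∀ j, f (P.root j) < 0 → -f (P.root j) ≤ N → p j := by
    intro N
    induction N with
    | zero => intro j h0 h1; push_cast at h1; omega
    | succ N ih =>
      intro j h0 h1
      let := P.indexNeg
      have hj' : 0 < f (P.root (-j)) := by
        simp only [indexNeg_neg, root_reflectionPerm, reflection_apply_self, map_neg]; omega
      obtain ⟨i, hi, hij⟩ := exists_mem_simpleRoots_pairing_pos hj'
      rcases eq_or_ne i (-j) with hne | hne
      · have := h₂ i i hi (h₁ i hi)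
        rw [hne] at this
        convert this
        have := (indexNeg_neg (P := P) (-j)).symm
        rw [this, neg_neg]
      have h3 := pos_reflection hf hi hj' hne
      have hr : P.root (P.reflectionPerm i (-j)) = - P.root (P.reflectionPerm i j) := by
        simp [root_reflectionPerm]
      have hp : P.pairing (-j) i = - P.pairing j i := by simp
      have h4 : p (P.reflectionPerm i j) := by
        rw [hr, map_neg] at h3
        refine ih _ (by omega) ?_
        have := pos_of_mem_simpleRoots hi
        simp only [root_reflectionPerm, reflection_apply, map_sub, map_smul, smul_eq_mul,
          RootPairing.coroot', LinearMap.flip_apply, root_coroot_eq_pairing] at h3 ⊢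
        push_cast at h1
        rw [hp] at hij
        nlinarith
      simpa using h₂ i _ hi h4
  rcases lt_or_gt_of_ne (hf j) with h | h
  · exact hneg (-f (P.root j)).toNat j h (Int.self_le_toNat _)
  · exact hpos' j h

end RootPairing

end

/-! ### Filtered matrices -/

section

open Matrix

section Filtration

variable {n : ℕ} {L : Type*} [Field L]

/-- The matrices that raise the degree by at least `k`, where the `a`-th basis vector has
degree `d a`. -/
def degFilt (L : Type*) [Field L] (d : Fin n → ℤ) (k : ℤ) :
    Submodule L (Matrix (Fin n) (Fin n) L) where
  carrier := {A | ∀ a b, d a < d b + k → A a b = 0}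
  add_mem' hA hB a b h := by simp [hA a b h, hB a b h]
  zero_mem' _ _ _ := rfl
  smul_mem' c A hA a b h := by simp [hA a b h]

variable {d : Fin n → ℤ} {k l : ℤ} {A B : Matrix (Fin n) (Fin n) L}

theorem mul_mem_degFilt (hA : A ∈ degFilt L d k) (hB : B ∈ degFilt L d l) :
    A * B ∈ degFilt L d (k + l) := by
  intro a b h
  rw [Matrix.mul_apply]
  refine Finset.sum_eq_zero fun j _ => ?_
  rcases lt_or_ge (d a) (d j + k) with h1 | h1
  · rw [hA a j h1, zero_mul]
  · rw [hB j b (by omega), mul_zero]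

theorem degFilt_mono (h : l ≤ k) (hA : A ∈ degFilt L d k) : A ∈ degFilt L d l :=
  fun a b hab => hA a b (by omega)

theorem one_mem_degFilt : (1 : Matrix (Fin n) (Fin n) L) ∈ degFilt L d 0 := by
  intro a b h
  rw [Matrix.one_apply_ne]
  rintro rfl
  omega

theorem pow_mem_degFilt (hA : A ∈ degFilt L d k) (m : ℕ) : A ^ m ∈ degFilt L d (m * k) := by
  induction m with
  | zero => simpa using one_mem_degFilt
  | succ m ih =>
    rw [pow_succ]
    have := mul_mem_degFilt ih hA
    push_cast
    rwa [add_mul, one_mul]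

theorem exists_degFilt_bound (d : Fin n → ℤ) : ∃ K : ℕ, ∀ a b, d a < d b + K ∧ -(K : ℤ) ≤ d a - d b := by
  refine ⟨2 * ∑ a, (d a).natAbs + 1, fun a b => ?_⟩
  have h : ∀ a, (d a).natAbs ≤ ∑ a, (d a).natAbs := fun a =>
    Finset.single_le_sum (f := fun a => (d a).natAbs) (fun _ _ => Nat.zero_le _) (Finset.mem_univ a)
  have ha := h a
  have hb := h b
  generalize ∑ a, (d a).natAbs = s at *
  push_cast
  omega

theorem isNilpotent_of_mem_degFilt (hk : 1 ≤ k) (hA : A ∈ degFilt L d k) : IsNilpotent A := by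
  obtain ⟨K, hK⟩ := exists_degFilt_bound d
  refine ⟨K, ?_⟩
  ext a b
  refine pow_mem_degFilt hA K a b ?_
  have := (hK a b).1
  nlinarith [Nat.cast_nonneg (α := ℤ) K]

/-- Left multiplication by a unipotent matrix reflects the filtration. -/
theorem mem_degFilt_of_unipotent_mul (hA : A - 1 ∈ degFilt L d 1) (hAB : A * B ∈ degFilt L d k) :
    B ∈ degFilt L d k := by
  obtain ⟨K, hK⟩ := exists_degFilt_bound d
  have key : ∀ m : ℕ, B ∈ degFilt L d (min k (-K + m)) := by
    intro m
    induction m with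
    | zero =>
      intro a b h
      have := (hK a b).2
      rw [lt_iff_not_ge] at h
      exact absurd (by simp; omega) h
    | succ m ih =>
      have h1 := mul_mem_degFilt hA ih
      have h2 : B = A * B - (A - 1) * B := by noncomm_ring
      rw [h2]
      refine Submodule.sub_mem _ (degFilt_mono (min_le_left _ _) hAB) (degFilt_mono ?_ h1)
      push_cast
      omega
  refine degFilt_mono ?_ (key (K + k.toNat))
  push_cast
  omega

theorem mem_degFilt_of_mul_unipotent (hA : A - 1 ∈ degFilt L d 1) (hBA : B * A ∈ degFilt L d k) :
    B ∈ degFilt L d k := by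
  obtain ⟨K, hK⟩ := exists_degFilt_bound d
  have key : ∀ m : ℕ, B ∈ degFilt L d (min k (-K + m)) := by
    intro m
    induction m with
    | zero =>
      intro a b h
      have := (hK a b).2
      rw [lt_iff_not_ge] at h
      exact absurd (by simp; omega) h
    | succ m ih =>
      have h1 := mul_mem_degFilt ih hA
      have h2 : B = B * A - B * (A - 1) := by noncomm_ring
      rw [h2]
      refine Submodule.sub_mem _ (degFilt_mono (min_le_left _ _) hBA) (degFilt_mono ?_ h1)
      push_cast
      omega
  refine degFilt_mono ?_ (key (K + k.toNat))
  push_cast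
  omega

/-- The group of matrices which are unipotent and upper triangular with respect to a grading. -/
def unipotentSubgroup (L : Type*) [Field L] (d : Fin n → ℤ) : Subgroup (GL (Fin n) L) where
  carrier := {u | (u : Matrix (Fin n) (Fin n) L) - 1 ∈ degFilt L d 1}
  one_mem' := by simp
  mul_mem' {u v} hu hv := by
    have h : ((u * v : GL (Fin n) L) : Matrix (Fin n) (Fin n) L) - 1 =
        (u.val - 1) * (v.val - 1) + ((u.val - 1) + (v.val - 1)) := by
      rw [Units.val_mul]; noncomm_ring
    rw [Set.mem_ofPred_eq, h]
    exact Submodule.add_mem _ (degFilt_mono (by norm_num) (mul_mem_degFilt hu hv))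
      (Submodule.add_mem _ hu hv)
  inv_mem' {u} hu := by
    have h : u.val * (((u⁻¹ : GL (Fin n) L) : Matrix (Fin n) (Fin n) L) - 1) = -(u.val - 1) := by
      rw [mul_sub, Units.mul_inv]; noncomm_ring
    exact mem_degFilt_of_unipotent_mul hu (h ▸ Submodule.neg_mem _ hu)

end Filtration

/-! ### Exponentials of nilpotent matrices -/

section Exp

variable {n : ℕ} {L : Type*} [Field L] [CharZero L] {N A : Matrix (Fin n) (Fin n) L}

/-- The exponential of a nilpotent matrix, as an invertible matrix. -/
noncomputable def expGL (N : Matrix (Fin n) (Fin n) L) (hN : IsNilpotent N) : GL (Fin n) L where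
  val := IsNilpotent.exp N
  inv := IsNilpotent.exp (-N)
  val_inv := IsNilpotent.exp_mul_exp_neg_self hN
  inv_val := IsNilpotent.exp_neg_mul_exp_self hN

theorem rat_smul_mem {M : Type*} [AddCommGroup M] [Module L M] [Module ℚ M] (V : Submodule L M)
    (c : ℚ) {x : M} (hx : x ∈ V) : c • x ∈ V := by
  rw [← Rat.cast_smul_eq_qsmul L]
  exact V.smul_mem _ hx

theorem exp_sub_mem_degFilt {d : Fin n → ℤ} {k : ℤ} (hk : 1 ≤ k) (hN : N ∈ degFilt L d k) :
    IsNilpotent.exp N - 1 - N ∈ degFilt L d (k + 1) := by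
  obtain ⟨m, hm⟩ := isNilpotent_of_mem_degFilt hk hN
  have hm' : N ^ (m + 2) = 0 := by rw [pow_add, hm, zero_mul]
  rw [IsNilpotent.exp_eq_sum hm', Finset.sum_range_succ', Finset.sum_range_succ']
  have h : ∀ B C D : Matrix (Fin n) (Fin n) L, D + B + C - C - B = D := by
    intro B C D; abel
  simp only [zero_add, pow_one, pow_zero, Nat.factorial_one, Nat.factorial_zero, Nat.cast_one,
    inv_one, one_smul, h]
  refine Submodule.sum_mem _ fun i _ => rat_smul_mem _ _ (degFilt_mono ?_ (pow_mem_degFilt hN _))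
  push_cast
  nlinarith

theorem exp_sub_one_mem_degFilt {d : Fin n → ℤ} {k : ℤ} (hk : 1 ≤ k) (hN : N ∈ degFilt L d k) :
    IsNilpotent.exp N - 1 ∈ degFilt L d k := by
  have h := Submodule.add_mem _ (degFilt_mono (show k ≤ k + 1 by omega)
    (exp_sub_mem_degFilt hk hN)) hN
  simpa using h

/-- The commutator with a matrix, as an endomorphism of the space of matrices. -/
def adMat (N : Matrix (Fin n) (Fin n) L) : Module.End L (Matrix (Fin n) (Fin n) L) :=
  LinearMap.mulLeft L N - LinearMap.mulRight L N

omit [CharZero L] in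
@[simp]
theorem adMat_apply : adMat N A = N * A - A * N := rfl

/-- Conjugation by `exp N` is the exponential of the commutator with `N`. -/
theorem exp_conj_eq (hN : IsNilpotent N) :
    IsNilpotent (adMat N) ∧
      IsNilpotent.exp N * A * IsNilpotent.exp (-N) = IsNilpotent.exp (adMat N) A := by
  obtain ⟨m, hm⟩ := hN
  have hl : (LinearMap.mulLeft L N) ^ m = 0 := by rw [LinearMap.pow_mulLeft, hm]; ext; simp
  have hneg : ∀ i : ℕ, (-LinearMap.mulRight L N) ^ i = LinearMap.mulRight L ((-N) ^ i) := by
    intro i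
    rw [← LinearMap.pow_mulRight]
    congr 1
    ext; simp
  have hm' : (-N) ^ m = 0 := by rw [neg_pow, hm, mul_zero]
  have hr : (-LinearMap.mulRight L N) ^ m = 0 := by
    rw [hneg, hm']
    ext; simp
  have hc : Commute (LinearMap.mulLeft L N) (-LinearMap.mulRight L N) :=
    Commute.neg_right (show Commute (LinearMap.mulLeft L N) (LinearMap.mulRight L N) from
      LinearMap.commute_mulLeft_right N N)
  constructor
  · rw [adMat, sub_eq_add_neg]
    exact hc.isNilpotent_add ⟨m, hl⟩ ⟨m, hr⟩
  · rw [adMat, sub_eq_add_neg, IsNilpotent.exp_add_of_commute hc ⟨m, hl⟩ ⟨m, hr⟩,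
      Module.End.mul_apply, IsNilpotent.exp_eq_sum hl, IsNilpotent.exp_eq_sum hr,
      IsNilpotent.exp_eq_sum hm, IsNilpotent.exp_eq_sum hm']
    simp only [LinearMap.sum_apply, LinearMap.smul_apply, LinearMap.pow_mulLeft, hneg,
      LinearMap.mulLeft_apply, LinearMap.mulRight_apply]
    rw [mul_assoc, Finset.sum_mul]
    refine Finset.sum_congr rfl fun i _ => ?_
    rw [smul_mul_assoc, Finset.mul_sum]
    simp only [mul_smul_comm]

theorem exp_conj_mem (V : Submodule L (Matrix (Fin n) (Fin n) L)) (hN : IsNilpotent N)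
    (hV : ∀ B ∈ V, N * B - B * N ∈ V) (hA : A ∈ V) :
    IsNilpotent.exp N * A * IsNilpotent.exp (-N) ∈ V := by
  obtain ⟨⟨m, hm⟩, h⟩ := exp_conj_eq (A := A) hN
  rw [h, IsNilpotent.exp_eq_sum hm, LinearMap.sum_apply]
  refine Submodule.sum_mem _ fun i hi => ?_
  clear hi
  rw [LinearMap.smul_apply]
  refine rat_smul_mem _ _ ?_
  induction i with
  | zero => simpa using hA
  | succ i ih => rw [pow_succ', Module.End.mul_apply]; exact hV _ ih

/-- Conjugation by an exponential, truncated after the second iterated commutator. -/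
theorem exp_conj_eq_of_triple (hN : IsNilpotent N)
    (h : adMat N (adMat N (adMat N A)) = 0) :
    IsNilpotent.exp N * A * IsNilpotent.exp (-N) =
      A + adMat N A + (2 : ℚ)⁻¹ • adMat N (adMat N A) := by
  obtain ⟨⟨m, hm⟩, h'⟩ := exp_conj_eq (A := A) hN
  have h3 : (adMat N) ^ 3 • A = 0 := by
    simpa [pow_succ, Module.End.mul_apply] using h
  have : IsNilpotent.exp (adMat N) A = IsNilpotent.exp (adMat N) • A := rfl
  rw [h', this, IsNilpotent.exp_smul_eq_sum h3 ⟨m, hm⟩]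
  simp [Finset.sum_range_succ, pow_succ, Module.End.mul_apply]

end Exp

end

/-! ### The Lie algebra of a split reductive group -/

section

open Matrix

/-- The functional on the character lattice defined by a cocharacter, with values in a field. -/
def RootPairing.cocharHom {ι X Y : Type*} [AddCommGroup X] [AddCommGroup Y] (P : RootDatum ι X Y)
    (L : Type*) [Field L] (y : Y) : X →+ L :=
  (Int.castAddHom L).comp (P.toLinearMap.flip y : X →ₗ[ℤ] ℤ).toAddMonoidHom

@[simp]
theorem RootPairing.cocharHom_apply {ι X Y : Type*} [AddCommGroup X] [AddCommGroup Y]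
    (P : RootDatum ι X Y) (L : Type*) [Field L] (y : Y) (x : X) :
    P.cocharHom L y x = (P.toLinearMap x y : ℤ) := rfl

theorem RootPairing.exists_cocharHom_ne_zero {ι X Y : Type*} [AddCommGroup X] [AddCommGroup Y]
    (P : RootDatum ι X Y) (L : Type*) [Field L] [CharZero L] {x : X} (hx : x ≠ 0) :
    ∃ y, P.cocharHom L y x ≠ 0 := by
  by_contra! h
  apply hx
  apply (LinearMap.IsPerfPair.bijective_left P.toLinearMap).1
  ext y
  simpa using h y

namespace SplitReductive

variable {ι X Y : Type*} [AddCommGroup X] [AddCommGroup Y] {P : RootDatum ι X Y}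
  {L : Type*} [Field L] {n : ℕ} (S : SplitReductive P L n)

/-- The diagonal matrix (in the weight basis) attached to a function on the character lattice. -/
def diag (h : X → L) : Matrix (Fin n) (Fin n) L :=
  Matrix.diagonal fun a => h (S.wt a)

@[simp]
theorem diag_mul_apply (h : X → L) (A : Matrix (Fin n) (Fin n) L) (a b : Fin n) :
    (S.diag h * A) a b = h (S.wt a) * A a b := by
  simp [diag, Matrix.diagonal_mul]

@[simp]
theorem mul_diag_apply (h : X → L) (A : Matrix (Fin n) (Fin n) L) (a b : Fin n) :
    (A * S.diag h) a b = A a b * h (S.wt b) := by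
  simp [diag, Matrix.mul_diagonal]

theorem diag_apply_eq (h : X → L) (a : Fin n) : S.diag h a a = h (S.wt a) := by
  simp [diag]

theorem diag_apply_ne (h : X → L) {a b : Fin n} (hab : a ≠ b) : S.diag h a b = 0 := by
  simp [diag, hab]

theorem diag_comm (h h' : X → L) : S.diag h * S.diag h' = S.diag h' * S.diag h := by
  ext a b
  by_cases hab : a = b
  · rw [hab, diag_mul_apply, mul_diag_apply, diag_apply_eq, mul_comm]
  · rw [diag_mul_apply, mul_diag_apply, S.diag_apply_ne _ hab, mul_zero, zero_mul]

/-- An additive predicate on the character lattice which holds for the weights holds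
everywhere. -/
theorem forall_of_forall_wt (H : AddSubgroup X) (h : ∀ a, S.wt a ∈ H) (x : X) : x ∈ H := by
  have : AddSubgroup.closure (Set.range S.wt) ≤ H := by
    rw [AddSubgroup.closure_le]
    rintro _ ⟨a, rfl⟩
    exact h a
  rw [S.closure_wt] at this
  exact this trivial

theorem diag_injective {h h' : X →+ L} (hh : S.diag h = S.diag h') : h = h' := by
  ext x
  refine S.forall_of_forall_wt (AddMonoidHom.eqLocus h h') (fun a => ?_) x
  have := congrFun (congrFun hh a) a
  rwa [diag_apply_eq, diag_apply_eq] at this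

theorem diag_mul_e (h : X →+ L) (i : ι) :
    S.diag h * S.e i - S.e i * S.diag h = h (P.root i) • S.e i := by
  ext a b
  rw [Matrix.sub_apply, diag_mul_apply, mul_diag_apply, Matrix.smul_apply, smul_eq_mul]
  by_cases hab : S.e i a b = 0
  · simp [hab]
  · rw [S.wt_eq i a b hab, map_add]
    ring

theorem bracket_neg_eq {i j : ι} (hij : P.root j = -P.root i) :
    S.e i * S.e j - S.e j * S.e i = S.diag (P.cocharHom L (P.coroot i)) :=
  S.bracket_neg i j hij

theorem exists_root_eq_neg (P : RootDatum ι X Y) (i : ι) : ∃ j, P.root j = -P.root i :=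
  ⟨P.reflectionPerm i i, by simp⟩

theorem e_ne_zero [CharZero L] (i : ι) : S.e i ≠ 0 := by
  intro h
  obtain ⟨j, hj⟩ := exists_root_eq_neg P i
  have h1 := S.bracket_neg_eq hj
  have h2 : S.diag (P.cocharHom L (P.coroot i)) = S.diag ((0 : X →+ L) : X → L) := by
    rw [← h1, h]
    ext a b
    simp [diag]
  have h3 := DFunLike.congr_fun (S.diag_injective h2) (P.root i)
  simp at h3

theorem e_apply_eq_zero {i : ι} {a b : Fin n} (h : S.wt a ≠ S.wt b + P.root i) :
    S.e i a b = 0 := by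
  by_contra h'
  exact h (S.wt_eq i a b h')

theorem e_mem_degFilt (f : X →+ ℤ) (i : ι) :
    S.e i ∈ degFilt L (fun a => f (S.wt a)) (f (P.root i)) := by
  intro a b h
  refine S.e_apply_eq_zero fun h' => ?_
  simp only [h', map_add] at h
  omega

theorem isNilpotent_e (i : ι) : IsNilpotent (S.e i) := by
  refine isNilpotent_of_mem_degFilt ?_
    (S.e_mem_degFilt (P.toLinearMap.flip (P.coroot i) : X →ₗ[ℤ] ℤ).toAddMonoidHom i)
  simp

section Lie

variable [Fintype ι]

/-- The Lie algebra of the group: the span of the Lie algebra of the torus and the root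
vectors, in the weight basis. -/
def lie : Submodule L (Matrix (Fin n) (Fin n) L) where
  carrier := {A | ∃ (h : X →+ L) (c : ι → L), A = S.diag h + ∑ i, c i • S.e i}
  zero_mem' := ⟨0, 0, by ext; simp [diag]⟩
  add_mem' := by
    rintro _ _ ⟨h, c, rfl⟩ ⟨h', c', rfl⟩
    refine ⟨h + h', c + c', ?_⟩
    have : S.diag (h + h' : X →+ L) = S.diag h + S.diag h' := by
      simp [diag, Matrix.diagonal_add]
    simp only [this, Pi.add_apply, add_smul, Finset.sum_add_distrib]
    abel
  smul_mem' := by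
    rintro r _ ⟨h, c, rfl⟩
    refine ⟨(AddMonoidHom.mulLeft r).comp h, r • c, ?_⟩
    have : S.diag ((AddMonoidHom.mulLeft r).comp h : X →+ L) = r • S.diag h := by
      ext a b
      simp [diag, Matrix.diagonal_apply]
    simp only [this, smul_add, Finset.smul_sum, Pi.smul_apply, smul_assoc]

theorem mem_lie {A : Matrix (Fin n) (Fin n) L} :
    A ∈ S.lie ↔ ∃ (h : X →+ L) (c : ι → L), A = S.diag h + ∑ i, c i • S.e i := Iff.rfl

theorem diag_mem_lie (h : X →+ L) : S.diag h ∈ S.lie := ⟨h, 0, by simp⟩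

theorem e_mem_lie (i : ι) : S.e i ∈ S.lie := by
  classical
  refine ⟨0, Pi.single i 1, ?_⟩
  have : S.diag ((0 : X →+ L) : X → L) = 0 := by ext; simp [diag]
  rw [this, zero_add, Finset.sum_eq_single i] <;> simp +contextual

theorem lie_induction {p : Matrix (Fin n) (Fin n) L → Prop}
    (hd : ∀ h : X →+ L, p (S.diag h)) (he : ∀ i, p (S.e i))
    (hadd : ∀ A B, p A → p B → p (A + B)) (hsmul : ∀ (c : L) A, p A → p (c • A))
    {A : Matrix (Fin n) (Fin n) L} (hA : A ∈ S.lie) : p A := by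
  obtain ⟨h, c, rfl⟩ := hA
  refine hadd _ _ (hd h) (Finset.sum_induction _ p hadd ?_ fun i _ => hsmul _ _ (he i))
  have : S.diag ((0 : X →+ L) : X → L) = 0 := by ext; simp [diag]
  exact this ▸ hd 0

theorem bracket_mem_lie {A B : Matrix (Fin n) (Fin n) L} (hA : A ∈ S.lie) (hB : B ∈ S.lie) :
    A * B - B * A ∈ S.lie := by
  have hadd : ∀ A B C : Matrix (Fin n) (Fin n) L, A * C - C * A ∈ S.lie →
      B * C - C * B ∈ S.lie → (A + B) * C - C * (A + B) ∈ S.lie := by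
    intro A B C h1 h2
    have : (A + B) * C - C * (A + B) = (A * C - C * A) + (B * C - C * B) := by noncomm_ring
    exact this ▸ Submodule.add_mem _ h1 h2
  have hsmul : ∀ (c : L) (A C : Matrix (Fin n) (Fin n) L), A * C - C * A ∈ S.lie →
      (c • A) * C - C * (c • A) ∈ S.lie := by
    intro c A C h
    rw [smul_mul_assoc, mul_smul_comm, ← smul_sub]
    exact Submodule.smul_mem _ _ h
  have hswap : ∀ A B : Matrix (Fin n) (Fin n) L, A * B - B * A ∈ S.lie →
      B * A - A * B ∈ S.lie := by
    intro A B h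
    rw [← neg_sub]
    exact Submodule.neg_mem _ h
  have hed : ∀ (i : ι) (h : X →+ L), S.e i * S.diag h - S.diag h * S.e i ∈ S.lie := by
    intro i h
    apply hswap
    rw [diag_mul_e]
    exact Submodule.smul_mem _ _ (S.e_mem_lie i)
  have hdd : ∀ h h' : X →+ L, S.diag h * S.diag h' - S.diag h' * S.diag h ∈ S.lie := by
    intro h h'
    rw [diag_comm, sub_self]
    exact Submodule.zero_mem _
  have hee : ∀ i j, S.e i * S.e j - S.e j * S.e i ∈ S.lie := by
    intro i j
    by_cases hij : P.root i + P.root j = 0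
    · rw [S.bracket_neg_eq (by rw [eq_neg_iff_add_eq_zero, add_comm, hij])]
      exact S.diag_mem_lie _
    · rcases S.bracket_add i j hij with ⟨k, c, -, h⟩ | h
      · rw [h]; exact Submodule.smul_mem _ _ (S.e_mem_lie k)
      · rw [h]; exact Submodule.zero_mem _
  refine S.lie_induction (p := fun A => A * B - B * A ∈ S.lie) ?_ ?_ (fun A C => hadd A C B)
    (fun c A => hsmul c A B) hA
  · intro h
    refine hswap _ _ (S.lie_induction (p := fun B => B * S.diag h - S.diag h * B ∈ S.lie)
      (fun h' => hdd h' h) (fun i => hed i h) (fun A C => hadd A C _) (fun c A => hsmul c A _) hB)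
  · intro i
    refine hswap _ _ (S.lie_induction (p := fun B => B * S.e i - S.e i * B ∈ S.lie)
      (fun h' => hswap _ _ (hed i h')) (fun j => hee j i) (fun A C => hadd A C _)
      (fun c A => hsmul c A _) hB)

/-- The entries of an element of the Lie algebra connecting two weights that differ by a root
are those of a multiple of the root vector. -/
theorem lie_apply_of_wt {h : X →+ L} {c : ι → L} {i : ι} {a b : Fin n}
    (hab : S.wt a = S.wt b + P.root i) :
    (S.diag h + ∑ j, c j • S.e j) a b = c i * S.e i a b := by
  have hne : a ≠ b := by
    rintro rfl
    exact P.ne_zero i (by simpa using hab)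
  rw [Matrix.add_apply, diag_apply_ne _ _ hne, zero_add, Matrix.sum_apply,
    Finset.sum_eq_single i]
  · simp
  · intro j _ hj
    rw [Matrix.smul_apply, S.e_apply_eq_zero, smul_zero]
    rw [hab]
    intro h'
    exact hj (P.root.injective (add_left_cancel h')).symm
  · simp

theorem lie_apply_of_not_root {h : X →+ L} {c : ι → L} {a b : Fin n} (hne : S.wt a ≠ S.wt b)
    (hab : ∀ i, S.wt a ≠ S.wt b + P.root i) :
    (S.diag h + ∑ j, c j • S.e j) a b = 0 := by
  rw [Matrix.add_apply, diag_apply_ne _ _ (fun h' => hne (by rw [h'])), zero_add, Matrix.sum_apply]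
  exact Finset.sum_eq_zero fun j _ => by rw [Matrix.smul_apply, S.e_apply_eq_zero (hab j), smul_zero]

theorem lie_apply_of_wt_eq {h : X →+ L} {c : ι → L} {a b : Fin n} (hab : S.wt a = S.wt b) :
    (S.diag h + ∑ j, c j • S.e j) a b = S.diag h a b := by
  rw [Matrix.add_apply, Matrix.sum_apply, add_eq_left]
  refine Finset.sum_eq_zero fun j _ => ?_
  rw [Matrix.smul_apply, S.e_apply_eq_zero, smul_zero]
  rw [hab]
  intro h'
  exact P.ne_zero j (by simpa using h'.symm)

/-- The group of matrices that normalize the Lie algebra. -/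
def lieNormalizer : Subgroup (GL (Fin n) L) where
  carrier := {g | ∀ A, g.val * A * (g⁻¹).val ∈ S.lie ↔ A ∈ S.lie}
  one_mem' := by simp
  mul_mem' {g g'} h h' A := by
    have e : (g * g').val * A * ((g * g')⁻¹).val =
        g.val * (g'.val * A * (g'⁻¹).val) * (g⁻¹).val := by
      rw [_root_.mul_inv_rev, Units.val_mul, Units.val_mul]
      simp only [mul_assoc]
    rw [e]
    exact (h _).trans (h' A)
  inv_mem' {g} h A := by
    rw [← h, inv_inv]
    have : g.val * ((g⁻¹).val * A * g.val) * (g⁻¹).val =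
        (g.val * (g⁻¹).val) * A * (g.val * (g⁻¹).val) := by simp only [mul_assoc]
    rw [this]
    simp

theorem mem_lieNormalizer_of_forall {g : GL (Fin n) L}
    (h : ∀ A ∈ S.lie, g.val * A * (g⁻¹).val ∈ S.lie)
    (h' : ∀ A ∈ S.lie, (g⁻¹).val * A * g.val ∈ S.lie) : g ∈ S.lieNormalizer := by
  intro A
  refine ⟨fun hA => ?_, h A⟩
  have := h' _ hA
  have e : (g⁻¹).val * (g.val * A * (g⁻¹).val) * g.val =
        ((g⁻¹).val * g.val) * A * ((g⁻¹).val * g.val) := by simp only [mul_assoc]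
  rw [e] at this
  simpa using this

theorem expGL_mem_lieNormalizer [CharZero L] {N : Matrix (Fin n) (Fin n) L} (hN : IsNilpotent N)
    (h : N ∈ S.lie) : expGL N hN ∈ S.lieNormalizer := by
  refine S.mem_lieNormalizer_of_forall (fun A hA => ?_) (fun A hA => ?_)
  · exact exp_conj_mem _ hN (fun B hB => S.bracket_mem_lie h hB) hA
  · have := exp_conj_mem S.lie hN.neg
      (fun B hB => S.bracket_mem_lie (Submodule.neg_mem _ h) hB) hA
    rwa [neg_neg] at this

end Lie

/-! ### Root elements and torus elements -/

/-- The element `exp(c e_α)`. -/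
noncomputable def rootElt [CharZero L] (i : ι) (c : L) : GL (Fin n) L :=
  expGL (c • S.e i) ((S.isNilpotent_e i).smul c)

/-- The diagonal matrix (in the weight basis) attached to a point of the torus. -/
def torusElt (t : Multiplicative X →* Lˣ) : GL (Fin n) L where
  val := S.diag fun x => (t (Multiplicative.ofAdd x) : L)
  inv := S.diag fun x => ((t (Multiplicative.ofAdd x))⁻¹ : Lˣ)
  val_inv := by simp [diag]
  inv_val := by simp [diag]

theorem torusElt_val (t : Multiplicative X →* Lˣ) :
    (S.torusElt t).val = S.diag fun x => (t (Multiplicative.ofAdd x) : L) := rfl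

theorem torusElt_inv_val (t : Multiplicative X →* Lˣ) :
    ((S.torusElt t)⁻¹).val = S.diag fun x => ((t (Multiplicative.ofAdd x))⁻¹ : Lˣ) := rfl

theorem torusElt_mul (t t' : Multiplicative X →* Lˣ) :
    S.torusElt (t * t') = S.torusElt t * S.torusElt t' := by
  ext a b
  rw [Units.val_mul, torusElt_val, torusElt_val, torusElt_val, diag_mul_apply]
  by_cases hab : a = b
  · rw [hab, diag_apply_eq, diag_apply_eq, MonoidHom.mul_apply, Units.val_mul]
  · rw [S.diag_apply_ne _ hab, S.diag_apply_ne _ hab, mul_zero]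

/-- The torus, in the weight basis, as a homomorphism into the general linear group. -/
def torusEltHom : (Multiplicative X →* Lˣ) →* GL (Fin n) L :=
  MonoidHom.mk' S.torusElt S.torusElt_mul

variable [CharZero L]

theorem rootElt_val (i : ι) (c : L) : (S.rootElt i c).val = IsNilpotent.exp (c • S.e i) := rfl

omit [CharZero L] in
theorem isNilpotent_smul_e (i : ι) (c : L) : IsNilpotent (c • S.e i) :=
  (S.isNilpotent_e i).smul c

theorem rootElt_add (i : ι) (c c' : L) : S.rootElt i (c + c') = S.rootElt i c * S.rootElt i c' := by
  ext1
  rw [Units.val_mul, rootElt_val, rootElt_val, rootElt_val, add_smul,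
    IsNilpotent.exp_add_of_commute _ (S.isNilpotent_smul_e i c) (S.isNilpotent_smul_e i c')]
  rw [Commute, SemiconjBy, smul_mul_smul_comm, smul_mul_smul_comm, mul_comm]

@[simp]
theorem rootElt_zero (i : ι) : S.rootElt i 0 = 1 := by
  ext1
  rw [rootElt_val, zero_smul, IsNilpotent.exp_zero, Units.val_one]

theorem rootElt_neg (i : ι) (c : L) : S.rootElt i (-c) = (S.rootElt i c)⁻¹ := by
  rw [eq_inv_iff_mul_eq_one, ← rootElt_add, neg_add_cancel, rootElt_zero]

/-- The group of points, in the weight basis. -/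
noncomputable def grp : Subgroup (GL (Fin n) L) :=
  Subgroup.closure (Set.range S.torusElt ∪ {g | ∃ i c, g = S.rootElt i c})

theorem torusElt_mem_grp (t : Multiplicative X →* Lˣ) : S.torusElt t ∈ S.grp :=
  Subgroup.subset_closure (Or.inl ⟨t, rfl⟩)

theorem rootElt_mem_grp (i : ι) (c : L) : S.rootElt i c ∈ S.grp :=
  Subgroup.subset_closure (Or.inr ⟨i, c, rfl⟩)

theorem rootElt_mem_lieNormalizer [Fintype ι] (i : ι) (c : L) :
    S.rootElt i c ∈ S.lieNormalizer :=
  S.expGL_mem_lieNormalizer _ (Submodule.smul_mem _ _ (S.e_mem_lie i))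

/-- Conjugation takes root elements to root elements if it does so for the root vectors. -/
theorem conj_rootElt {g : GL (Fin n) L} {i j : ι} {c : L}
    (h : g.val * S.e i * (g⁻¹).val = c • S.e j) (a : L) :
    g * S.rootElt i a * g⁻¹ = S.rootElt j (a * c) := by
  ext1
  rw [Units.val_mul, Units.val_mul, rootElt_val, rootElt_val]
  have h1 : a • S.e i = (g⁻¹).val * ((a * c) • S.e j) * g.val := by
    rw [mul_smul, ← h, mul_smul_comm, smul_mul_assoc]
    congr 1
    have : (g⁻¹).val * (g.val * S.e i * (g⁻¹).val) * g.val =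
        ((g⁻¹).val * g.val) * S.e i * ((g⁻¹).val * g.val) := by simp only [mul_assoc]
    rw [this]
    simp
  obtain ⟨m, hm⟩ := S.isNilpotent_smul_e i a
  obtain ⟨m', hm'⟩ := S.isNilpotent_smul_e j (a * c)
  have hm1 : (a • S.e i) ^ (m + m') = 0 := by rw [pow_add, hm, zero_mul]
  have hm2 : ((a * c) • S.e j) ^ (m + m') = 0 := by rw [pow_add, hm', mul_zero]
  rw [IsNilpotent.exp_eq_sum hm1, IsNilpotent.exp_eq_sum hm2, Finset.mul_sum, Finset.sum_mul]
  refine Finset.sum_congr rfl fun k _ => ?_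
  rw [mul_smul_comm, smul_mul_assoc]
  congr 1
  have := Units.conj_pow' g ((a * c) • S.e j) k
  rw [h1, this]
  have e : g.val * ((g⁻¹).val * ((a * c) • S.e j) ^ k * g.val) * (g⁻¹).val =
      (g.val * (g⁻¹).val) * ((a * c) • S.e j) ^ k * (g.val * (g⁻¹).val) := by
    simp only [mul_assoc]
  rw [e]
  simp

/-! ### Matrices that permute the weight spaces -/

omit [CharZero L]

/-- The matrix `g` maps the weight space of weight `x` to that of weight `w x`, where `w` is an
automorphism of the character lattice. -/
def HasType (g : Matrix (Fin n) (Fin n) L) (w : X ≃ₗ[ℤ] X) : Prop :=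
  ∀ a b, g a b ≠ 0 → S.wt a = w (S.wt b)

variable {S}

theorem HasType.mul {g g' : Matrix (Fin n) (Fin n) L} {w w' : X ≃ₗ[ℤ] X} (h : S.HasType g w)
    (h' : S.HasType g' w') : S.HasType (g * g') (w * w') := by
  intro a b hab
  rw [Matrix.mul_apply] at hab
  obtain ⟨c, -, hc⟩ := Finset.exists_ne_zero_of_sum_ne_zero hab
  rw [h a c (left_ne_zero_of_mul hc), h' c b (right_ne_zero_of_mul hc)]
  rfl

theorem hasType_diag (h : X → L) : S.HasType (S.diag h) 1 := by
  intro a b hab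
  by_cases hne : a = b
  · rw [hne]; rfl
  · exact absurd (S.diag_apply_ne h hne) hab

theorem hasType_one : S.HasType (1 : Matrix (Fin n) (Fin n) L) 1 := by
  intro a b hab
  by_cases hne : a = b
  · rw [hne]; rfl
  · exact absurd (Matrix.one_apply_ne hne) hab

theorem HasType.mul_diag {g : Matrix (Fin n) (Fin n) L} {w : X ≃ₗ[ℤ] X} (h : S.HasType g w)
    (f : X → L) : g * S.diag f = S.diag (fun x => f (w⁻¹ x)) * g := by
  ext a b
  rw [diag_mul_apply, mul_diag_apply]
  by_cases hab : g a b = 0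
  · simp [hab]
  · rw [h a b hab]
    have : w⁻¹ (w (S.wt b)) = S.wt b := w.symm_apply_apply _
    rw [this, mul_comm]

theorem HasType.inv {g : GL (Fin n) L} {w : X ≃ₗ[ℤ] X} (h : S.HasType g.val w) :
    S.HasType (g⁻¹).val w⁻¹ := by
  classical
  intro a b hab
  let f : X → L := fun x => if x = S.wt a then 1 else 0
  have h1 := h.mul_diag f
  have h2 : S.diag f * (g⁻¹).val = (g⁻¹).val * S.diag (fun x => f (w⁻¹ x)) := by
    have : S.diag f * (g⁻¹).val = (g⁻¹).val * (g.val * S.diag f) * (g⁻¹).val := by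
      rw [← mul_assoc]; simp
    rw [this, h1, mul_assoc, mul_assoc]
    simp
  have h3 := congrFun (congrFun h2 a) b
  rw [diag_mul_apply, mul_diag_apply] at h3
  simp only [f, if_true, one_mul] at h3
  by_contra hne
  rw [if_neg (Ne.symm hne), mul_zero] at h3
  exact hab h3

theorem exists_apply_ne_zero (g : GL (Fin n) L) (b : Fin n) : ∃ a, g.val a b ≠ 0 := by
  by_contra! h
  have h1 : ((g⁻¹).val * g.val) b b = 1 := by simp
  rw [Matrix.mul_apply, Finset.sum_eq_zero] at h1
  · exact zero_ne_one h1
  · intro a _; rw [h a, mul_zero]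

theorem HasType.unique {g : GL (Fin n) L} {w w' : X ≃ₗ[ℤ] X} (h : S.HasType g.val w)
    (h' : S.HasType g.val w') : w = w' := by
  ext x
  refine S.forall_of_forall_wt
    (AddMonoidHom.eqLocus (w : X →ₗ[ℤ] X).toAddMonoidHom (w' : X →ₗ[ℤ] X).toAddMonoidHom) (fun b => ?_) x
  obtain ⟨a, ha⟩ := exists_apply_ne_zero g b
  exact (h a b ha).symm.trans (h' a b ha)

/-- Conjugating a matrix of weight `μ` by a matrix of type `w` gives a matrix of weight `w μ`. -/
theorem HasType.conj_weight {g : GL (Fin n) L} {w : X ≃ₗ[ℤ] X} (h : S.HasType g.val w)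
    {A : Matrix (Fin n) (Fin n) L} {μ : X} (hA : ∀ a b, A a b ≠ 0 → S.wt a = S.wt b + μ)
    (a b : Fin n) (hab : (g.val * A * (g⁻¹).val) a b ≠ 0) : S.wt a = S.wt b + w μ := by
  rw [Matrix.mul_apply] at hab
  obtain ⟨c, -, hc⟩ := Finset.exists_ne_zero_of_sum_ne_zero hab
  have h1 := left_ne_zero_of_mul hc
  rw [Matrix.mul_apply] at h1
  obtain ⟨d, -, hd⟩ := Finset.exists_ne_zero_of_sum_ne_zero h1
  rw [h a d (left_ne_zero_of_mul hd), hA d c (right_ne_zero_of_mul hd),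
    h.inv c b (right_ne_zero_of_mul hc), map_add]
  congr 1
  exact w.apply_symm_apply _

variable (S) in
theorem hasType_torusElt (t : Multiplicative X →* Lˣ) : S.HasType (S.torusElt t).val 1 := by
  rw [torusElt_val]
  exact hasType_diag _

theorem conj_ne_zero (g : GL (Fin n) L) {A : Matrix (Fin n) (Fin n) L} (hA : A ≠ 0) :
    g.val * A * (g⁻¹).val ≠ 0 := by
  intro h
  apply hA
  have : (g⁻¹).val * (g.val * A * (g⁻¹).val) * g.val =
      ((g⁻¹).val * g.val) * A * ((g⁻¹).val * g.val) := by simp only [mul_assoc]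
  rw [h] at this
  simpa using this.symm

/-- A nonzero element of the Lie algebra of weight `μ ≠ 0` is a multiple of a root vector. -/
theorem exists_root_of_mem_lie [Fintype ι] {A : Matrix (Fin n) (Fin n) L} {μ : X} (hμ : μ ≠ 0)
    (hA : A ∈ S.lie) (hA0 : A ≠ 0) (hwt : ∀ a b, A a b ≠ 0 → S.wt a = S.wt b + μ) :
    ∃ (j : ι) (c : L), P.root j = μ ∧ c ≠ 0 ∧ A = c • S.e j := by
  obtain ⟨h, c, rfl⟩ := hA
  obtain ⟨a, b, hab⟩ : ∃ a b, (S.diag h + ∑ i, c i • S.e i) a b ≠ 0 := by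
    by_contra! h0
    exact hA0 (by ext a b; simpa using h0 a b)
  have h1 := hwt a b hab
  obtain ⟨j, hj⟩ : ∃ j, P.root j = μ := by
    by_contra! hcon
    refine hab (S.lie_apply_of_not_root ?_ ?_)
    · rw [h1]; simpa using hμ
    · intro i h2
      exact hcon i (add_left_cancel (h2.symm.trans h1))
  have hA : S.diag h + ∑ i, c i • S.e i = c j • S.e j := by
    ext a b
    by_cases h2 : S.wt a = S.wt b + μ
    · rw [S.lie_apply_of_wt (i := j) (by rw [h2, hj])]
      rfl
    · rw [Matrix.smul_apply, S.e_apply_eq_zero (by rw [hj]; exact h2), smul_zero]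
      by_contra h3
      exact h2 (hwt a b h3)
  refine ⟨j, c j, hj, fun h0 => ?_, hA⟩
  rw [h0, zero_smul] at hA
  exact hA0 hA

/-- A matrix of type `w` normalizing the Lie algebra permutes the root vectors, up to scalars. -/
theorem HasType.conj_e [Fintype ι] [CharZero L] {g : GL (Fin n) L} {w : X ≃ₗ[ℤ] X}
    (h : S.HasType g.val w) (hg : g ∈ S.lieNormalizer) (i : ι) :
    ∃ (j : ι) (c : L), P.root j = w (P.root i) ∧ c ≠ 0 ∧ g.val * S.e i * (g⁻¹).val = c • S.e j := by
  refine exists_root_of_mem_lie ?_ ((hg _).2 (S.e_mem_lie i)) (conj_ne_zero g (S.e_ne_zero i))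
    (h.conj_weight (S.wt_eq i))
  intro h0
  exact P.ne_zero i (w.injective (h0.trans (map_zero w).symm))

theorem torusElt_mem_lieNormalizer [Fintype ι] (t : Multiplicative X →* Lˣ) :
    S.torusElt t ∈ S.lieNormalizer := by
  have key : ∀ t : Multiplicative X →* Lˣ, ∀ A ∈ S.lie,
      (S.torusElt t).val * A * ((S.torusElt t)⁻¹).val ∈ S.lie := by
    intro t A hA
    refine S.lie_induction (p := fun A => (S.torusElt t).val * A * ((S.torusElt t)⁻¹).val ∈ S.lie)
      (fun h => ?_) (fun i => ?_) (fun A B hA hB => ?_) (fun c A hA => ?_) hA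
    · rw [torusElt_val, diag_comm, mul_assoc, ← torusElt_val, Units.mul_inv, mul_one]
      exact S.diag_mem_lie h
    · have : (S.torusElt t).val * S.e i * ((S.torusElt t)⁻¹).val =
          (t (Multiplicative.ofAdd (P.root i)) : L) • S.e i := by
        ext a b
        rw [torusElt_val, torusElt_inv_val, mul_diag_apply, diag_mul_apply, Matrix.smul_apply,
          smul_eq_mul]
        by_cases hab : S.e i a b = 0
        · simp [hab]
        · rw [S.wt_eq i a b hab, ofAdd_add, map_mul]
          push_cast
          have : (t (Multiplicative.ofAdd (S.wt b)) : L) ≠ 0 := Units.ne_zero _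
          field_simp
      rw [this]
      exact Submodule.smul_mem _ _ (S.e_mem_lie i)
    · rw [mul_add, add_mul]
      exact Submodule.add_mem _ hA hB
    · rw [mul_smul_comm, smul_mul_assoc]
      exact Submodule.smul_mem _ _ hA
  refine S.mem_lieNormalizer_of_forall (key t) fun A hA => ?_
  have h1 := key t⁻¹ A hA
  have h2 : S.torusElt t⁻¹ = (S.torusElt t)⁻¹ := map_inv S.torusEltHom t
  rwa [h2, inv_inv] at h1

theorem grp_le_lieNormalizer [Fintype ι] [CharZero L] : S.grp ≤ S.lieNormalizer := by
  rw [grp, Subgroup.closure_le]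
  rintro _ (⟨t, rfl⟩ | ⟨i, c, rfl⟩)
  · exact torusElt_mem_lieNormalizer t
  · exact S.rootElt_mem_lieNormalizer i c

end SplitReductive

end

section

open Matrix

namespace SplitReductive

variable {ι X Y : Type*} [AddCommGroup X] [AddCommGroup Y] {P : RootDatum ι X Y}
  {L : Type*} [Field L] {n : ℕ} (S : SplitReductive P L n)

/-! ### Unipotent subgroups -/

/-- The grading of the weight basis by a functional on the character lattice. -/
def deg (f : Module.Dual ℤ X) (a : Fin n) : ℤ := f (S.wt a)

theorem e_mem_degFilt' {f : Module.Dual ℤ X} {i : ι} {k : ℤ} (h : f (P.root i) = k) :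
    S.e i ∈ degFilt L (S.deg f) k :=
  h ▸ S.e_mem_degFilt f.toAddMonoidHom i

variable [CharZero L]

theorem rootElt_sub_one_mem {f : Module.Dual ℤ X} {i : ι} (hi : 0 < f (P.root i)) (c : L) :
    (S.rootElt i c).val - 1 ∈ degFilt L (S.deg f) (f (P.root i)) :=
  exp_sub_one_mem_degFilt (by omega) (Submodule.smul_mem _ _ (S.e_mem_degFilt' rfl))

/-- The subgroup generated by the root groups of a set of roots. -/
noncomputable def rootGroup (s : Set ι) : Subgroup (GL (Fin n) L) :=
  Subgroup.closure {g | ∃ i ∈ s, ∃ c, g = S.rootElt i c}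

variable {S} in
theorem rootElt_mem_rootGroup {s : Set ι} {i : ι} (hi : i ∈ s) (c : L) :
    S.rootElt i c ∈ S.rootGroup s :=
  Subgroup.subset_closure ⟨i, hi, c, rfl⟩

theorem rootGroup_le_grp (s : Set ι) : S.rootGroup s ≤ S.grp := by
  rw [rootGroup, Subgroup.closure_le]
  rintro _ ⟨i, -, c, rfl⟩
  exact S.rootElt_mem_grp i c

theorem rootGroup_le_unipotentSubgroup (f : Module.Dual ℤ X) :
    S.rootGroup {i | 0 < f (P.root i)} ≤ unipotentSubgroup L (S.deg f) := by
  rw [rootGroup, Subgroup.closure_le]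
  rintro _ ⟨i, hi, c, rfl⟩
  exact degFilt_mono (show 1 ≤ f (P.root i) from hi) (S.rootElt_sub_one_mem hi c)

/-- A combination of root vectors of degree `k` is, up to higher degree, the unipotent part of a
product of root elements. -/
theorem exists_mem_rootGroup_sub (f : Module.Dual ℤ X) {k : ℤ} (hk : 1 ≤ k) (c : ι → L)
    (s : Finset ι) (hs : ∀ i ∈ s, f (P.root i) = k) :
    ∃ v ∈ S.rootGroup {i | 0 < f (P.root i)},
      v.val - 1 - ∑ i ∈ s, c i • S.e i ∈ degFilt L (S.deg f) (k + 1) := by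
  classical
  induction s using Finset.induction_on with
  | empty => exact ⟨1, Subgroup.one_mem _, by simp⟩
  | insert i s his ih =>
    have hs' : ∀ j ∈ s, f (P.root j) = k := fun j hj => hs j (Finset.mem_insert_of_mem hj)
    obtain ⟨v, hv, hv'⟩ := ih hs'
    have hi : f (P.root i) = k := hs i (Finset.mem_insert_self _ _)
    have hi0 : 0 < f (P.root i) := by omega
    have hmem : i ∈ {i | 0 < f (P.root i)} := hi0
    refine ⟨v * S.rootElt i (c i), Subgroup.mul_mem _ hv (rootElt_mem_rootGroup hmem _), ?_⟩
    have hx := S.rootElt_sub_one_mem hi0 (c i)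
    rw [hi] at hx
    have hx' : (S.rootElt i (c i)).val - 1 - c i • S.e i ∈ degFilt L (S.deg f) (k + 1) :=
      exp_sub_mem_degFilt hk (Submodule.smul_mem _ _ (S.e_mem_degFilt' hi))
    have hsum : ∑ j ∈ s, c j • S.e j ∈ degFilt L (S.deg f) k :=
      Submodule.sum_mem _ fun j hj => Submodule.smul_mem _ _
        (S.e_mem_degFilt' (hs' j hj))
    have hv1 : v.val - 1 ∈ degFilt L (S.deg f) k := by
      have := Submodule.add_mem _ (degFilt_mono (show k ≤ k + 1 by omega) hv') hsum
      simpa using this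
    have e : (v * S.rootElt i (c i)).val - 1 - ∑ j ∈ insert i s, c j • S.e j =
        (v.val - 1 - ∑ j ∈ s, c j • S.e j) + ((S.rootElt i (c i)).val - 1 - c i • S.e i) +
          (v.val - 1) * ((S.rootElt i (c i)).val - 1) := by
      rw [Finset.sum_insert his, Units.val_mul]
      generalize (S.rootElt i (c i)).val = B
      generalize ∑ j ∈ s, c j • S.e j = C
      generalize c i • S.e i = D
      rw [mul_sub, sub_mul, sub_mul, one_mul, mul_one, mul_one]
      abel
    rw [e]
    exact Submodule.add_mem _ (Submodule.add_mem _ hv' hx')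
      (degFilt_mono (show k + 1 ≤ k + k by omega) (mul_mem_degFilt hv1 hx))

/-- A unipotent matrix which is upper triangular with respect to a functional `f` and normalizes
the Lie algebra lies in the group generated by the root groups on which `f` is positive. If
`u = 1 + u_k + ⋯` with `u_k` of lowest degree `k`, then the component of degree `k` of
`u D u⁻¹ - D` is `-k u_k`, where `D` is the element of the Lie algebra of the torus given by `f`;
thus `u_k` lies in the Lie algebra, and it is removed by a product of root elements. -/
theorem mem_rootGroup_of_unipotent [Fintype ι] (f : Module.Dual ℤ X) {u : GL (Fin n) L}
    (hu : u ∈ S.lieNormalizer) (hu' : u ∈ unipotentSubgroup L (S.deg f)) :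
    u ∈ S.rootGroup {i | 0 < f (P.root i)} := by
  obtain ⟨K, hK⟩ := exists_degFilt_bound (S.deg f)
  -- induction on the lowest degree `k`; there are no nonzero entries of degree `K` or more
  have key : ∀ (m : ℕ) (k : ℤ) (u : GL (Fin n) L), 1 ≤ k → K ≤ k + m → u ∈ S.lieNormalizer →
      u.val - 1 ∈ degFilt L (S.deg f) k → u ∈ S.rootGroup {i | 0 < f (P.root i)} := by
    intro m
    induction m with
    | zero =>
      intro k u _ hKk _ hu
      have : u = 1 := by
        ext1
        rw [Units.val_one, ← sub_eq_zero]
        ext a b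
        refine hu a b ?_
        have := (hK a b).1
        push_cast at hKk
        omega
      exact this ▸ Subgroup.one_mem _
    | succ m ih =>
      intro k u hk hKk hN hu
      have hu1 : u.val - 1 ∈ degFilt L (S.deg f) 1 := degFilt_mono hk hu
      let h : X →+ L := (Int.castAddHom L).comp f.toAddMonoidHom
      have hh : ∀ a, h (S.wt a) = (S.deg f a : L) := fun a => rfl
      set A := u.val * S.diag h * (u⁻¹).val - S.diag h with hA
      have hAlie : A ∈ S.lie := Submodule.sub_mem _ ((hN _).2 (S.diag_mem_lie h)) (S.diag_mem_lie h)
      have hAu : A * u.val = u.val * S.diag h - S.diag h * u.val := by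
        rw [hA, sub_mul, mul_assoc, ← Units.val_mul, inv_mul_cancel, Units.val_one, mul_one]
      have hent : ∀ a b, (A * u.val) a b =
          (u.val - 1) a b * ((S.deg f b : L) - (S.deg f a : L)) := by
        intro a b
        rw [hAu, Matrix.sub_apply, Matrix.sub_apply, diag_mul_apply, mul_diag_apply, hh, hh]
        by_cases hab : a = b
        · subst hab; ring
        · rw [Matrix.one_apply_ne hab]; ring
      have hAuk : A * u.val ∈ degFilt L (S.deg f) k := by
        intro a b hab
        rw [hent, hu a b hab, zero_mul]
      have hAk : A ∈ degFilt L (S.deg f) k := mem_degFilt_of_mul_unipotent hu1 hAuk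
      have hAu2 := degFilt_mono (show k + 1 ≤ k + k by omega) (mul_mem_degFilt hAk hu)
      obtain ⟨h', c, hc⟩ := S.mem_lie.1 hAlie
      let s : Finset ι := Finset.univ.filter fun i => f (P.root i) = k
      have hs : ∀ i ∈ s, f (P.root i) = k := fun i hi => (Finset.mem_filter.1 hi).2
      have hk0 : (k : L) ≠ 0 := by
        rw [Int.cast_ne_zero]; omega
      -- the component of degree `k` of `u - 1` is a combination of the root vectors of degree `k`
      have hu_k : u.val - 1 - ∑ i ∈ s, (-(k : L)⁻¹ * c i) • S.e i ∈
          degFilt L (S.deg f) (k + 1) := by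
        intro a b hab
        rw [Matrix.sub_apply]
        rcases lt_or_ge (S.deg f a) (S.deg f b + k) with h1 | h1
        · have h2 : ∑ i ∈ s, (-(k : L)⁻¹ * c i) • S.e i ∈ degFilt L (S.deg f) k :=
            Submodule.sum_mem _ fun i hi => Submodule.smul_mem _ _ (S.e_mem_degFilt' (hs i hi))
          rw [hu a b h1, h2 a b h1, sub_zero]
        · have hdeg : S.deg f a = S.deg f b + k := by omega
          have h3 : A a b = -(k : L) * (u.val - 1) a b := by
            have h4 := hAu2 a b hab
            rw [mul_sub, mul_one, Matrix.sub_apply, sub_eq_zero] at h4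
            rw [← h4, hent, hdeg]
            push_cast
            ring
          have hne : a ≠ b := by
            rintro rfl; omega
          have h5 : A a b = ∑ i ∈ s, c i * S.e i a b := by
            rw [hc, Matrix.add_apply, diag_apply_ne _ _ hne, zero_add, Matrix.sum_apply]
            symm
            refine Finset.sum_subset (Finset.filter_subset _ _) fun i _ hi => ?_
            change c i * S.e i a b = 0
            by_contra h6
            have h7 := S.wt_eq i a b (right_ne_zero_of_mul h6)
            apply hi
            simp only [s, Finset.mem_filter, Finset.mem_univ, true_and]
            have h8 : S.deg f a = S.deg f b + f (P.root i) := by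
              simp only [deg, h7, map_add]
            omega
          have h9 : (∑ i ∈ s, (-(k : L)⁻¹ * c i) • S.e i) a b = -(k : L)⁻¹ * A a b := by
            rw [h5, Matrix.sum_apply, Finset.mul_sum]
            refine Finset.sum_congr rfl fun i _ => ?_
            rw [Matrix.smul_apply, smul_eq_mul, mul_assoc]
          rw [h9, h3]
          field_simp
          ring
      obtain ⟨v, hv, hv'⟩ := S.exists_mem_rootGroup_sub f hk (fun i => -(k : L)⁻¹ * c i) s hs
      have hvN : v ∈ S.lieNormalizer := grp_le_lieNormalizer (S.rootGroup_le_grp _ hv)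
      have hw : (v⁻¹ * u).val - 1 ∈ degFilt L (S.deg f) (k + 1) := by
        refine mem_degFilt_of_unipotent_mul (S.rootGroup_le_unipotentSubgroup f hv) ?_
        have e : v.val * ((v⁻¹ * u).val - 1) = u.val - v.val := by
          rw [mul_sub, ← Units.val_mul, mul_inv_cancel_left, mul_one]
        rw [e]
        have := Submodule.sub_mem _ hu_k hv'
        rwa [sub_sub_sub_cancel_right, sub_sub_sub_cancel_right] at this
      have := ih (k + 1) (v⁻¹ * u) (by omega) (by push_cast at hKk; omega)
        (Subgroup.mul_mem _ (Subgroup.inv_mem _ hvN) hN) hw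
      simpa using Subgroup.mul_mem _ hv this
  exact key K 1 u le_rfl (by omega) hu hu'

theorem rootElt_mem_degFilt_zero {f : Module.Dual ℤ X} {i : ι} (hi : f (P.root i) = 0) (c : L) :
    (S.rootElt i c).val ∈ degFilt L (S.deg f) 0 := by
  obtain ⟨m, hm⟩ := S.isNilpotent_smul_e i c
  rw [rootElt_val, IsNilpotent.exp_eq_sum hm]
  refine Submodule.sum_mem _ fun k _ => rat_smul_mem _ _ ?_
  have := pow_mem_degFilt (Submodule.smul_mem _ c (S.e_mem_degFilt' hi)) k
  rwa [mul_zero] at this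

/-- An element of degree zero for a functional `f` that normalizes the Lie algebra
normalizes the group generated by the root groups on which `f` is positive. -/
theorem conj_mem_rootGroup [Fintype ι] {f : Module.Dual ℤ X} {g u : GL (Fin n) L}
    (hg : g ∈ S.lieNormalizer) (hg0 : g.val ∈ degFilt L (S.deg f) 0)
    (hg0' : (g⁻¹).val ∈ degFilt L (S.deg f) 0)
    (hu : u ∈ S.rootGroup {i | 0 < f (P.root i)}) :
    g * u * g⁻¹ ∈ S.rootGroup {i | 0 < f (P.root i)} := by
  apply S.mem_rootGroup_of_unipotent f
  · exact Subgroup.mul_mem _ (Subgroup.mul_mem _ hg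
      (grp_le_lieNormalizer (S.rootGroup_le_grp _ hu))) (Subgroup.inv_mem _ hg)
  · have e : (g * u * g⁻¹).val - 1 = g.val * (u.val - 1) * (g⁻¹).val := by
      rw [mul_sub, sub_mul, mul_one, ← Units.val_mul, ← Units.val_mul, ← Units.val_mul,
        mul_inv_cancel, Units.val_one]
    have := mul_mem_degFilt (mul_mem_degFilt hg0 (S.rootGroup_le_unipotentSubgroup f hu)) hg0'
    change (g * u * g⁻¹).val - 1 ∈ degFilt L (S.deg f) 1
    rw [e]
    simpa using this

omit [CharZero L] in
theorem degFilt_zero_of_hasType_one {f : Module.Dual ℤ X} {g : Matrix (Fin n) (Fin n) L}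
    (hg : S.HasType g 1) : g ∈ degFilt L (S.deg f) 0 := by
  intro a b hab
  by_contra h
  have : S.deg f a = S.deg f b := congrArg f (hg a b h)
  omega

end SplitReductive

end

section

open Matrix

namespace SplitReductive

variable {ι X Y : Type*} [AddCommGroup X] [AddCommGroup Y] {P : RootDatum ι X Y}
  {L : Type*} [Field L] {n : ℕ} (S : SplitReductive P L n)

/-! ### Torus elements and reflections -/

/-- The torus, in the weight basis. -/
def tor : Subgroup (GL (Fin n) L) := S.torusEltHom.range

variable {S}

theorem torusElt_mem_tor (t : Multiplicative X →* Lˣ) : S.torusElt t ∈ S.tor := ⟨t, rfl⟩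

theorem hasType_one_of_mem_tor {g : GL (Fin n) L} (hg : g ∈ S.tor) : S.HasType g.val 1 := by
  obtain ⟨t, rfl⟩ := hg
  exact S.hasType_torusElt t

theorem tor_le_grp [CharZero L] : S.tor ≤ S.grp := by
  rintro _ ⟨t, rfl⟩
  exact S.torusElt_mem_grp t

theorem torusElt_conj_e (t : Multiplicative X →* Lˣ) (i : ι) :
    (S.torusElt t).val * S.e i * ((S.torusElt t)⁻¹).val =
      (t (Multiplicative.ofAdd (P.root i)) : L) • S.e i := by
  ext a b
  rw [torusElt_val, torusElt_inv_val, mul_diag_apply, diag_mul_apply, Matrix.smul_apply,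
    smul_eq_mul]
  by_cases hab : S.e i a b = 0
  · simp [hab]
  · rw [S.wt_eq i a b hab, ofAdd_add, map_mul]
    push_cast
    have : (t (Multiplicative.ofAdd (S.wt b)) : L) ≠ 0 := Units.ne_zero _
    field_simp

theorem HasType.conj_mem_tor {g : GL (Fin n) L} {w : X ≃ₗ[ℤ] X} (h : S.HasType g.val w)
    {t : GL (Fin n) L} (ht : t ∈ S.tor) : g * t * g⁻¹ ∈ S.tor := by
  obtain ⟨t, rfl⟩ := ht
  refine ⟨t.comp (AddMonoidHom.toMultiplicative
    ((w⁻¹ : X ≃ₗ[ℤ] X) : X →ₗ[ℤ] X).toAddMonoidHom), ?_⟩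
  rw [eq_mul_inv_iff_mul_eq]
  ext1
  rw [Units.val_mul, Units.val_mul]
  exact (h.mul_diag (fun x => (t (Multiplicative.ofAdd x) : L))).symm

theorem hasType_of_mul_diag [CharZero L] {g : GL (Fin n) L} {w : X ≃ₗ[ℤ] X}
    (h : ∀ h : X →+ L, g.val * S.diag h = S.diag (fun x => h (w⁻¹ x)) * g.val) :
    S.HasType g.val w := by
  intro a b hab
  have h1 : w⁻¹ (S.wt a) = S.wt b := by
    by_contra hne
    obtain ⟨y, hy⟩ := P.exists_cocharHom_ne_zero L (sub_ne_zero.2 hne)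
    have h2 := congrFun (congrFun (h (P.cocharHom L y)) a) b
    rw [mul_diag_apply, diag_mul_apply, mul_comm] at h2
    have h3 := mul_right_cancel₀ hab h2
    exact hy (by rw [map_sub, h3, sub_self])
  rw [← h1]
  exact (w.apply_symm_apply _).symm

/-- The torus element obtained by evaluating a cocharacter at a unit. -/
def cocharElt (P : RootDatum ι X Y) (y : Y) (d : Lˣ) : Multiplicative X →* Lˣ where
  toFun x := d ^ (P.toLinearMap x.toAdd y)
  map_one' := by simp
  map_mul' x x' := by simp [_root_.zpow_add]

variable [CharZero L]

theorem rootElt_conj_diag (i : ι) (c : L) (h : X →+ L) :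
    (S.rootElt i c).val * S.diag h * ((S.rootElt i c)⁻¹).val =
      S.diag h - (c * h (P.root i)) • S.e i := by
  have h1 : adMat (c • S.e i) (S.diag h) = -((c * h (P.root i)) • S.e i) := by
    rw [adMat_apply, smul_mul_assoc, mul_smul_comm, ← smul_sub, ← neg_sub, diag_mul_e, smul_neg,
      smul_smul]
  have h2 : adMat (c • S.e i) (adMat (c • S.e i) (S.diag h)) = 0 := by
    rw [h1, map_neg, map_smul, adMat_apply, smul_mul_assoc, mul_smul_comm, sub_self, smul_zero,
      neg_zero]
  have := exp_conj_eq_of_triple (A := S.diag h) (S.isNilpotent_smul_e i c) (by rw [h2, map_zero])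
  rw [h2, h1, smul_zero, add_zero, ← sub_eq_add_neg] at this
  exact this

theorem rootElt_conj_e_self (i : ι) (c : L) :
    (S.rootElt i c).val * S.e i * ((S.rootElt i c)⁻¹).val = S.e i := by
  have h1 : adMat (c • S.e i) (S.e i) = 0 := by
    rw [adMat_apply, smul_mul_assoc, mul_smul_comm, sub_self]
  have := exp_conj_eq_of_triple (A := S.e i) (S.isNilpotent_smul_e i c)
    (by rw [h1, map_zero, map_zero])
  rw [h1, map_zero, smul_zero, add_zero, add_zero] at this
  exact this

theorem rootElt_conj_e_neg {i j : ι} (hij : P.root j = -P.root i) (c : L) :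
    (S.rootElt j c).val * S.e i * ((S.rootElt j c)⁻¹).val =
      S.e i - c • S.diag (P.cocharHom L (P.coroot i)) - (c ^ 2) • S.e j := by
  set H := P.cocharHom L (P.coroot i) with hH
  have h1 : adMat (c • S.e j) (S.e i) = -(c • S.diag H) := by
    rw [adMat_apply, smul_mul_assoc, mul_smul_comm, ← smul_sub, ← neg_sub, S.bracket_neg_eq hij,
      smul_neg]
  have hHj : H (P.root j) = -2 := by
    rw [hH, RootPairing.cocharHom_apply, hij, map_neg, LinearMap.neg_apply, P.root_coroot_two]
    norm_num
  have h2 : adMat (c • S.e j) (adMat (c • S.e j) (S.e i)) = (-2 * c ^ 2) • S.e j := by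
    rw [h1, map_neg, map_smul, adMat_apply, smul_mul_assoc, mul_smul_comm, ← smul_sub, ← neg_sub,
      diag_mul_e, hHj]
    module
  have h3 : adMat (c • S.e j) (adMat (c • S.e j) (adMat (c • S.e j) (S.e i))) = 0 := by
    rw [h2, map_smul, adMat_apply, smul_mul_assoc, mul_smul_comm, sub_self, smul_zero]
  have := exp_conj_eq_of_triple (A := S.e i) (S.isNilpotent_smul_e j c) h3
  rw [h2, h1, ← Rat.cast_smul_eq_qsmul L, smul_smul] at this
  refine (this : (S.rootElt j c).val * S.e i * ((S.rootElt j c)⁻¹).val = _).trans ?_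
  have e : (((2 : ℚ)⁻¹ : ℚ) : L) * (-2 * c ^ 2) = -c ^ 2 := by
    push_cast
    field_simp
  rw [e, neg_smul, ← sub_eq_add_neg, ← sub_eq_add_neg]

variable (S)

/-- A representative `exp(c e_α) exp(-c⁻¹ e_{-α}) exp(c e_α)` of the reflection in the
root `α`. -/
noncomputable def reflElt (i : ι) (c : L) : GL (Fin n) L :=
  S.rootElt i c * S.rootElt (P.reflectionPerm i i) (-c⁻¹) * S.rootElt i c

theorem reflElt_mem_grp (i : ι) (c : L) : S.reflElt i c ∈ S.grp :=
  Subgroup.mul_mem _ (Subgroup.mul_mem _ (S.rootElt_mem_grp _ _) (S.rootElt_mem_grp _ _))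
    (S.rootElt_mem_grp _ _)

theorem reflElt_neg (i : ι) (c : L) : S.reflElt i (-c) = (S.reflElt i c)⁻¹ := by
  simp only [reflElt, _root_.mul_inv_rev, ← rootElt_neg, inv_neg, mul_assoc]

theorem hasType_reflElt (i : ι) {c : L} (hc : c ≠ 0) :
    S.HasType (S.reflElt i c).val (P.reflection i) := by
  refine hasType_of_mul_diag fun h => ?_
  set j := P.reflectionPerm i i with hj
  have hij : P.root j = -P.root i := by simp [hj]
  set H := P.cocharHom L (P.coroot i) with hH
  have hHi : H (P.root i) = 2 := by
    rw [hH, RootPairing.cocharHom_apply, P.root_coroot_two]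
    norm_num
  have key : (S.reflElt i c).val * S.diag h * ((S.reflElt i c)⁻¹).val =
      S.diag h - h (P.root i) • S.diag H := by
    have e : (S.reflElt i c).val * S.diag h * ((S.reflElt i c)⁻¹).val =
        (S.rootElt i c).val * ((S.rootElt j (-c⁻¹)).val *
          ((S.rootElt i c).val * S.diag h * ((S.rootElt i c)⁻¹).val) *
          ((S.rootElt j (-c⁻¹))⁻¹).val) * ((S.rootElt i c)⁻¹).val := by
      simp only [reflElt, _root_.mul_inv_rev, Units.val_mul, mul_assoc, hj]
    rw [e, rootElt_conj_diag, mul_sub, sub_mul, mul_smul_comm, smul_mul_assoc, rootElt_conj_diag,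
      rootElt_conj_e_neg hij, hij]
    simp only [mul_sub, sub_mul, mul_smul_comm, smul_mul_assoc, rootElt_conj_diag,
      rootElt_conj_e_self]
    -- what remains is the image of `e_{-α}`, which occurs with total coefficient zero
    rw [← hH, hHi, map_neg]
    simp only [smul_sub, smul_smul]
    have e1 : (-c⁻¹ * -h (P.root i)) = c⁻¹ * h (P.root i) := by ring
    have e2 : c * h (P.root i) * (-c⁻¹) ^ 2 = c⁻¹ * h (P.root i) := by field_simp
    have e3 : c * h (P.root i) * -c⁻¹ = -h (P.root i) := by field_simp
    have e4 : c * h (P.root i) * (-c⁻¹ * (c * 2)) = - (2 * (c * h (P.root i))) := by field_simp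
    rw [e1, e2, e3, e4]
    module
  have hrefl : (fun x => h ((P.reflection i)⁻¹ x)) =
      ((h - (AddMonoidHom.mulLeft (h (P.root i))).comp H : X →+ L) : X → L) := by
    funext x
    have : (P.reflection i)⁻¹ = P.reflection i := P.reflection_inv i
    rw [this, P.reflection_apply, map_sub, map_zsmul]
    simp [hH, RootPairing.coroot', mul_comm]
  have hdiag : S.diag (fun x => h ((P.reflection i)⁻¹ x)) =
      S.diag h - h (P.root i) • S.diag H := by
    rw [hrefl]
    ext a b
    simp only [diag, Matrix.diagonal_apply, Matrix.sub_apply, Matrix.smul_apply]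
    split_ifs <;> simp
  rw [hdiag, ← key, mul_assoc, ← Units.val_mul, inv_mul_cancel, Units.val_one, mul_one]

variable {S}

theorem torusElt_conj_reflElt (t : Multiplicative X →* Lˣ) (i : ι) (c : L) :
    S.torusElt t * S.reflElt i c * (S.torusElt t)⁻¹ =
      S.reflElt i (c * t (Multiplicative.ofAdd (P.root i))) := by
  set j := P.reflectionPerm i i with hj
  have hij : P.root j = -P.root i := by simp [hj]
  have e : S.torusElt t * S.reflElt i c * (S.torusElt t)⁻¹ =
      (S.torusElt t * S.rootElt i c * (S.torusElt t)⁻¹) *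
      (S.torusElt t * S.rootElt j (-c⁻¹) * (S.torusElt t)⁻¹) *
      (S.torusElt t * S.rootElt i c * (S.torusElt t)⁻¹) := by
    rw [reflElt, ← hj]; group
  rw [e, S.conj_rootElt (torusElt_conj_e t i), S.conj_rootElt (torusElt_conj_e t j), hij, ofAdd_neg,
    map_inv, reflElt, mul_inv, Units.val_inv_eq_inv_val, neg_mul]

variable [IsAlgClosed L]

/-- Over an algebraically closed field, different representatives of a reflection differ by an
element of the torus: conjugation by the value of the coroot at a square root of `c` turns
the parameter `1` into `c`. -/
theorem reflElt_mul_inv_mem_tor (i : ι) {c : L} (hc : c ≠ 0) :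
    S.reflElt i c * (S.reflElt i 1)⁻¹ ∈ S.tor := by
  obtain ⟨d, hd⟩ := IsAlgClosed.exists_pow_nat_eq c (n := 2) (by norm_num)
  have hd0 : d ≠ 0 := by rintro rfl; exact hc (by rw [← hd]; ring)
  set t := cocharElt P (P.coroot i) (Units.mk0 d hd0) with ht
  have h1 : (t (Multiplicative.ofAdd (P.root i)) : L) = c := by
    rw [ht]
    simp only [cocharElt, MonoidHom.coe_mk, OneHom.coe_mk, toAdd_ofAdd, P.root_coroot_two]
    rw [← hd]
    norm_cast
  have h2 := torusElt_conj_reflElt (S := S) t i 1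
  rw [h1, one_mul] at h2
  rw [← h2]
  have e : S.torusElt t * S.reflElt i 1 * (S.torusElt t)⁻¹ * (S.reflElt i 1)⁻¹ =
      S.torusElt t * (S.reflElt i 1 * (S.torusElt t)⁻¹ * (S.reflElt i 1)⁻¹) := by group
  rw [e]
  exact Subgroup.mul_mem _ (torusElt_mem_tor t) ((S.hasType_reflElt i one_ne_zero).conj_mem_tor
    (Subgroup.inv_mem _ (torusElt_mem_tor t)))

theorem reflElt_mul_reflElt_mem_tor (i : ι) {c : L} (hc : c ≠ 0) :
    S.reflElt i 1 * S.reflElt i c ∈ S.tor := by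
  have h := Subgroup.inv_mem _ (reflElt_mul_inv_mem_tor (S := S) i (neg_ne_zero.2 hc))
  rwa [S.reflElt_neg, _root_.mul_inv_rev, inv_inv, inv_inv] at h

variable (S)

/-- The group generated by the torus and representatives of the simple reflections. -/
noncomputable def monomialGroup (f : Module.Dual ℤ X) : Subgroup (GL (Fin n) L) :=
  Subgroup.closure (S.tor ∪ {g | ∃ i ∈ P.simpleRoots f, g = S.reflElt i 1})

variable {S} {f : Module.Dual ℤ X}

omit [IsAlgClosed L] in
theorem monomialGroup_le_grp : S.monomialGroup f ≤ S.grp := by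
  rw [monomialGroup, Subgroup.closure_le]
  rintro g (hg | ⟨i, -, rfl⟩)
  · exact tor_le_grp hg
  · exact S.reflElt_mem_grp i 1

omit [IsAlgClosed L] in
theorem tor_le_monomialGroup : S.tor ≤ S.monomialGroup f :=
  fun _ hg => Subgroup.subset_closure (Or.inl hg)

omit [IsAlgClosed L] in
theorem reflElt_one_mem {i : ι} (hi : i ∈ P.simpleRoots f) :
    S.reflElt i 1 ∈ S.monomialGroup f :=
  Subgroup.subset_closure (Or.inr ⟨i, hi, rfl⟩)

theorem reflElt_mem {i : ι} (hi : i ∈ P.simpleRoots f) {c : L} (hc : c ≠ 0) :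
    S.reflElt i c ∈ S.monomialGroup f := by
  have := Subgroup.mul_mem _ (tor_le_monomialGroup (reflElt_mul_inv_mem_tor (S := S) i hc))
    (reflElt_one_mem hi)
  simpa using this

omit [IsAlgClosed L] in
theorem exists_hasType_of_mem {g : GL (Fin n) L} (hg : g ∈ S.monomialGroup f) :
    ∃ w, S.HasType g.val w := by
  induction hg using Subgroup.closure_induction with
  | mem g hg =>
    rcases hg with hg | ⟨i, -, rfl⟩
    · exact ⟨1, hasType_one_of_mem_tor hg⟩
    · exact ⟨_, S.hasType_reflElt i one_ne_zero⟩
  | one => exact ⟨1, hasType_one⟩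
  | mul g g' _ _ h h' =>
    obtain ⟨w, hw⟩ := h
    obtain ⟨w', hw'⟩ := h'
    exact ⟨w * w', hw.mul hw'⟩
  | inv g _ h =>
    obtain ⟨w, hw⟩ := h
    exact ⟨w⁻¹, hw.inv⟩

/-- The product of the representatives of the reflections in a list of roots. -/
noncomputable def wordElt (S : SplitReductive P L n) (l : List ι) : GL (Fin n) L :=
  (l.map fun i => S.reflElt i 1).prod

/-- The product of the reflections in a list of roots. -/
def wordRefl (P : RootDatum ι X Y) (l : List ι) : X ≃ₗ[ℤ] X :=
  (l.map P.reflection).prod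

omit [IsAlgClosed L] in
theorem hasType_wordElt (l : List ι) : S.HasType (wordElt S l).val (wordRefl P l) := by
  induction l with
  | nil => exact hasType_one
  | cons i l ih =>
    rw [wordElt, wordRefl, List.map_cons, List.map_cons, List.prod_cons, List.prod_cons]
    exact (S.hasType_reflElt i one_ne_zero).mul ih

omit [IsAlgClosed L] in
theorem wordElt_mem_lieNormalizer [Fintype ι] (l : List ι) :
    wordElt S l ∈ S.lieNormalizer :=
  Subgroup.list_prod_mem _ fun g hg => by
    obtain ⟨i, -, rfl⟩ := List.mem_map.1 hg
    exact grp_le_lieNormalizer (S.reflElt_mem_grp i 1)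

/-- A monomial element is, up to the torus, a word in the representatives of the simple
reflections. -/
theorem exists_word_of_mem {g : GL (Fin n) L} (hg : g ∈ S.monomialGroup f) :
    ∃ l : List ι, (∀ i ∈ l, i ∈ P.simpleRoots f) ∧ g * (wordElt S l)⁻¹ ∈ S.tor := by
  induction hg using Subgroup.closure_induction_left with
  | one => exact ⟨[], by simp, by simp [wordElt]⟩
  | mul_left g hg g' hg' ih =>
    obtain ⟨l, hl, h⟩ := ih
    rcases hg with hg | ⟨i, hi, rfl⟩
    · exact ⟨l, hl, by rw [mul_assoc]; exact Subgroup.mul_mem _ hg h⟩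
    · refine ⟨i :: l, by simpa using ⟨hi, hl⟩, ?_⟩
      have e : S.reflElt i 1 * g' * (wordElt S (i :: l))⁻¹ =
          S.reflElt i 1 * (g' * (wordElt S l)⁻¹) * (S.reflElt i 1)⁻¹ := by
        simp only [wordElt, List.map_cons, List.prod_cons, _root_.mul_inv_rev, mul_assoc]
      rw [e]
      exact (S.hasType_reflElt i one_ne_zero).conj_mem_tor h
  | inv_mul_cancel g hg g' hg' ih =>
    obtain ⟨l, hl, h⟩ := ih
    rcases hg with hg | ⟨i, hi, rfl⟩
    · exact ⟨l, hl, by rw [mul_assoc]; exact Subgroup.mul_mem _ (Subgroup.inv_mem _ hg) h⟩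
    · refine ⟨i :: l, by simpa using ⟨hi, hl⟩, ?_⟩
      have e : (S.reflElt i 1)⁻¹ * g' * (wordElt S (i :: l))⁻¹ =
          (S.reflElt i 1)⁻¹ * (g' * (wordElt S l)⁻¹) * ((S.reflElt i 1)⁻¹)⁻¹ *
          (S.reflElt i 1 * S.reflElt i 1)⁻¹ := by
        simp only [wordElt, List.map_cons, List.prod_cons, _root_.mul_inv_rev, mul_assoc, inv_inv]
        group
      rw [e]
      exact Subgroup.mul_mem _ ((S.hasType_reflElt i one_ne_zero).inv.conj_mem_tor h)
        (Subgroup.inv_mem _ (reflElt_mul_reflElt_mem_tor i one_ne_zero))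

section

variable [Finite ι] [P.IsReduced] (hf : ∀ i, f (P.root i) ≠ 0)

include hf

omit [IsAlgClosed L] [CharZero L] in
/-- The exchange condition. -/
theorem exists_exchange {k : ι} (hk : 0 < f (P.root k)) (l : List ι)
    (hl : ∀ i ∈ l, i ∈ P.simpleRoots f) (hneg : f (wordRefl P l (P.root k)) < 0) :
    ∃ l₁ j l₂, l = l₁ ++ j :: l₂ ∧ wordRefl P l₂ (P.root k) = P.root j := by
  induction l with
  | nil =>
    simp only [wordRefl, List.map_nil, List.prod_nil] at hneg
    exact absurd hneg (not_lt.2 hk.le)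
  | cons i l ih =>
    have hi := hl i (by simp)
    have hl' : ∀ j ∈ l, j ∈ P.simpleRoots f := fun j hj => hl j (by simp [hj])
    by_cases h : f (wordRefl P l (P.root k)) < 0
    · obtain ⟨l₁, j, l₂, rfl, h2⟩ := ih hl' h
      exact ⟨i :: l₁, j, l₂, by simp, h2⟩
    · obtain ⟨m, hm⟩ : ∃ m, wordRefl P l (P.root k) = P.root m := by
        clear ih hneg hl hl' h
        induction l with
        | nil => exact ⟨k, rfl⟩
        | cons i l ih =>
          obtain ⟨m, hm⟩ := ih
          refine ⟨P.reflectionPerm i m, ?_⟩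
          rw [P.root_reflectionPerm, ← hm]
          simp only [wordRefl, List.map_cons, List.prod_cons]
          rfl
      rw [hm] at h
      have hm0 : 0 < f (P.root m) := lt_of_le_of_ne (not_lt.1 h) (hf m).symm
      have hneg' : f (P.root (P.reflectionPerm i m)) < 0 := by
        rw [P.root_reflectionPerm, ← hm]
        simp only [wordRefl, List.map_cons, List.prod_cons] at hneg
        exact hneg
      by_cases him : i = m
      · exact ⟨[], i, l, rfl, by rw [hm, him]⟩
      · exact absurd (RootPairing.pos_reflection hf hi hm0 him) (not_lt.2 hneg'.le)

end

section

variable [Fintype ι]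

omit [IsAlgClosed L] in
/-- An element of type `w` conjugates a triple of root vectors and coroot to such a triple; in
particular `w` is compatible with coroots. -/
theorem HasType.conj_triple {g : GL (Fin n) L} {w : X ≃ₗ[ℤ] X} (hg : S.HasType g.val w)
    (hgN : g ∈ S.lieNormalizer) {j k : ι} (hjk : w (P.root k) = P.root j) :
    (∃ c : L, c ≠ 0 ∧ g.val * S.e k * (g⁻¹).val = c • S.e j ∧
      g.val * S.e (P.reflectionPerm k k) * (g⁻¹).val = c⁻¹ • S.e (P.reflectionPerm j j)) ∧
    ∀ x, P.toLinearMap (w⁻¹ x) (P.coroot k) = P.toLinearMap x (P.coroot j) := by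
  obtain ⟨j', c, hj', hc, h1⟩ := hg.conj_e hgN k
  obtain rfl : j' = j := P.root.injective (hj'.trans hjk)
  obtain ⟨m, d, hm, hd, h2⟩ := hg.conj_e hgN (P.reflectionPerm k k)
  have hmj : P.root m = -P.root j' := by
    rw [hm, RootPairing.root_reflectionPerm_self', map_neg, hjk]
  have hm' : m = P.reflectionPerm j' j' :=
    P.root.injective (by rw [hmj, RootPairing.root_reflectionPerm_self'])
  -- conjugate the relation `[e_k, e_{-k}] = k^∨` by `g`
  have h3 : g.val * S.diag (P.cocharHom L (P.coroot k)) * (g⁻¹).val =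
      (c * d) • S.diag (P.cocharHom L (P.coroot j')) := by
    rw [← S.bracket_neg_eq (i := k) (j := P.reflectionPerm k k) (by simp),
      ← S.bracket_neg_eq hmj]
    have e : ∀ A B : Matrix (Fin n) (Fin n) L, g.val * (A * B - B * A) * (g⁻¹).val =
        (g.val * A * (g⁻¹).val) * (g.val * B * (g⁻¹).val) -
        (g.val * B * (g⁻¹).val) * (g.val * A * (g⁻¹).val) := by
      intro A B
      have e1 : ∀ A B : Matrix (Fin n) (Fin n) L,
          (g.val * A * (g⁻¹).val) * (g.val * B * (g⁻¹).val) = g.val * (A * B) * (g⁻¹).val := by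
        intro A B
        have : (g.val * A * (g⁻¹).val) * (g.val * B * (g⁻¹).val) =
          g.val * A * ((g⁻¹).val * g.val) * B * (g⁻¹).val := by simp only [mul_assoc]
        rw [this]
        simp [mul_assoc]
      rw [e1, e1, mul_sub, sub_mul]
    rw [e, h1, h2, smul_mul_smul_comm, smul_mul_smul_comm, mul_comm d c, smul_sub]
  have h4 : S.diag (fun x => P.cocharHom L (P.coroot k) (w⁻¹ x)) =
      (c * d) • S.diag (P.cocharHom L (P.coroot j')) := by
    rw [← h3, hg.mul_diag, mul_assoc, ← Units.val_mul, mul_inv_cancel, Units.val_one, mul_one]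
  have h5 : S.diag ((P.cocharHom L (P.coroot k)).comp
        ((w⁻¹ : X ≃ₗ[ℤ] X) : X →ₗ[ℤ] X).toAddMonoidHom : X →+ L) =
      S.diag ((AddMonoidHom.mulLeft (c * d)).comp (P.cocharHom L (P.coroot j')) : X →+ L) := by
    refine Eq.trans (b := S.diag (fun x => P.cocharHom L (P.coroot k) (w⁻¹ x))) rfl (h4.trans ?_)
    ext a b
    simp [diag, Matrix.diagonal_apply]
  have h6 : ∀ x, (P.toLinearMap (w⁻¹ x) (P.coroot k) : L) =
      c * d * P.toLinearMap x (P.coroot j') := fun x => DFunLike.congr_fun (S.diag_injective h5) x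
  -- both coroots pair to `2` with the corresponding root
  have hcd : c * d = 1 := by
    have h7 : w⁻¹ (P.root j') = P.root k := by rw [← hjk]; exact w.symm_apply_apply _
    have h8 := h6 (P.root j')
    rw [h7, P.root_coroot_two, P.root_coroot_two] at h8
    have h2 : ((2 : ℤ) : L) ≠ 0 := Int.cast_ne_zero.2 two_ne_zero
    exact (mul_right_cancel₀ h2 (by rw [one_mul]; exact h8)).symm
  refine ⟨⟨c, hc, h1, ?_⟩, fun x => ?_⟩
  · rw [h2, hm', eq_inv_of_mul_eq_one_right hcd]
  · have := h6 x
    rw [hcd, one_mul] at this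
    exact_mod_cast this

omit [IsAlgClosed L] in
/-- Conjugating the representative of a reflection gives a representative of the conjugate
reflection. -/
theorem exists_conj_reflElt {g : GL (Fin n) L} {w : X ≃ₗ[ℤ] X} (hg : S.HasType g.val w)
    (hgN : g ∈ S.lieNormalizer) {j k : ι} (hjk : w (P.root k) = P.root j) :
    ∃ c : L, c ≠ 0 ∧ g * S.reflElt k 1 * g⁻¹ = S.reflElt j c := by
  obtain ⟨⟨c, hc, h1, h2⟩, -⟩ := hg.conj_triple hgN hjk
  refine ⟨c, hc, ?_⟩
  have e : g * S.reflElt k 1 * g⁻¹ =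
      (g * S.rootElt k 1 * g⁻¹) *
      (g * S.rootElt (P.reflectionPerm k k) (-1⁻¹) * g⁻¹) *
      (g * S.rootElt k 1 * g⁻¹) := by
    rw [reflElt]; group
  rw [e, S.conj_rootElt h1, S.conj_rootElt h2, reflElt, one_mul, inv_one, neg_mul, one_mul]

variable [P.IsReduced] (hf : ∀ i, f (P.root i) ≠ 0)

include hf

/-- A word in the representatives of the simple reflections which acts trivially on the character
lattice lies in the torus. -/
theorem wordElt_mem_tor (N : ℕ) : ∀ l : List ι, l.length ≤ N → (∀ i ∈ l, i ∈ P.simpleRoots f) →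
    wordRefl P l = 1 → wordElt S l ∈ S.tor := by
  induction N with
  | zero =>
    intro l hl _ _
    rw [Nat.le_zero, List.length_eq_zero_iff] at hl
    rw [hl]
    exact Subgroup.one_mem _
  | succ N ih =>
    intro l hlen hl h1
    rcases List.eq_nil_or_concat l with rfl | ⟨l', k, rfl⟩
    · exact Subgroup.one_mem _
    have hk : k ∈ P.simpleRoots f := hl k (by simp)
    have hl' : ∀ i ∈ l', i ∈ P.simpleRoots f := fun i hi => hl i (by simp [hi])
    have hrefl : wordRefl P l' (P.root k) = -P.root k := by
      have h2 : wordRefl P l' * P.reflection k = 1 := by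
        simpa [wordRefl] using h1
      have h3 : wordRefl P l' (P.reflection k (P.root k)) = P.root k :=
        LinearEquiv.congr_fun h2 (P.root k)
      rw [P.reflection_apply_self, map_neg] at h3
      exact neg_eq_iff_eq_neg.1 h3
    have hk0 := RootPairing.pos_of_mem_simpleRoots hk
    -- the word can be shortened by two letters, at the expense of a torus element
    obtain ⟨l₁, j, l₂, rfl, hj⟩ := exists_exchange hf hk0 l' hl' (by
      rw [hrefl, map_neg]; omega)
    obtain ⟨c, hc, hconj⟩ := exists_conj_reflElt (hasType_wordElt (S := S) l₂)
      (wordElt_mem_lieNormalizer l₂) hj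
    have htor := reflElt_mul_reflElt_mem_tor (S := S) j hc
    have e : wordElt S (l₁ ++ j :: l₂ ++ [k]) =
        (wordElt S l₁ * (S.reflElt j 1 * S.reflElt j c) * (wordElt S l₁)⁻¹) *
          wordElt S (l₁ ++ l₂) := by
      rw [← hconj]
      simp only [wordElt, List.map_append, List.prod_append, List.map_cons, List.prod_cons,
        List.map_nil, List.prod_nil]
      group
    have htor' := (hasType_wordElt (S := S) l₁).conj_mem_tor htor
    have htype : wordRefl P (l₁ ++ l₂) = 1 := by
      refine (hasType_wordElt (S := S) (l₁ ++ l₂)).unique ?_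
      have e2 : wordElt S (l₁ ++ l₂) =
          (wordElt S l₁ * (S.reflElt j 1 * S.reflElt j c) * (wordElt S l₁)⁻¹)⁻¹ *
          wordElt S (l₁ ++ j :: l₂ ++ [k]) := by
        rw [e]; group
      rw [e2]
      have h3 := (hasType_one_of_mem_tor (Subgroup.inv_mem _ htor')).mul
        (hasType_wordElt (S := S) (l₁ ++ j :: l₂ ++ [k]))
      have h4 : wordRefl P (l₁ ++ j :: l₂ ++ [k]) = 1 := by simpa using h1
      rwa [h4, mul_one] at h3
    have hfinal : wordElt S (l₁ ++ l₂) ∈ S.tor := by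
      refine ih _ ?_ ?_ htype
      · simp at hlen ⊢; omega
      · intro i hi
        refine hl' i ?_
        simp at hi ⊢
        tauto
    have := Subgroup.mul_mem _ htor' hfinal
    rw [← e] at this
    simpa using this

/-- An element of the group of monomial elements which acts trivially on the character lattice
lies in the torus. -/
theorem mem_tor_of_mem_monomialGroup {g : GL (Fin n) L} (hg : g ∈ S.monomialGroup f)
    (h1 : S.HasType g.val 1) : g ∈ S.tor := by
  obtain ⟨l, hl, h⟩ := exists_word_of_mem hg
  have htype : wordRefl P l = 1 := by
    refine (hasType_wordElt (S := S) l).unique ?_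
    have e : wordElt S l = (g * (wordElt S l)⁻¹)⁻¹ * g := by group
    rw [e]
    have := (hasType_one_of_mem_tor (Subgroup.inv_mem _ h)).mul h1
    rwa [mul_one] at this
  have := Subgroup.mul_mem _ h (wordElt_mem_tor (S := S) hf l.length l le_rfl hl htype)
  simpa using this

end

end SplitReductive

end

section

open Matrix

namespace SplitReductive

variable {ι X Y : Type*} [AddCommGroup X] [AddCommGroup Y] {P : RootDatum ι X Y}
  {L : Type*} [Field L] {n : ℕ} {S : SplitReductive P L n}

/-! ### The Bruhat decomposition -/

section

variable {f : Module.Dual ℤ X}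

/-- The functional `f + f ∘ s_α`, which vanishes on the root `α`, and which is positive on the
positive roots other than `α` if `α` is simple. -/
def reflFunctional (P : RootDatum ι X Y) (f : Module.Dual ℤ X) (i : ι) : Module.Dual ℤ X :=
  f + f ∘ₗ (P.reflection i : X →ₗ[ℤ] X)

theorem reflFunctional_root (i j : ι) :
    reflFunctional P f i (P.root j) = f (P.root j) + f (P.root (P.reflectionPerm i j)) := by
  rw [P.root_reflectionPerm]; rfl

theorem reflFunctional_root_self (i : ι) : reflFunctional P f i (P.root i) = 0 := by
  rw [reflFunctional_root, RootPairing.root_reflectionPerm_self', map_neg, add_neg_cancel]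

variable [Finite ι] [P.IsReduced] (hf : ∀ i, f (P.root i) ≠ 0)

include hf

theorem reflFunctional_pos {i j : ι} (hi : i ∈ P.simpleRoots f) (hj : 0 < f (P.root j))
    (hij : i ≠ j) : 0 < reflFunctional P f i (P.root j) := by
  have := RootPairing.pos_reflection hf hi hj hij
  rw [reflFunctional_root]
  omega

theorem pos_of_reflFunctional_pos {i j : ι} (hi : i ∈ P.simpleRoots f)
    (hj : 0 < reflFunctional P f i (P.root j)) : 0 < f (P.root j) := by
  by_contra hneg
  obtain ⟨k, hk⟩ := exists_root_eq_neg P j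
  have hk0 : 0 < f (P.root k) := by
    have := hf j
    rw [hk, map_neg]
    omega
  rw [← neg_neg (P.root j), ← hk, map_neg] at hj
  rcases eq_or_ne i k with rfl | hik
  · rw [reflFunctional_root_self] at hj
    omega
  · have := reflFunctional_pos hf hi hk0 hik
    omega

end

section

variable [CharZero L] [Fintype ι] {f : Module.Dual ℤ X}

theorem tor_conj_mem_rootGroup {t u : GL (Fin n) L} (ht : t ∈ S.tor)
    (hu : u ∈ S.rootGroup {i | 0 < f (P.root i)}) :
    t * u * t⁻¹ ∈ S.rootGroup {i | 0 < f (P.root i)} :=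
  S.conj_mem_rootGroup (grp_le_lieNormalizer (tor_le_grp ht))
    (S.degFilt_zero_of_hasType_one (hasType_one_of_mem_tor ht))
    (S.degFilt_zero_of_hasType_one (hasType_one_of_mem_tor (Subgroup.inv_mem _ ht))) hu

theorem rootElt_conj_mem_rootGroup {i : ι} (hi : f (P.root i) = 0) (c : L) {u : GL (Fin n) L}
    (hu : u ∈ S.rootGroup {i | 0 < f (P.root i)}) :
    S.rootElt i c * u * (S.rootElt i c)⁻¹ ∈ S.rootGroup {i | 0 < f (P.root i)} := by
  refine S.conj_mem_rootGroup (S.rootElt_mem_lieNormalizer i c) (S.rootElt_mem_degFilt_zero hi c) ?_ hu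
  rw [← rootElt_neg]
  exact S.rootElt_mem_degFilt_zero hi _

theorem reflElt_conj_mem_rootGroup {i : ι} (hi : f (P.root i) = 0) (c : L) {u : GL (Fin n) L}
    (hu : u ∈ S.rootGroup {i | 0 < f (P.root i)}) :
    S.reflElt i c * u * (S.reflElt i c)⁻¹ ∈ S.rootGroup {i | 0 < f (P.root i)} := by
  have hi' : f (P.root (P.reflectionPerm i i)) = 0 := by
    rw [RootPairing.root_reflectionPerm_self', map_neg, hi, neg_zero]
  have := rootElt_conj_mem_rootGroup hi c (rootElt_conj_mem_rootGroup hi' (-c⁻¹)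
    (rootElt_conj_mem_rootGroup hi c hu))
  rw [reflElt]
  simpa only [_root_.mul_inv_rev, mul_assoc] using this

/-- A monomial element conjugates a root element to a root element. -/
theorem HasType.conj_rootElt {g : GL (Fin n) L} {w : X ≃ₗ[ℤ] X} (hg : S.HasType g.val w)
    (hgN : g ∈ S.lieNormalizer) {i j : ι} (hij : w (P.root i) = P.root j) :
    ∃ c : L, c ≠ 0 ∧ ∀ a, g * S.rootElt i a * g⁻¹ = S.rootElt j (a * c) := by
  obtain ⟨j', c, hj', hc, h⟩ := hg.conj_e hgN i
  obtain rfl : j' = j := P.root.injective (hj'.trans hij)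
  exact ⟨c, hc, S.conj_rootElt h⟩

variable [P.IsReduced] (hf : ∀ i, f (P.root i) ≠ 0)

include hf

theorem rootGroup_reflFunctional_le {i : ι} (hi : i ∈ P.simpleRoots f) :
    S.rootGroup {j | 0 < reflFunctional P f i (P.root j)} ≤ S.rootGroup {j | 0 < f (P.root j)} := by
  refine Subgroup.closure_mono ?_
  rintro _ ⟨j, hj, c, rfl⟩
  exact ⟨j, pos_of_reflFunctional_pos hf hi hj, c, rfl⟩

/-- The unipotent group of the positive roots is the product of the group of the positive roots
other than a simple root and of the root group of this simple root. -/
theorem exists_eq_mul_rootElt {i : ι} (hi : i ∈ P.simpleRoots f) {u : GL (Fin n) L}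
    (hu : u ∈ S.rootGroup {j | 0 < f (P.root j)}) :
    ∃ v ∈ S.rootGroup {j | 0 < reflFunctional P f i (P.root j)}, ∃ c, u = v * S.rootElt i c := by
  have h0 := reflFunctional_root_self (P := P) (f := f) i
  induction hu using Subgroup.closure_induction with
  | mem g hg =>
    obtain ⟨j, hj, c, rfl⟩ := hg
    rcases eq_or_ne i j with rfl | hij
    · exact ⟨1, Subgroup.one_mem _, c, (one_mul _).symm⟩
    · exact ⟨_, rootElt_mem_rootGroup (s := {j | 0 < reflFunctional P f i (P.root j)})
        (reflFunctional_pos hf hi hj hij) c, 0, by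
        rw [rootElt_zero, mul_one]⟩
  | one => exact ⟨1, Subgroup.one_mem _, 0, by rw [rootElt_zero, mul_one]⟩
  | mul u u' _ _ h h' =>
    obtain ⟨v, hv, c, rfl⟩ := h
    obtain ⟨v', hv', c', rfl⟩ := h'
    refine ⟨_, Subgroup.mul_mem _ hv (rootElt_conj_mem_rootGroup h0 c hv'), c + c', ?_⟩
    rw [rootElt_add]
    group
  | inv u _ h =>
    obtain ⟨v, hv, c, rfl⟩ := h
    refine ⟨_, rootElt_conj_mem_rootGroup h0 (-c) (Subgroup.inv_mem _ hv), -c, ?_⟩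
    rw [rootElt_neg]
    group

end

section

variable [CharZero L] [Fintype ι] [IsAlgClosed L] {f : Module.Dual ℤ X}

variable (S) in
/-- The union `U N U` of the double cosets of the Bruhat decomposition. -/
def bruhatSet (f : Module.Dual ℤ X) : Set (GL (Fin n) L) :=
  {g | ∃ u ∈ S.rootGroup {i | 0 < f (P.root i)}, ∃ m ∈ S.monomialGroup f,
    ∃ u' ∈ S.rootGroup {i | 0 < f (P.root i)}, g = u * m * u'}

variable (S) in
/-- The group of elements which stabilize `U N U` under left multiplication. -/
def bruhatStab (f : Module.Dual ℤ X) : Subgroup (GL (Fin n) L) where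
  carrier := {g | ∀ x ∈ S.bruhatSet f, g * x ∈ S.bruhatSet f ∧ g⁻¹ * x ∈ S.bruhatSet f}
  one_mem' x hx := by simpa using hx
  mul_mem' {g g'} h h' x hx := by
    refine ⟨?_, ?_⟩
    · rw [mul_assoc]
      exact (h _ (h' x hx).1).1
    · rw [_root_.mul_inv_rev, mul_assoc]
      exact (h' _ (h x hx).2).2
  inv_mem' {g} h x hx := ⟨(h x hx).2, by rw [inv_inv]; exact (h x hx).1⟩

omit [IsAlgClosed L] [Fintype ι] in
theorem rootGroup_mul_mem_bruhatSet {u x : GL (Fin n) L}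
    (hu : u ∈ S.rootGroup {i | 0 < f (P.root i)}) (hx : x ∈ S.bruhatSet f) :
    u * x ∈ S.bruhatSet f := by
  obtain ⟨v, hv, m, hm, v', hv', rfl⟩ := hx
  exact ⟨u * v, Subgroup.mul_mem _ hu hv, m, hm, v', hv', by group⟩

omit [IsAlgClosed L] [Fintype ι] in
theorem rootGroup_le_bruhatStab :
    S.rootGroup {i | 0 < f (P.root i)} ≤ S.bruhatStab f := fun _ hu _ hx =>
  ⟨rootGroup_mul_mem_bruhatSet hu hx, rootGroup_mul_mem_bruhatSet (Subgroup.inv_mem _ hu) hx⟩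

omit [IsAlgClosed L] in
theorem tor_mul_mem_bruhatSet {t x : GL (Fin n) L} (ht : t ∈ S.tor) (hx : x ∈ S.bruhatSet f) :
    t * x ∈ S.bruhatSet f := by
  obtain ⟨v, hv, m, hm, v', hv', rfl⟩ := hx
  exact ⟨_, tor_conj_mem_rootGroup ht hv, t * m, Subgroup.mul_mem _ (tor_le_monomialGroup ht) hm,
    v', hv', by group⟩

omit [IsAlgClosed L] in
theorem tor_le_bruhatStab : S.tor ≤ S.bruhatStab f := fun _ ht _ hx =>
  ⟨tor_mul_mem_bruhatSet ht hx, tor_mul_mem_bruhatSet (Subgroup.inv_mem _ ht) hx⟩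

variable [P.IsReduced] (hf : ∀ i, f (P.root i) ≠ 0)

include hf

omit [IsAlgClosed L] [P.IsReduced] hf in
/-- A monomial element of type `w` takes a root element of the root `α` to the right if `w⁻¹ α`
is positive. -/
theorem rootElt_mul_mem_bruhatSet {m u : GL (Fin n) L} {w : X ≃ₗ[ℤ] X}
    (hm : m ∈ S.monomialGroup f) (hw : S.HasType m.val w) {i k : ι}
    (hk : w (P.root k) = P.root i) (hk0 : 0 < f (P.root k))
    (hu : u ∈ S.rootGroup {i | 0 < f (P.root i)}) (c : L) :
    ∃ u' ∈ S.rootGroup {i | 0 < f (P.root i)}, S.rootElt i c * m * u = m * u' := by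
  obtain ⟨d, hd, h⟩ := hw.conj_rootElt (grp_le_lieNormalizer (monomialGroup_le_grp hm)) hk
  refine ⟨_, Subgroup.mul_mem _ (rootElt_mem_rootGroup (s := {i | 0 < f (P.root i)}) hk0
    (c * d⁻¹)) hu, ?_⟩
  have h1 := h (c * d⁻¹)
  rw [inv_mul_cancel_right₀ hd] at h1
  rw [← h1]
  group

/-- The set `U N U` is stable under the representatives of the simple reflections. -/
theorem reflElt_mul_mem_bruhatSet {i : ι} (hi : i ∈ P.simpleRoots f) {x : GL (Fin n) L}
    (hx : x ∈ S.bruhatSet f) : S.reflElt i 1 * x ∈ S.bruhatSet f := by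
  obtain ⟨u, hu, m, hm, u', hu', rfl⟩ := hx
  obtain ⟨v, hv, c, rfl⟩ := exists_eq_mul_rootElt hf hi hu
  set s := S.reflElt i 1 with hs
  have hsm : s ∈ S.monomialGroup f := reflElt_one_mem hi
  have hstype : S.HasType s.val (P.reflection i) := S.hasType_reflElt i one_ne_zero
  have hvU := rootGroup_reflFunctional_le hf hi
    (reflElt_conj_mem_rootGroup (reflFunctional_root_self (P := P) (f := f) i) 1 hv)
  suffices h : s * (S.rootElt i c * m * u') ∈ S.bruhatSet f by
    have := rootGroup_mul_mem_bruhatSet hvU h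
    rw [← hs] at this
    convert this using 1
    group
  obtain ⟨w, hw⟩ := exists_hasType_of_mem hm
  obtain ⟨k, d, hk, -, -⟩ := hw.inv.conj_e
    (Subgroup.inv_mem _ (grp_le_lieNormalizer (monomialGroup_le_grp hm))) i
  have hwk : w (P.root k) = P.root i := by rw [hk]; exact w.apply_symm_apply _
  -- if `w⁻¹ α` is positive, the root element of `α` moves to the right through `m`; otherwise it
  -- moves to the right through `s m` after a computation in the group generated by the root groups of
  -- `α` and `-α`
  rcases (hf k).lt_or_gt with hneg | hpos
  · by_cases hc : c = 0
    · refine ⟨1, Subgroup.one_mem _, s * m, Subgroup.mul_mem _ hsm hm, u', hu', ?_⟩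
      rw [hc, rootElt_zero]
      group
    have hij : P.reflection i (P.root i) = P.root (P.reflectionPerm i i) :=
      (P.root_reflectionPerm i i).symm
    obtain ⟨a, ha, h⟩ := hstype.conj_rootElt
      (grp_le_lieNormalizer (monomialGroup_le_grp hsm)) hij
    set b := -(c * a)⁻¹ with hb
    have hb0 : b ≠ 0 := neg_ne_zero.2 (inv_ne_zero (mul_ne_zero hc ha))
    have hb' : -b⁻¹ = c * a := by rw [hb, inv_neg, inv_inv, neg_neg]
    have h1 : s * S.rootElt i c * s⁻¹ = S.rootElt i (-b) * S.reflElt i b * S.rootElt i (-b) := by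
      rw [h c, reflElt, hb', rootElt_neg]
      group
    obtain ⟨k', hk'⟩ := exists_root_eq_neg P k
    obtain ⟨u'', hu'', h2⟩ := rootElt_mul_mem_bruhatSet (S := S) (f := f) (i := i) (k := k')
      (Subgroup.mul_mem _ hsm hm) (hstype.mul hw)
      (show P.reflection i (w (P.root k')) = P.root i by
        rw [hk', map_neg, hwk, map_neg, P.reflection_apply_self, neg_neg])
      (by rw [hk', map_neg]; omega) hu' (-b)
    have hipos : 0 < f (P.root i) := RootPairing.pos_of_mem_simpleRoots hi
    refine ⟨S.rootElt i (-b), rootElt_mem_rootGroup (s := {i | 0 < f (P.root i)}) hipos _,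
      S.reflElt i b * (s * m), Subgroup.mul_mem _ (reflElt_mem hi hb0)
      (Subgroup.mul_mem _ hsm hm), u'', hu'', ?_⟩
    calc s * (S.rootElt i c * m * u') = (s * S.rootElt i c * s⁻¹) * (s * m * u') := by group
      _ = S.rootElt i (-b) * S.reflElt i b * (S.rootElt i (-b) * (s * m) * u') := by
          rw [h1]; group
      _ = _ := by rw [h2]; group
  · obtain ⟨u'', hu'', h2⟩ := rootElt_mul_mem_bruhatSet hm hw hwk hpos hu' c
    exact ⟨1, Subgroup.one_mem _, s * m, Subgroup.mul_mem _ hsm hm, u'', hu'', by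
      rw [h2]; group⟩

theorem reflElt_mem_bruhatStab {i : ι} (hi : i ∈ P.simpleRoots f) :
    S.reflElt i 1 ∈ S.bruhatStab f := by
  refine fun x hx => ⟨reflElt_mul_mem_bruhatSet hf hi hx, ?_⟩
  have h := reflElt_mul_mem_bruhatSet hf hi (tor_mul_mem_bruhatSet (Subgroup.inv_mem _
    (reflElt_mul_reflElt_mem_tor (S := S) i one_ne_zero)) hx)
  convert h using 1
  group

theorem rootElt_mem_bruhatStab (j : ι) : ∀ c, S.rootElt j c ∈ S.bruhatStab f := by
  refine RootPairing.induction_simpleRoots (P := P) hf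
    (p := fun j => ∀ c, S.rootElt j c ∈ S.bruhatStab f) ?_ ?_ j
  · intro i hi c
    have hipos : 0 < f (P.root i) := RootPairing.pos_of_mem_simpleRoots hi
    exact rootGroup_le_bruhatStab (rootElt_mem_rootGroup (s := {i | 0 < f (P.root i)}) hipos c)
  · intro i j hi hj c
    obtain ⟨a, ha, h⟩ := (S.hasType_reflElt i one_ne_zero).conj_rootElt
      (grp_le_lieNormalizer (S.reflElt_mem_grp i 1)) (P.root_reflectionPerm i j).symm
    have h1 := h (c * a⁻¹)
    rw [inv_mul_cancel_right₀ ha] at h1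
    rw [← h1]
    exact Subgroup.mul_mem _ (Subgroup.mul_mem _ (reflElt_mem_bruhatStab hf hi) (hj _))
      (Subgroup.inv_mem _ (reflElt_mem_bruhatStab hf hi))

/-- The Bruhat decomposition. -/
theorem mem_bruhatSet_of_mem_grp {g : GL (Fin n) L} (hg : g ∈ S.grp) : g ∈ S.bruhatSet f := by
  have h : S.grp ≤ S.bruhatStab f := by
    rw [grp, Subgroup.closure_le]
    rintro _ (⟨t, rfl⟩ | ⟨i, c, rfl⟩)
    · exact tor_le_bruhatStab (torusElt_mem_tor t)
    · exact rootElt_mem_bruhatStab hf i c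
  have h1 := (h hg 1 ⟨1, Subgroup.one_mem _, 1, Subgroup.one_mem _, 1, Subgroup.one_mem _,
    by simp⟩).1
  rwa [mul_one] at h1

omit hf in
/-- The torus is its own centralizer: an element of the group which preserves all weight
spaces lies in the torus. -/
theorem mem_tor_of_hasType_one (hf : ∀ i, f (P.root i) ≠ 0) {g : GL (Fin n) L} (hg : g ∈ S.grp)
    (h1 : S.HasType g.val 1) : g ∈ S.tor := by
  obtain ⟨u, hu, m, hm, u', hu', rfl⟩ := mem_bruhatSet_of_mem_grp hf hg
  set g := u * m * u' with hgdef
  have hu1 := S.rootGroup_le_unipotentSubgroup f (Subgroup.inv_mem _ hu)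
  have hu2 := S.rootGroup_le_unipotentSubgroup f (Subgroup.inv_mem _ hu')
  have hm' : m = u⁻¹ * g * u'⁻¹ := by rw [hgdef]; group
  have hg0 := S.degFilt_zero_of_hasType_one (f := f) h1
  -- `g` preserves the weight spaces, so that `m = u⁻¹ g u'⁻¹` differs from `g` only in positive
  -- degrees
  have hdiff : m.val - g.val ∈ degFilt L (S.deg f) 1 := by
    have e : m.val - g.val = ((u⁻¹).val - 1) * g.val * ((u'⁻¹).val - 1) +
        ((u⁻¹).val - 1) * g.val + g.val * ((u'⁻¹).val - 1) := by
      rw [hm', Units.val_mul, Units.val_mul]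
      noncomm_ring
    rw [e]
    have h2 := mul_mem_degFilt hu1 hg0
    have h3 := mul_mem_degFilt h2 hu2
    have h4 := mul_mem_degFilt hg0 hu2
    exact Submodule.add_mem _ (Submodule.add_mem _ (degFilt_mono (by norm_num) h3)
      (degFilt_mono (by norm_num) h2)) (degFilt_mono (by norm_num) h4)
  have heq : ∀ a b, S.wt a = S.wt b → m.val a b = g.val a b := by
    intro a b hab
    have := hdiff a b (by rw [deg, deg, hab]; omega)
    rwa [Matrix.sub_apply, sub_eq_zero] at this
  obtain ⟨w, hw⟩ := exists_hasType_of_mem hm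
  have hw1 : w = 1 := by
    ext x
    refine S.forall_of_forall_wt (AddMonoidHom.eqLocus (w : X →ₗ[ℤ] X).toAddMonoidHom
      (AddMonoidHom.id X)) (fun b => ?_) x
    obtain ⟨a, ha⟩ := exists_apply_ne_zero g b
    have hab := h1 a b ha
    rw [← heq a b hab] at ha
    exact (hw a b ha).symm.trans hab
  rw [hw1] at hw
  have hmg : m = g := by
    ext a b
    by_cases hab : S.wt a = S.wt b
    · exact heq a b hab
    · have h2 : m.val a b = 0 := by
        by_contra h
        exact hab (hw a b h)
      have h3 : g.val a b = 0 := by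
        by_contra h
        exact hab (h1 a b h)
      rw [h2, h3]
  rw [← hmg]
  exact mem_tor_of_mem_monomialGroup hf hm hw

end

end SplitReductive

end

section

open Matrix

namespace SplitReductive

variable {ι X Y : Type*} [AddCommGroup X] [AddCommGroup Y] {P : RootDatum ι X Y}
  {L : Type*} [Field L] {n : ℕ} {S : SplitReductive P L n}

/-! ### Automorphisms of the character lattice induced by group elements -/

/-- If the conjugation by `g` matches enough homomorphisms on the character lattice, then `g`
permutes the weight spaces through an automorphism of the lattice. -/
theorem exists_hasType {A : Type*} [AddCommGroup A] (g : GL (Fin n) L)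
    (T : (X →+ A) → (X →+ A) → Prop)
    (hT : ∀ h h', T h h' → ∀ a b, g.val a b ≠ 0 → h' (S.wt a) = h (S.wt b))
    (h₁ : ∀ x ≠ 0, ∃ h h', T h h' ∧ h x ≠ 0) (h₂ : ∀ x ≠ 0, ∃ h h', T h h' ∧ h' x ≠ 0) :
    ∃ w : X ≃ₗ[ℤ] X, S.HasType g.val w := by
  -- the graph of the automorphism of the lattice
  set Γ : AddSubgroup (X × X) :=
    AddSubgroup.closure {p | ∃ a b, g.val a b ≠ 0 ∧ p = (S.wt b, S.wt a)} with hΓ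
  have hmem : ∀ a b, g.val a b ≠ 0 → (S.wt b, S.wt a) ∈ Γ := fun a b hab =>
    AddSubgroup.subset_closure ⟨a, b, hab, rfl⟩
  have hcompat : ∀ p ∈ Γ, ∀ h h', T h h' → h' p.2 = h p.1 := by
    intro p hp h h' hh
    induction hp using AddSubgroup.closure_induction with
    | mem p hp =>
      obtain ⟨a, b, hab, rfl⟩ := hp
      exact hT h h' hh a b hab
    | zero => simp
    | add p p' _ _ ih ih' => rw [Prod.fst_add, Prod.snd_add, map_add, map_add, ih, ih']
    | neg p _ ih => rw [Prod.fst_neg, Prod.snd_neg, map_neg, map_neg, ih]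
  set p₁ : Γ →+ X := (AddMonoidHom.fst X X).comp Γ.subtype with hp₁
  set p₂ : Γ →+ X := (AddMonoidHom.snd X X).comp Γ.subtype with hp₂
  have hzero : ∀ p : Γ, p₁ p = 0 ↔ p₂ p = 0 := by
    intro p
    constructor
    · intro h
      by_contra hne
      obtain ⟨k, k', hk, hk'⟩ := h₂ _ hne
      exact hk' ((hcompat p.1 p.2 k k' hk).trans (by
        rw [show p.1.1 = 0 from h, map_zero]))
    · intro h
      by_contra hne
      obtain ⟨k, k', hk, hk'⟩ := h₁ _ hne
      exact hk' ((hcompat p.1 p.2 k k' hk).symm.trans (by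
        rw [show p.1.2 = 0 from h, map_zero]))
  have hext : ∀ p : Γ, p₁ p = 0 → p = 0 := fun p h =>
    Subtype.ext (Prod.ext h ((hzero p).1 h))
  have hbij₁ : Function.Bijective p₁ := by
    refine ⟨(injective_iff_map_eq_zero p₁).2 hext, fun x => ?_⟩
    refine S.forall_of_forall_wt p₁.range (fun b => ?_) x
    obtain ⟨a, ha⟩ := exists_apply_ne_zero g b
    exact ⟨⟨_, hmem a b ha⟩, rfl⟩
  have hbij₂ : Function.Bijective p₂ := by
    refine ⟨(injective_iff_map_eq_zero p₂).2 fun p h => hext p ((hzero p).2 h), fun x => ?_⟩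
    refine S.forall_of_forall_wt p₂.range (fun a => ?_) x
    obtain ⟨b, hb⟩ : ∃ b, g.val a b ≠ 0 := by
      by_contra! h
      have h1 : (g.val * (g⁻¹).val) a a = 1 := by simp
      rw [Matrix.mul_apply, Finset.sum_eq_zero] at h1
      · exact zero_ne_one h1
      · intro b _; rw [h b, zero_mul]
    exact ⟨⟨_, hmem a b hb⟩, rfl⟩
  set w : X ≃+ X := (AddEquiv.ofBijective p₁ hbij₁).symm.trans (AddEquiv.ofBijective p₂ hbij₂)
  refine ⟨w.toIntLinearEquiv, fun a b hab => ?_⟩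
  have : (AddEquiv.ofBijective p₁ hbij₁).symm (S.wt b) = ⟨_, hmem a b hab⟩ := by
    rw [AddEquiv.symm_apply_eq]
    rfl
  change S.wt a = p₂ ((AddEquiv.ofBijective p₁ hbij₁).symm (S.wt b))
  rw [this]
  rfl

variable (P L) in
include P in
theorem exists_torus_ne_one [CharZero L] {x : X} (hx : x ≠ 0) :
    ∃ t : Multiplicative X →* Lˣ, t (Multiplicative.ofAdd x) ≠ 1 := by
  obtain ⟨y, hy⟩ := P.exists_cocharHom_ne_zero ℚ hx
  rw [RootPairing.cocharHom_apply, Int.cast_ne_zero] at hy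
  refine ⟨cocharElt P y (Units.mk0 2 two_ne_zero), fun h => ?_⟩
  have h1 : ((2 : ℚ) : L) ^ (P.toLinearMap x y) = 1 := by
    have := congrArg Units.val h
    simpa [cocharElt] using this
  rw [← Rat.cast_zpow] at h1
  have h2 := Rat.cast_injective (h1.trans Rat.cast_one.symm)
  exact hy ((zpow_eq_one_iff_right₀ (by norm_num) (by norm_num)).1 h2)

/-- An element of the normalizer of the torus permutes the weight spaces. -/
theorem exists_hasType_of_normalizes [CharZero L] {g : GL (Fin n) L}
    (h : ∀ t ∈ S.tor, g * t * g⁻¹ ∈ S.tor) (h' : ∀ t ∈ S.tor, g⁻¹ * t * g ∈ S.tor) :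
    ∃ w : X ≃ₗ[ℤ] X, S.HasType g.val w := by
  refine exists_hasType (A := Additive Lˣ) g (fun k k' =>
    g * S.torusElt (AddMonoidHom.toMultiplicativeLeft k) =
      S.torusElt (AddMonoidHom.toMultiplicativeLeft k') * g) ?_ ?_ ?_
  · intro k k' hk a b hab
    have h1 : (g.val * (S.torusElt (AddMonoidHom.toMultiplicativeLeft k)).val) a b =
        ((S.torusElt (AddMonoidHom.toMultiplicativeLeft k')).val * g.val) a b := by
      rw [← Units.val_mul, ← Units.val_mul, hk]
    rw [torusElt_val, torusElt_val, mul_diag_apply, diag_mul_apply, mul_comm] at h1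
    have h2 := mul_right_cancel₀ hab h1
    exact (Units.ext h2).symm
  · intro x hx
    obtain ⟨t, ht⟩ := exists_torus_ne_one P L hx
    obtain ⟨t', ht'⟩ := h _ (torusElt_mem_tor (S := S) t)
    refine ⟨AddMonoidHom.toMultiplicativeLeft.symm t, AddMonoidHom.toMultiplicativeLeft.symm t',
      ?_, fun h0 => ht h0⟩
    have : S.torusElt t' = g * S.torusElt t * g⁻¹ := ht'
    rw [Equiv.apply_symm_apply, Equiv.apply_symm_apply, this]
    group
  · intro x hx
    obtain ⟨t, ht⟩ := exists_torus_ne_one P L hx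
    obtain ⟨t', ht'⟩ := h' _ (torusElt_mem_tor (S := S) t)
    refine ⟨AddMonoidHom.toMultiplicativeLeft.symm t', AddMonoidHom.toMultiplicativeLeft.symm t,
      ?_, fun h0 => ht h0⟩
    have : S.torusElt t' = g⁻¹ * S.torusElt t * g := ht'
    rw [Equiv.apply_symm_apply, Equiv.apply_symm_apply, this]
    group

/-- An element of the Lie algebra commuting with a torus element on which no root is trivial
lies in the Lie algebra of the torus. -/
theorem exists_eq_diag_of_commute [Fintype ι] {t : Multiplicative X →* Lˣ}
    (ht : ∀ i, t (Multiplicative.ofAdd (P.root i)) ≠ 1) {A : Matrix (Fin n) (Fin n) L}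
    (hA : A ∈ S.lie) (hcomm : A * (S.torusElt t).val = (S.torusElt t).val * A) :
    ∃ h : X →+ L, A = S.diag h := by
  obtain ⟨h, c, rfl⟩ := hA
  refine ⟨h, ?_⟩
  ext a b
  have h1 := congrFun (congrFun hcomm a) b
  rw [torusElt_val, mul_diag_apply, diag_mul_apply] at h1
  by_cases hab : S.wt a = S.wt b
  · rw [S.lie_apply_of_wt_eq hab]
  have hne : a ≠ b := fun h => hab (by rw [h])
  rw [S.diag_apply_ne h hne]
  by_contra h0
  rw [mul_comm] at h1
  have h2 := Units.ext (mul_right_cancel₀ h0 h1)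
  by_cases hroot : ∃ i, S.wt a = S.wt b + P.root i
  · obtain ⟨i, hi⟩ := hroot
    rw [hi, ofAdd_add, map_mul] at h2
    exact ht i (left_eq_mul.1 h2)
  · push Not at hroot
    exact h0 (S.lie_apply_of_not_root hab hroot)

/-- An element of the group commuting with a torus element on which no root is trivial permutes
the weight spaces, and the permutation fixes the torus element. -/
theorem exists_hasType_of_commute [Fintype ι] [CharZero L] {g : GL (Fin n) L}
    (hg : g ∈ S.lieNormalizer) {t : Multiplicative X →* Lˣ}
    (ht : ∀ i, t (Multiplicative.ofAdd (P.root i)) ≠ 1) (hcomm : Commute g (S.torusElt t)) :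
    ∃ w : X ≃ₗ[ℤ] X, S.HasType g.val w ∧
      ∀ x, t (Multiplicative.ofAdd (w x)) = t (Multiplicative.ofAdd x) := by
  have key : ∀ g ∈ S.lieNormalizer, Commute g (S.torusElt t) → ∀ h : X →+ L,
      ∃ h' : X →+ L, g.val * S.diag h * (g⁻¹).val = S.diag h' := by
    intro g hg hcomm h
    refine exists_eq_diag_of_commute ht ((hg _).2 (S.diag_mem_lie h)) ?_
    have h1 : (g⁻¹).val * (S.torusElt t).val = (S.torusElt t).val * (g⁻¹).val := by
      rw [← Units.val_mul, ← Units.val_mul, hcomm.inv_left.eq]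
    have h2 : g.val * (S.torusElt t).val = (S.torusElt t).val * g.val := by
      rw [← Units.val_mul, ← Units.val_mul, hcomm.eq]
    have h3 : S.diag h * (S.torusElt t).val = (S.torusElt t).val * S.diag h := by
      rw [torusElt_val, diag_comm]
    rw [mul_assoc, h1, ← mul_assoc, mul_assoc g.val, h3, ← mul_assoc, h2]
    simp only [mul_assoc]
  obtain ⟨w, hw⟩ : ∃ w : X ≃ₗ[ℤ] X, S.HasType g.val w := by
    refine exists_hasType (A := L) g (fun k k' => g.val * S.diag k = S.diag k' * g.val) ?_ ?_ ?_
    · intro k k' hk a b hab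
      have h1 := congrFun (congrFun hk a) b
      rw [mul_diag_apply, diag_mul_apply, mul_comm] at h1
      exact (mul_right_cancel₀ hab h1).symm
    · intro x hx
      obtain ⟨y, hy⟩ := P.exists_cocharHom_ne_zero L hx
      obtain ⟨k', hk'⟩ := key g hg hcomm (P.cocharHom L y)
      refine ⟨_, k', ?_, hy⟩
      rw [← hk', mul_assoc, ← Units.val_mul, inv_mul_cancel, Units.val_one, mul_one]
    · intro x hx
      obtain ⟨y, hy⟩ := P.exists_cocharHom_ne_zero L hx
      obtain ⟨k', hk'⟩ := key g⁻¹ (Subgroup.inv_mem _ hg) hcomm.inv_left (P.cocharHom L y)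
      refine ⟨k', _, ?_, hy⟩
      rw [← hk', inv_inv, ← mul_assoc, ← mul_assoc, ← Units.val_mul, mul_inv_cancel,
        Units.val_one, one_mul]
  refine ⟨w, hw, fun x => ?_⟩
  have h0 : g.val * (S.torusElt t).val = (S.torusElt t).val * g.val := by
    rw [← Units.val_mul, ← Units.val_mul, hcomm.eq]
  refine S.forall_of_forall_wt (AddMonoidHom.eqLocus
    ((AddMonoidHom.toMultiplicativeLeft.symm t).comp (w : X →ₗ[ℤ] X).toAddMonoidHom)
    (AddMonoidHom.toMultiplicativeLeft.symm t)) (fun b => ?_) x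
  obtain ⟨a, ha⟩ := exists_apply_ne_zero g b
  have h1 := congrFun (congrFun h0 a) b
  rw [torusElt_val, mul_diag_apply, diag_mul_apply, mul_comm] at h1
  have h2 := Units.ext (mul_right_cancel₀ ha h1)
  rw [hw a b ha] at h2
  exact h2.symm

theorem HasType.exists_root_eq [Fintype ι] [CharZero L] {g : GL (Fin n) L} {w : X ≃ₗ[ℤ] X}
    (h : S.HasType g.val w) (hg : g ∈ S.grp) (i : ι) : ∃ j, P.root j = w (P.root i) := by
  obtain ⟨j, -, hj, -⟩ := h.conj_e (grp_le_lieNormalizer hg) i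
  exact ⟨j, hj⟩

/-- A functional that kills the roots defines a central element of the Lie algebra. -/
theorem commute_diag_of_mem_grp [CharZero L] {h : X →+ L} (h0 : ∀ i, h (P.root i) = 0)
    {g : GL (Fin n) L} (hg : g ∈ S.grp) : g.val * S.diag h = S.diag h * g.val := by
  induction hg using Subgroup.closure_induction with
  | mem g hg =>
    rcases hg with ⟨t, rfl⟩ | ⟨i, c, rfl⟩
    · rw [torusElt_val, diag_comm]
    · have h1 := rootElt_conj_diag (S := S) i c h
      rw [h0, mul_zero, zero_smul, sub_zero] at h1
      nth_rewrite 2 [← h1]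
      rw [mul_assoc, ← Units.val_mul, inv_mul_cancel, Units.val_one, mul_one]
  | one => simp
  | mul g g' _ _ ih ih' =>
    rw [Units.val_mul, mul_assoc, ih', ← mul_assoc, ih, mul_assoc]
  | inv g _ ih =>
    have h1 : (g⁻¹).val * (g.val * S.diag h) * (g⁻¹).val =
        (g⁻¹).val * (S.diag h * g.val) * (g⁻¹).val := by rw [ih]
    have e1 : (g⁻¹).val * (g.val * S.diag h) * (g⁻¹).val = S.diag h * (g⁻¹).val := by
      rw [← mul_assoc, ← Units.val_mul, inv_mul_cancel, Units.val_one, one_mul]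
    have e2 : (g⁻¹).val * (S.diag h * g.val) * (g⁻¹).val = (g⁻¹).val * S.diag h := by
      rw [mul_assoc, mul_assoc, ← Units.val_mul, mul_inv_cancel, Units.val_one, mul_one]
    rw [← e1, h1, e2]

/-- An automorphism of the character lattice induced by a group element is determined by its
action on the roots. -/
theorem HasType.eq_one_of_root [Fintype ι] [Module.Finite ℤ X] [CharZero L]
    {g : GL (Fin n) L} {w : X ≃ₗ[ℤ] X} (h : S.HasType g.val w) (hg : g ∈ S.grp)
    (hroot : ∀ i, w (P.root i) = P.root i) : w = 1 := by
  have hinv : ∀ x, w⁻¹ x = x := by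
    intro x
    rw [← sub_eq_zero]
    -- `w⁻¹ x - x` is orthogonal to all coroots, and killed by all functionals which kill the roots
    refine P.eq_zero_of_forall_coroot _ (fun i => ?_) fun f hf => ?_
    · have := (h.conj_triple (grp_le_lieNormalizer hg) (hroot i)).2 x
      rw [map_sub, LinearMap.sub_apply, this, sub_self]
    · refine S.forall_of_forall_wt (AddMonoidHom.ker (f.toAddMonoidHom.comp
        (((w⁻¹ : X ≃ₗ[ℤ] X) : X →ₗ[ℤ] X).toAddMonoidHom - AddMonoidHom.id X))) (fun b => ?_) x
      obtain ⟨a, ha⟩ := exists_apply_ne_zero g⁻¹ b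
      have h1 := commute_diag_of_mem_grp (S := S)
        (h := (Int.castAddHom L).comp f.toAddMonoidHom) (fun i => by simp [hf])
        (Subgroup.inv_mem _ hg)
      have h2 := congrFun (congrFun h1 a) b
      rw [mul_diag_apply, diag_mul_apply, mul_comm] at h2
      have h3 := mul_right_cancel₀ ha h2
      simp only [AddMonoidHom.comp_apply, LinearMap.toAddMonoidHom_coe, Int.coe_castAddHom,
        Int.cast_inj] at h3
      rw [AddMonoidHom.mem_ker]
      change f (w⁻¹ (S.wt b) - S.wt b) = 0
      rw [map_sub, h3, h.inv a b ha, sub_self]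
  ext x
  have := congrArg w (hinv x)
  rw [show w (w⁻¹ x) = x from w.apply_symm_apply x] at this
  exact this.symm

/-- A nilpotent matrix of nonzero weight `μ` whose exponential normalizes the Lie algebra belongs
to the Lie algebra, so that `μ` is a root. -/
theorem exists_root_of_exp_mem [Fintype ι] [CharZero L] {N : Matrix (Fin n) (Fin n) L}
    (hN : IsNilpotent N) (hN0 : N ≠ 0) {μ : X} (hμ : μ ≠ 0)
    (hwt : ∀ a b, N a b ≠ 0 → S.wt a = S.wt b + μ) (hexp : expGL N hN ∈ S.lieNormalizer) :
    ∃ j, P.root j = μ := by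
  obtain ⟨y, hy⟩ := P.exists_cocharHom_ne_zero L hμ
  set h := P.cocharHom L y with hh
  -- `exp (ad N)` maps `diag h` to `diag h - h(μ) N`, whence `N` lies in the Lie algebra
  have h1 : adMat N (S.diag h) = -(h μ • N) := by
    ext a b
    rw [adMat_apply, Matrix.sub_apply, mul_diag_apply, diag_mul_apply, Matrix.neg_apply,
      Matrix.smul_apply, smul_eq_mul]
    by_cases hab : N a b = 0
    · simp [hab]
    · rw [hwt a b hab, map_add]
      ring
  have h2 : adMat N (adMat N (S.diag h)) = 0 := by
    rw [h1, map_neg, map_smul, adMat_apply, sub_self, smul_zero, neg_zero]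
  have h3 : (expGL N hN).val * S.diag h * ((expGL N hN)⁻¹).val = _ :=
    exp_conj_eq_of_triple (A := S.diag h) hN (by rw [h2, map_zero])
  rw [h2, h1, smul_zero, add_zero] at h3
  have h4 : (expGL N hN).val * S.diag h * ((expGL N hN)⁻¹).val ∈ S.lie :=
    (hexp _).2 (S.diag_mem_lie h)
  have h5 : N ∈ S.lie := by
    have h6 : h μ • N = S.diag h - (expGL N hN).val * S.diag h * ((expGL N hN)⁻¹).val := by
      rw [h3]
      abel
    have h7 := Submodule.smul_mem _ (h μ)⁻¹ (Submodule.sub_mem _ (S.diag_mem_lie h) h4)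
    rwa [← h6, inv_smul_smul₀ hy] at h7
  obtain ⟨j, -, hj, -⟩ := exists_root_of_mem_lie hμ h5 hN0 hwt
  exact ⟨j, hj⟩

end SplitReductive

end

section

open Matrix

namespace SplitReductive

variable {ι X Y : Type*} [AddCommGroup X] [AddCommGroup Y] {P : RootDatum ι X Y}
  {K : Type*} [Field K] {n : ℕ} (S : SplitReductive P K n) (L : Type*) [Field L] [Algebra K L]

/-! ### Points over an extension field -/

/-- The base change of a split reductive group to an extension field. -/
def baseChange : SplitReductive P L n where
  wt := S.wt
  closure_wt := S.closure_wt
  basis := Matrix.GeneralLinearGroup.map (algebraMap K L) S.basis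
  e i := (S.e i).map (algebraMap K L)
  wt_eq i a b h := S.wt_eq i a b fun h0 => h (by rw [Matrix.map_apply, h0, map_zero])
  bracket_neg i j hij := by
    rw [← Matrix.map_mul, ← Matrix.map_mul, ← Matrix.map_sub _ (map_sub _), S.bracket_neg i j hij,
      Matrix.diagonal_map (map_zero _)]
    simp
  bracket_add i j hij := by
    rw [← Matrix.map_mul, ← Matrix.map_mul, ← Matrix.map_sub _ (map_sub _)]
    rcases S.bracket_add i j hij with ⟨k, c, hk, h⟩ | h
    · refine Or.inl ⟨k, algebraMap K L c, hk, ?_⟩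
      rw [h]
      ext a b
      simp
    · exact Or.inr (by rw [h, Matrix.map_zero _ (map_zero _)])

/-- The matrix of a group element with respect to the weight basis. -/
def inWeightBasis : GL (Fin n) L ≃* GL (Fin n) L :=
  (MulAut.conj (S.baseChange L).basis)⁻¹

variable {L}

theorem inWeightBasis_apply (g : GL (Fin n) L) :
    S.inWeightBasis L g = ((S.baseChange L).basis)⁻¹ * g * (S.baseChange L).basis :=
  MulAut.conj_inv_apply _ _

theorem inWeightBasis_symm_apply (g : GL (Fin n) L) :
    (S.inWeightBasis L).symm g = (S.baseChange L).basis * g * ((S.baseChange L).basis)⁻¹ :=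
  rfl

theorem torusHom_eq (t : Multiplicative X →* Lˣ) :
    S.torusHom L t = (S.inWeightBasis L).symm ((S.baseChange L).torusElt t) := by
  rw [inWeightBasis_symm_apply]
  change (_ : GL (Fin n) L) * _ * _ = _
  congr 2

theorem inWeightBasis_torusHom (t : Multiplicative X →* Lˣ) :
    S.inWeightBasis L (S.torusHom L t) = (S.baseChange L).torusElt t := by
  rw [torusHom_eq, MulEquiv.apply_symm_apply]

theorem mem_torus_iff {g : GL (Fin n) L} :
    g ∈ S.torus L ↔ S.inWeightBasis L g ∈ (S.baseChange L).tor := by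
  constructor
  · rintro ⟨t, rfl⟩
    exact ⟨t, (S.inWeightBasis_torusHom t).symm⟩
  · rintro ⟨t, ht⟩
    refine ⟨t, ?_⟩
    rw [torusHom_eq, MulEquiv.symm_apply_eq]
    exact ht

theorem mem_points_iff [CharZero L] {g : GL (Fin n) L} :
    g ∈ S.points L ↔ S.inWeightBasis L g ∈ (S.baseChange L).grp := by
  have h : S.points L = (S.baseChange L).grp.map (S.inWeightBasis L).symm.toMonoidHom := by
    rw [points, grp, MonoidHom.map_closure, Set.image_union]
    congr 2
    · ext g
      constructor
      · rintro ⟨t, rfl⟩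
        exact ⟨_, ⟨t, rfl⟩, (S.torusHom_eq t).symm⟩
      · rintro ⟨_, ⟨t, rfl⟩, rfl⟩
        exact ⟨t, S.torusHom_eq t⟩
    · ext g
      constructor
      · rintro ⟨i, c, h⟩
        refine ⟨_, ⟨i, c, rfl⟩, ?_⟩
        ext1
        exact h.symm
      · rintro ⟨_, ⟨i, c, rfl⟩, rfl⟩
        exact ⟨i, c, rfl⟩
  rw [h]
  constructor
  · rintro ⟨x, hx, rfl⟩
    simpa using hx
  · intro hg
    exact ⟨_, hg, by simp⟩

variable (L) in
/-- The scalar extension of matrices. -/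
noncomputable abbrev extend : GL (Fin n) K →* GL (Fin n) L :=
  Matrix.GeneralLinearGroup.map (algebraMap K L)

theorem inWeightBasis_extend (g : GL (Fin n) K) :
    S.inWeightBasis L (extend L g) = extend L (S.inWeightBasis K g) := by
  rw [inWeightBasis_apply, inWeightBasis_apply, map_mul, map_mul, map_inv]
  have : extend L (S.baseChange K).basis = (S.baseChange L).basis := by
    ext1
    rfl
  rw [this]

theorem hasType_extend {g : GL (Fin n) K} {w : X ≃ₗ[ℤ] X}
    (h : (S.baseChange K).HasType g.val w) : (S.baseChange L).HasType (extend L g).val w := by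
  intro a b hab
  refine h a b fun h0 => hab ?_
  change algebraMap K L (g.val a b) = 0
  rw [h0, map_zero]

theorem extend_torusElt (t : Multiplicative X →* Kˣ) :
    extend L ((S.baseChange K).torusElt t) =
      (S.baseChange L).torusElt ((Units.map (algebraMap K L : K →* L)).comp t) := by
  ext a b
  change algebraMap K L (((S.baseChange K).torusElt t).val a b) = _
  rw [torusElt_val, torusElt_val, diag, diag, Matrix.diagonal_apply, Matrix.diagonal_apply]
  split_ifs
  · rfl
  · exact map_zero _

theorem extend_rootElt [CharZero K] [CharZero L] (i : ι) (c : K) :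
    extend L ((S.baseChange K).rootElt i c) = (S.baseChange L).rootElt i (algebraMap K L c) := by
  obtain ⟨m, hm⟩ := (S.baseChange K).isNilpotent_smul_e i c
  have e : ((algebraMap K L).mapMatrix (c • (S.baseChange K).e i) : Matrix (Fin n) (Fin n) L) =
      algebraMap K L c • (S.baseChange L).e i := by
    ext a b
    simp [baseChange]
  have hm' : (algebraMap K L c • (S.baseChange L).e i) ^ m = 0 := by
    rw [← e, ← map_pow, hm, map_zero]
  ext1
  change (algebraMap K L).mapMatrix ((S.baseChange K).rootElt i c).val = _
  rw [rootElt_val, rootElt_val, IsNilpotent.exp_eq_sum hm, IsNilpotent.exp_eq_sum hm', map_sum]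
  refine Finset.sum_congr rfl fun k _ => ?_
  rw [map_rat_smul, map_pow, e]

theorem extend_mem_grp [CharZero K] [CharZero L] {g : GL (Fin n) K}
    (hg : g ∈ (S.baseChange K).grp) : extend L g ∈ (S.baseChange L).grp := by
  have h : (S.baseChange K).grp ≤ (S.baseChange L).grp.comap (extend L) := by
    rw [grp, Subgroup.closure_le]
    rintro _ (⟨t, rfl⟩ | ⟨i, c, rfl⟩)
    · rw [SetLike.mem_coe, Subgroup.mem_comap, extend_torusElt]
      exact torusElt_mem_grp _ _
    · rw [SetLike.mem_coe, Subgroup.mem_comap, extend_rootElt]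
      exact rootElt_mem_grp _ _ _
  exact h hg

/-- An element of the torus over an extension field with entries in the ground field comes from
the torus over the ground field. -/
theorem mem_tor_of_extend_mem_tor {g : GL (Fin n) K}
    (h : extend L g ∈ (S.baseChange L).tor) : g ∈ (S.baseChange K).tor := by
  obtain ⟨t, ht⟩ := h
  have hinj := (algebraMap K L).injective
  set φ := Units.map (algebraMap K L : K →* L) with hφ
  have hφinj : Function.Injective φ := Units.map_injective hinj
  have htg : ∀ a b, algebraMap K L (g.val a b) = ((S.baseChange L).torusElt t).val a b := by
    intro a b
    change (extend L g).val a b = _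
    rw [← ht]
    rfl
  have hrange : ∀ x, t (Multiplicative.ofAdd x) ∈ φ.range := by
    refine S.forall_of_forall_wt (Subgroup.toAddSubgroup' (φ.range.comap t)) fun a => ?_
    have h1 := htg a a
    rw [torusElt_val, diag_apply_eq] at h1
    have h0 : g.val a a ≠ 0 := by
      intro h0
      rw [h0, map_zero] at h1
      exact Units.ne_zero _ h1.symm
    exact ⟨Units.mk0 _ h0, Units.ext h1⟩
  have hrange' : ∀ x, t x ∈ φ.range := fun x => hrange (Multiplicative.toAdd x)
  set t' : Multiplicative X →* Kˣ :=
    (MonoidHom.ofInjective hφinj).symm.toMonoidHom.comp (t.codRestrict φ.range hrange') with ht'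
  have ht'' : φ.comp t' = t := by
    refine MonoidHom.ext fun x => ?_
    have := (MonoidHom.ofInjective hφinj).apply_symm_apply (t.codRestrict φ.range hrange' x)
    exact congrArg Subtype.val this
  refine ⟨t', ?_⟩
  ext a b
  apply hinj
  rw [htg, ← ht'', ← extend_torusElt]
  rfl

variable (L) in
/-- The set of automorphisms of the character lattice induced by elements of the group over the
extension field `L`. -/
def weylSet [CharZero L] : Set (X ≃ₗ[ℤ] X) :=
  {w | ∃ g ∈ (S.baseChange L).grp, (S.baseChange L).HasType g.val w}

variable {S}

section

variable [CharZero L] [Finite ι] {w w' : X ≃ₗ[ℤ] X}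

omit [Finite ι] in
theorem inv_mul_mem_weylSet (h : w ∈ S.weylSet L) (h' : w' ∈ S.weylSet L) :
    w⁻¹ * w' ∈ S.weylSet L := by
  obtain ⟨g, hg, hw⟩ := h
  obtain ⟨g', hg', hw'⟩ := h'
  exact ⟨g⁻¹ * g', Subgroup.mul_mem _ (Subgroup.inv_mem _ hg) hg', hw.inv.mul hw'⟩

theorem exists_root_eq_of_mem_weylSet (h : w ∈ S.weylSet L) (i : ι) :
    ∃ j, P.root j = w (P.root i) := by
  have := Fintype.ofFinite ι
  obtain ⟨g, hg, hw⟩ := h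
  exact hw.exists_root_eq hg i

theorem eq_one_of_mem_weylSet [Module.Finite ℤ X] (h : w ∈ S.weylSet L)
    (hroot : ∀ i, w (P.root i) = P.root i) : w = 1 := by
  have := Fintype.ofFinite ι
  obtain ⟨g, hg, hw⟩ := h
  exact hw.eq_one_of_root hg hroot

theorem eq_of_mem_weylSet [Module.Finite ℤ X] (h : w ∈ S.weylSet L) (h' : w' ∈ S.weylSet L)
    (hroot : ∀ i, w (P.root i) = w' (P.root i)) : w = w' := by
  have := eq_one_of_mem_weylSet (inv_mul_mem_weylSet h h') fun i => by
    rw [LinearEquiv.mul_apply, ← hroot i]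
    exact w.symm_apply_apply _
  exact inv_mul_eq_one.1 this

variable [Module.Finite ℤ X] [P.IsReduced] [IsAlgClosed L]

/-- The torus is its own centralizer. -/
theorem mem_tor_of_mem_grp_of_hasType_one {g : GL (Fin n) L} (hg : g ∈ (S.baseChange L).grp)
    (h1 : (S.baseChange L).HasType g.val 1) : g ∈ (S.baseChange L).tor := by
  have := Fintype.ofFinite ι
  have := P.isTorsionFree_left
  have := P.free_left
  obtain ⟨f, hf⟩ := RootPairing.exists_dual_ne_zero_of_free (fun i => P.root i) (fun i => P.ne_zero i)
  exact mem_tor_of_hasType_one hf hg h1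

/-- An element of the torus is strongly regular if no root is trivial on it and if it is not
fixed by any nontrivial element of the Weyl group. -/
theorem mem_torus_of_commute {t : Multiplicative X →* Kˣ}
    (ht : ∀ i, t (Multiplicative.ofAdd (P.root i)) ≠ 1)
    (ht' : ∀ w ∈ S.weylSet L, w ≠ 1 →
      ∃ x, t (Multiplicative.ofAdd (w x)) ≠ t (Multiplicative.ofAdd x))
    {g : GL (Fin n) L} (hg : g ∈ S.points L) (hcomm : Commute g (extend L (S.torusHom K t))) :
    g ∈ S.torus L := by
  have := Fintype.ofFinite ι
  rw [mem_points_iff] at hg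
  rw [mem_torus_iff]
  have hinj := Units.map_injective (f := (algebraMap K L : K →* L)) (algebraMap K L).injective
  have hcomm' : Commute (S.inWeightBasis L g) ((S.baseChange L).torusElt
      ((Units.map (algebraMap K L : K →* L)).comp t)) := by
    rw [← extend_torusElt, ← inWeightBasis_torusHom, ← inWeightBasis_extend]
    exact hcomm.map _
  obtain ⟨w, hw, hfix⟩ := exists_hasType_of_commute (grp_le_lieNormalizer hg)
    (fun i h => ht i (hinj (h.trans (map_one _).symm))) hcomm'
  have hw1 : w = 1 := by
    by_contra hne
    obtain ⟨x, hx⟩ := ht' w ⟨_, hg, hw⟩ hne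
    exact hx (hinj (hfix x))
  rw [hw1] at hw
  exact mem_tor_of_mem_grp_of_hasType_one hg hw

variable [CharZero K]

variable (L) in
omit [IsAlgClosed L] [Module.Finite ℤ X] [P.IsReduced] [Finite ι] in
theorem exists_mem_weylSet {g : GL (Fin n) K} (hg : g ∈ S.points K)
    (hn : g ∈ Subgroup.normalizer (S.torus K : Set (GL (Fin n) K))) :
    ∃ w ∈ S.weylSet L, (S.baseChange K).HasType (S.inWeightBasis K g).val w := by
  have h1 : ∀ g ∈ Subgroup.normalizer (S.torus K : Set (GL (Fin n) K)),
      ∀ t ∈ (S.baseChange K).tor,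
      S.inWeightBasis K g * t * (S.inWeightBasis K g)⁻¹ ∈ (S.baseChange K).tor := by
    intro g hn t ht
    obtain ⟨s, rfl⟩ := (S.inWeightBasis K).surjective t
    rw [← map_mul, ← map_inv, ← map_mul, ← mem_torus_iff]
    rw [← mem_torus_iff] at ht
    exact (Subgroup.mem_normalizer_iff.1 hn s).1 ht
  obtain ⟨w, hw⟩ := exists_hasType_of_normalizes (h1 g hn) fun t ht => by
    have := h1 g⁻¹ (Subgroup.inv_mem _ hn) t ht
    rwa [map_inv, inv_inv] at this
  refine ⟨w, ⟨_, S.extend_mem_grp (S.mem_points_iff.1 hg), S.hasType_extend hw⟩, hw⟩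

variable (L) in
include L in
theorem mem_torus_of_hasType_one {g : GL (Fin n) K} (hg : g ∈ S.points K)
    (h1 : (S.baseChange K).HasType (S.inWeightBasis K g).val 1) : g ∈ S.torus K := by
  rw [mem_torus_iff]
  exact S.mem_tor_of_extend_mem_tor (L := L) (mem_tor_of_mem_grp_of_hasType_one
    (S.extend_mem_grp (S.mem_points_iff.1 hg)) (S.hasType_extend h1))

end

end SplitReductive

end

section

open Matrix

namespace SplitReductive

variable {ι X Y : Type*} [AddCommGroup X] [AddCommGroup Y] {P : RootDatum ι X Y}
  {L : Type*} [Field L] {n : ℕ} {S : SplitReductive P L n}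

/-! ### The Galois action on the roots -/

/-- A matrix which intertwines the weight vectors of the torus with their transforms under an
automorphism of the character lattice induces this automorphism on the weight spaces. -/
theorem hasType_of_mul_torusElt [CharZero L] {g : GL (Fin n) L} {w : X ≃ₗ[ℤ] X}
    (h : ∀ t t' : Multiplicative X →* Lˣ,
      (∀ x, t' (Multiplicative.ofAdd (w x)) = t (Multiplicative.ofAdd x)) →
      g * S.torusElt t = S.torusElt t' * g) : S.HasType g.val w := by
  intro a b hab
  have h1 : w⁻¹ (S.wt a) = S.wt b := by
    by_contra hne
    obtain ⟨t, ht⟩ := exists_torus_ne_one P L (sub_ne_zero.2 hne)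
    have h2 : g.val * (S.torusElt t).val = (S.torusElt (t.comp (AddMonoidHom.toMultiplicative
        ((w⁻¹ : X ≃ₗ[ℤ] X) : X →ₗ[ℤ] X).toAddMonoidHom))).val * g.val := by
      rw [← Units.val_mul, ← Units.val_mul, h]
      intro x
      exact congrArg (fun x => t (Multiplicative.ofAdd x)) (w.symm_apply_apply x)
    have h3 := congrFun (congrFun h2 a) b
    rw [torusElt_val, torusElt_val, mul_diag_apply, diag_mul_apply, mul_comm] at h3
    have h4 : t (Multiplicative.ofAdd (S.wt b)) = t (Multiplicative.ofAdd (w⁻¹ (S.wt a))) :=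
      Units.ext (mul_right_cancel₀ hab h3)
    exact ht (by rw [ofAdd_sub, map_div, h4, div_self'])
  rw [← h1]
  exact (w.apply_symm_apply _).symm

/-- Conjugation by an invertible matrix, composed with the entrywise action of a field
automorphism. -/
def twistedConj (s : L →+* L) (d : GL (Fin n) L) :
    Matrix (Fin n) (Fin n) L →+* Matrix (Fin n) (Fin n) L where
  toFun A := d.val * A.map s * (d⁻¹).val
  map_one' := by rw [Matrix.map_one _ (map_zero s) (map_one s), mul_one]; simp
  map_zero' := by rw [Matrix.map_zero _ (map_zero s), mul_zero, zero_mul]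
  map_add' A B := by rw [Matrix.map_add _ (map_add s), mul_add, add_mul]
  map_mul' A B := by
    rw [Matrix.map_mul]
    have : d.val * A.map s * (d⁻¹).val * (d.val * B.map s * (d⁻¹).val) =
        d.val * A.map s * ((d⁻¹).val * d.val) * B.map s * (d⁻¹).val := by
      simp only [mul_assoc]
    rw [this, ← Units.val_mul, inv_mul_cancel, Units.val_one, mul_one]
    simp only [mul_assoc]

end SplitReductive

namespace UnramifiedPair

open SplitReductive

variable {ι X Y : Type*} [AddCommGroup X] [AddCommGroup Y] {P : RootDatum ι X Y}
  {F : Type*} [NontriviallyNormedField F] [CharZero F] {n : ℕ} (D : UnramifiedPair P F n)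

/-- The action of a Galois element on a character of the lattice with values in `F^u`. -/
noncomputable def galTorus (s : GalU F) (t : Multiplicative X →* (maxUnramified F)ˣ) :
    Multiplicative X →* (maxUnramified F)ˣ :=
  (Units.map (s : maxUnramified F →* maxUnramified F)).comp t

/-- The cocycle comparing the weight basis with its Galois transform. -/
noncomputable def cocycle (s : GalU F) : GL (Fin n) (maxUnramified F) :=
  ((D.baseChange (maxUnramified F)).basis)⁻¹ * galGL s (D.baseChange (maxUnramified F)).basis

theorem galGL_torusElt (s : GalU F) (t : Multiplicative X →* (maxUnramified F)ˣ) :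
    galGL s ((D.baseChange (maxUnramified F)).torusElt t) =
      (D.baseChange (maxUnramified F)).torusElt (galTorus s t) := by
  refine Units.ext (Matrix.ext fun a b => ?_)
  change s (((D.baseChange (maxUnramified F)).torusElt t).val a b) = _
  rw [torusElt_val, torusElt_val, SplitReductive.diag, SplitReductive.diag, Matrix.diagonal_apply, Matrix.diagonal_apply]
  split_ifs
  · rfl
  · exact map_zero _

theorem inWeightBasis_galGL (s : GalU F) (g : GL (Fin n) (maxUnramified F)) :
    D.inWeightBasis (maxUnramified F) (galGL s g) =
      D.cocycle s * galGL s (D.inWeightBasis (maxUnramified F) g) * (D.cocycle s)⁻¹ := by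
  rw [inWeightBasis_apply, inWeightBasis_apply, cocycle, map_mul, map_mul, map_inv]
  group

/-- The cocycle permutes the weight spaces through the Galois action on the character lattice. -/
theorem cocycle_hasType (s : GalU F) :
    (D.baseChange (maxUnramified F)).HasType (D.cocycle s).val (D.gal s) := by
  refine hasType_of_mul_torusElt fun t t' h => ?_
  set t₀ := galTorus s⁻¹ t with ht₀
  have hst : ∀ x, s (t₀ x : maxUnramified F) = (t x : maxUnramified F) := fun x =>
    s.apply_symm_apply _
  have h1 := D.galGL_torusHom s t₀ t' (fun x => by rw [h, hst])
  have h2 := congrArg (D.inWeightBasis (maxUnramified F)) h1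
  rw [inWeightBasis_galGL, inWeightBasis_torusHom, inWeightBasis_torusHom, galGL_torusElt,
    mul_inv_eq_iff_eq_mul] at h2
  rw [← h2]
  congr 2
  refine MonoidHom.ext fun x => Units.ext (hst x).symm

/-- A Galois element which fixes the weight basis acts trivially on the character lattice. -/
theorem gal_eq_one {s : GalU F} (hs : ∀ a b, s (D.basis.val a b) = D.basis.val a b) :
    D.gal s = 1 := by
  have h1 : D.cocycle s = 1 := by
    rw [cocycle, inv_mul_eq_one]
    exact Units.ext (Matrix.ext fun a b => (hs a b).symm)
  have h2 := D.cocycle_hasType s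
  rw [h1] at h2
  exact HasType.unique (g := 1) h2 hasType_one

/-- The Galois action on the character lattice permutes the roots. -/
theorem exists_root_eq_gal [Finite ι] (s : GalU F) (i : ι) :
    ∃ j, P.root j = D.gal s (P.root i) := by
  have := Fintype.ofFinite ι
  set S := D.baseChange (maxUnramified F) with hS
  set Φ := twistedConj (n := n) (s : maxUnramified F →+* maxUnramified F) (D.cocycle s) with hΦ
  have hwt : ∀ a b, (S.e i).map s a b ≠ 0 → S.wt a = S.wt b + P.root i := fun a b hab =>
    S.wt_eq i a b fun h0 => hab (by rw [Matrix.map_apply, h0, map_zero])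
  -- the twisted conjugate of a root vector is a nilpotent matrix of nonzero weight whose exponential
  -- lies in the group
  have hN0 : Φ (S.e i) ≠ 0 := by
    refine conj_ne_zero (D.cocycle s) fun h0 => S.e_ne_zero i ?_
    refine Matrix.ext fun a b => ?_
    have := congrFun (congrFun h0 a) b
    exact s.injective (this.trans (map_zero s).symm)
  have hN : IsNilpotent (Φ (S.e i)) := (S.isNilpotent_e i).map Φ
  refine exists_root_of_exp_mem (S := S) hN hN0 (fun h0 => P.ne_zero i ?_)
    ((D.cocycle_hasType s).conj_weight hwt) ?_
  · exact (D.gal s).injective (h0.trans (map_zero _).symm)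
  · have h1 : D.inWeightBasis _ (galGL s ((D.inWeightBasis (maxUnramified F)).symm
        (S.rootElt i 1))) ∈ S.grp := by
      refine D.mem_points_iff.1 (D.galGL_points s _ (D.mem_points_iff.2 ?_))
      rw [MulEquiv.apply_symm_apply]
      exact S.rootElt_mem_grp i 1
    rw [inWeightBasis_galGL, MulEquiv.apply_symm_apply] at h1
    refine grp_le_lieNormalizer ?_
    convert h1 using 1
    ext1
    change IsNilpotent.exp (Φ (S.e i)) = Φ (IsNilpotent.exp ((1 : maxUnramified F) • S.e i))
    rw [one_smul, IsNilpotent.map_exp (S.isNilpotent_e i)]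

/-- A torus element is rational over `F` as soon as it is fixed by a Galois element `φ` which
generates the Galois group modulo the elements that fix the coordinates of the torus element and
the weight basis. -/
theorem torusHom_mem_ratTorus {φ : GalU F} {t : Multiplicative X →* (maxUnramified F)ˣ}
    (hφ : ∀ x, t (Multiplicative.ofAdd (D.gal φ x)) = galTorus φ t (Multiplicative.ofAdd x))
    (hgen : ∀ s : GalU F, ∃ i : ℕ, (∀ a b, ((φ ^ i)⁻¹ * s) (D.basis.val a b) = D.basis.val a b) ∧
      ∀ x, galTorus ((φ ^ i)⁻¹ * s) t x = t x) :
    D.torusHom (maxUnramified F) t ∈ D.ratTorus := by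
  have hmul : ∀ (s s' : GalU F) (g : GL (Fin n) (maxUnramified F)),
      galGL (s * s') g = galGL s (galGL s' g) := fun s s' g => rfl
  have h1 : galGL φ (D.torusHom (maxUnramified F) t) = D.torusHom (maxUnramified F) t :=
    D.galGL_torusHom φ t t fun x => congrArg Units.val (hφ x)
  have h2 : ∀ i : ℕ, galGL (φ ^ i) (D.torusHom (maxUnramified F) t) =
      D.torusHom (maxUnramified F) t := by
    intro i
    induction i with
    | zero => rfl
    | succ i ih => rw [pow_succ, hmul, h1, ih]
  refine ⟨⟨t, rfl⟩, fun s => ?_⟩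
  obtain ⟨i, hi, hi'⟩ := hgen s
  have h3 : galGL ((φ ^ i)⁻¹ * s) (D.torusHom (maxUnramified F) t) =
      D.torusHom (maxUnramified F) t := by
    refine D.galGL_torusHom _ t t fun x => ?_
    rw [D.gal_eq_one hi]
    exact congrArg Units.val (hi' (Multiplicative.ofAdd x)).symm
  have h4 : s = φ ^ i * ((φ ^ i)⁻¹ * s) := by group
  rw [h4, hmul, h3, h2]

end UnramifiedPair

end

/-! ### The absolute value on the algebraic closure of a local field -/

section

open Polynomial
open scoped NormedField Valued

section

variable (F : Type*) [NontriviallyNormedField F] [IsUltrametricDist F] [ProperSpace F]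

/-- The extension of the norm of `F` to the algebraic closure, as an absolute value. -/
noncomputable def closureAbs : AbsoluteValue (AlgebraicClosure F) ℝ where
  toFun := spectralNorm F (AlgebraicClosure F)
  map_mul' x y := spectralAlgNorm_mul x y
  nonneg' x := spectralNorm_nonneg x
  eq_zero' x := ⟨fun h => eq_zero_of_map_spectralNorm_eq_zero h (Algebra.IsAlgebraic.isAlgebraic x),
    fun h => by rw [h, spectralNorm_zero]⟩
  add_le' x y := map_add_le_add (spectralAlgNorm F (AlgebraicClosure F)) x y

theorem closureAbs_algebraMap (x : F) :
    closureAbs F (algebraMap F (AlgebraicClosure F) x) = ‖x‖ := spectralNorm_extends x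

theorem closureAbs_add_le (x y : AlgebraicClosure F) :
    closureAbs F (x + y) ≤ max (closureAbs F x) (closureAbs F y) :=
  isNonarchimedean_spectralNorm x y

theorem closureAbs_sub_le (x y : AlgebraicClosure F) :
    closureAbs F (x - y) ≤ max (closureAbs F x) (closureAbs F y) := by
  rw [sub_eq_add_neg, ← (closureAbs F).map_neg y]
  exact closureAbs_add_le F _ _

theorem closureAbs_sub_lt {x y : AlgebraicClosure F} {r : ℝ} (hx : closureAbs F x < r)
    (hy : closureAbs F y < r) : closureAbs F (x - y) < r :=
  (closureAbs_sub_le F x y).trans_lt (max_lt hx hy)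

variable {F} in
theorem closureAbs_algEquiv (σ : AlgebraicClosure F ≃ₐ[F] AlgebraicClosure F)
    (x : AlgebraicClosure F) : closureAbs F (σ x) = closureAbs F x :=
  (spectralNorm_eq_of_equiv σ x).symm

variable {F} in
theorem closureAbs_eq_one_of_pow {x : AlgebraicClosure F} {m : ℕ} (hm : m ≠ 0) (h : x ^ m = 1) :
    closureAbs F x = 1 := by
  have := congrArg (closureAbs F) h
  rw [map_pow, map_one] at this
  exact (pow_eq_one_iff_of_nonneg ((closureAbs F).nonneg x) hm).1 this

/-- The ring of integers of the algebraic closure. -/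
noncomputable def closureIntegers : Subring (AlgebraicClosure F) where
  carrier := {x | closureAbs F x ≤ 1}
  mul_mem' {x y} hx hy := by
    change closureAbs F (x * y) ≤ 1
    rw [map_mul]
    exact mul_le_one₀ hx ((closureAbs F).nonneg y) hy
  one_mem' := (map_one (closureAbs F)).le
  add_mem' {x y} hx hy := (closureAbs_add_le F x y).trans (max_le hx hy)
  zero_mem' := by
    change closureAbs F 0 ≤ 1
    rw [map_zero]
    exact zero_le_one
  neg_mem' {x} hx := by
    change closureAbs F (-x) ≤ 1
    rw [(closureAbs F).map_neg]
    exact hx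

/-- The maximal ideal of the ring of integers of the algebraic closure. -/
noncomputable def closureMaximal : Ideal (closureIntegers F) where
  carrier := {x | closureAbs F (x : AlgebraicClosure F) < 1}
  add_mem' {x y} hx hy := (closureAbs_add_le F x y).trans_lt (max_lt hx hy)
  zero_mem' := by
    change closureAbs F ((0 : closureIntegers F) : AlgebraicClosure F) < 1
    rw [Subring.coe_zero, map_zero]
    exact zero_lt_one
  smul_mem' c {x} hx := by
    change closureAbs F ((c * x : closureIntegers F) : AlgebraicClosure F) < 1
    rw [Subring.coe_mul, map_mul]
    exact (mul_le_of_le_one_left ((closureAbs F).nonneg _) c.2).trans_lt hx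

instance closureMaximal_isPrime : (closureMaximal F).IsPrime where
  ne_top' h := by
    have : (1 : closureIntegers F) ∈ closureMaximal F := h ▸ Submodule.mem_top
    have h1 : closureAbs F 1 < 1 := this
    rw [map_one] at h1
    exact lt_irrefl _ h1
  mem_or_mem' {x y} hxy := by
    by_contra! h
    have hx : closureAbs F (x : AlgebraicClosure F) = 1 := le_antisymm x.2 (not_lt.1 h.1)
    have hy : closureAbs F (y : AlgebraicClosure F) = 1 := le_antisymm y.2 (not_lt.1 h.2)
    have hxy' : closureAbs F ((x : AlgebraicClosure F) * y) < 1 := hxy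
    rw [map_mul, hx, hy, mul_one] at hxy'
    exact lt_irrefl _ hxy'

/-- The residue ring of the algebraic closure. -/
abbrev ClosureResidue : Type _ := closureIntegers F ⧸ closureMaximal F

/-- The reduction map to the residue ring. -/
noncomputable abbrev closureRed : closureIntegers F →+* ClosureResidue F :=
  Ideal.Quotient.mk (closureMaximal F)

variable {F} in
theorem closureRed_eq_zero {x : closureIntegers F} :
    closureRed F x = 0 ↔ closureAbs F (x : AlgebraicClosure F) < 1 :=
  Ideal.Quotient.eq_zero_iff_mem

variable {F} in
theorem closureRed_eq {x y : closureIntegers F} :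
    closureRed F x = closureRed F y ↔ closureAbs F ((x : AlgebraicClosure F) - y) < 1 := by
  rw [← sub_eq_zero, ← map_sub, closureRed_eq_zero]
  rfl

variable {F} in
omit [ProperSpace F] in
theorem norm_lt_one_of_mem_maximalIdeal {x : 𝒪[F]} (hx : x ∈ 𝓂[F]) : ‖(x : F)‖ < 1 := by
  refine lt_of_le_of_ne (Valued.integer.norm_le_one x) fun h => ?_
  exact hx (Valued.integer.isUnit_iff_norm_eq_one.2 h)

/-- The inclusion of rings of integers. -/
noncomputable def integersToClosure : 𝒪[F] →+* closureIntegers F :=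
  ((algebraMap F (AlgebraicClosure F)).comp (𝒪[F]).subtype).codRestrict (closureIntegers F)
    fun x => by
      change closureAbs F (algebraMap F (AlgebraicClosure F) x) ≤ 1
      rw [closureAbs_algebraMap]
      exact Valued.integer.norm_le_one x

/-- The embedding of the residue field in the residue ring of the algebraic closure. -/
noncomputable instance residueAlgebra : Algebra 𝓀[F] (ClosureResidue F) :=
  (Ideal.quotientMap (closureMaximal F) (integersToClosure F) (I := 𝓂[F]) fun x hx => by
    change closureAbs F (algebraMap F (AlgebraicClosure F) x) < 1
    rw [closureAbs_algebraMap]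
    exact norm_lt_one_of_mem_maximalIdeal hx).toAlgebra

theorem algebraMap_residue (x : 𝒪[F]) :
    algebraMap 𝓀[F] (ClosureResidue F) (IsLocalRing.residue 𝒪[F] x) =
      closureRed F (integersToClosure F x) := rfl

theorem algebraMap_residue_injective :
    Function.Injective (algebraMap 𝓀[F] (ClosureResidue F)) := by
  refine (injective_iff_map_eq_zero _).2 fun a ha => ?_
  obtain ⟨x, rfl⟩ := IsLocalRing.residue_surjective a
  rw [algebraMap_residue, closureRed_eq_zero] at ha
  change closureAbs F (algebraMap F (AlgebraicClosure F) x) < 1 at ha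
  rw [closureAbs_algebraMap] at ha
  rw [IsLocalRing.residue_eq_zero_iff]
  exact fun h => ha.ne (Valued.integer.isUnit_iff_norm_eq_one.1 h)

instance finite_residueField : Finite 𝓀[F] := by
  have hset : (𝒪[F] : Set F) = Metric.closedBall 0 1 := by
    ext x
    rw [mem_closedBall_zero_iff]
    exact Valued.integer.mem_iff
  have : CompactSpace 𝒪[F] :=
    (isCompact_iff_compactSpace (s := (𝒪[F] : Set F))).1 (hset ▸ isCompact_closedBall (0 : F) 1)
  have hopen : IsOpen ((𝓂[F] : Ideal 𝒪[F]).toAddSubgroup : Set 𝒪[F]) := by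
    have h : ((𝓂[F] : Ideal 𝒪[F]).toAddSubgroup : Set 𝒪[F]) =
        {x : 𝒪[F] | ‖(x : F)‖ < 1} := by
      ext x
      refine ⟨norm_lt_one_of_mem_maximalIdeal, fun hx h => ?_⟩
      exact hx.ne (Valued.integer.isUnit_iff_norm_eq_one.1 h)
    rw [h]
    exact isOpen_lt (continuous_norm.comp continuous_subtype_val) continuous_const
  exact AddSubgroup.quotient_finite_of_isOpen _ hopen

theorem one_lt_residueCard : 1 < residueCard F :=
  have := finite_residueField F
  Finite.one_lt_card

omit [ProperSpace F] in
theorem card_residueField [Fintype 𝓀[F]] : Fintype.card 𝓀[F] = residueCard F :=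
  Nat.card_eq_fintype_card.symm

theorem residueCard_cast_eq_zero : (residueCard F : ClosureResidue F) = 0 := by
  have h : ((Nat.card 𝓀[F] : ℕ) : 𝓀[F]) = 0 := by
    have := Fintype.ofFinite 𝓀[F]
    rw [Nat.card_eq_fintype_card]
    exact FiniteField.cast_card_eq_zero 𝓀[F]
  have := congrArg (algebraMap 𝓀[F] (ClosureResidue F)) h
  rwa [map_natCast, map_zero] at this

/-- The `q`-power map of the residue ring. -/
noncomputable def residueFrobenius : ClosureResidue F →ₐ[𝓀[F]] ClosureResidue F :=
  @FiniteField.frobeniusAlgHom 𝓀[F] (ClosureResidue F) _ (Fintype.ofFinite _) _ _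

theorem residueFrobenius_apply (x : ClosureResidue F) :
    residueFrobenius F x = x ^ residueCard F := by
  let := Fintype.ofFinite 𝓀[F]
  rw [← card_residueField]
  rfl

theorem residueFrobenius_pow_apply (i : ℕ) (x : ClosureResidue F) :
    (residueFrobenius F)^[i] x = x ^ residueCard F ^ i := by
  induction i with
  | zero => simp
  | succ i ih =>
    rw [Function.iterate_succ_apply', ih, residueFrobenius_apply, ← pow_mul, ← pow_succ]

theorem residueFrobenius_injective : Function.Injective (residueFrobenius F) := by
  rw [injective_iff_map_eq_zero]
  intro x hx
  rw [residueFrobenius_apply] at hx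
  exact pow_eq_zero_iff (zero_lt_one.trans (one_lt_residueCard F)).ne' |>.1 hx

variable {F}

theorem residueCard_pow_sub_one_ne_zero {d : ℕ} (hd : 0 < d) : residueCard F ^ d - 1 ≠ 0 := by
  have := Nat.one_lt_pow hd.ne' (one_lt_residueCard F)
  omega

omit [ProperSpace F] in
theorem pow_residueCard_eq_one_of_dvd {M : Type*} [Monoid M] {d e : ℕ} (hde : d ∣ e) {ζ : M}
    (hζ : ζ ^ (residueCard F ^ d - 1) = 1) : ζ ^ (residueCard F ^ e - 1) = 1 := by
  obtain ⟨k, rfl⟩ := hde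
  obtain ⟨m, hm⟩ : residueCard F ^ d - 1 ∣ residueCard F ^ (d * k) - 1 := by
    have := Nat.sub_dvd_pow_sub_pow (residueCard F ^ d) 1 k
    rwa [one_pow, ← pow_mul] at this
  rw [hm, pow_mul, hζ, one_pow]

theorem cast_residueCard_pow_sub_one {d : ℕ} (hd : 0 < d) :
    ((residueCard F ^ d - 1 : ℕ) : ClosureResidue F) = -1 := by
  rw [Nat.cast_sub (Nat.one_le_pow _ _ (zero_lt_one.trans (one_lt_residueCard F))), Nat.cast_pow,
    residueCard_cast_eq_zero, zero_pow hd.ne', Nat.cast_one, zero_sub]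

/-! ### Roots of unity of order prime to the residue characteristic -/

/-- Distinct roots of unity of order dividing `q ^ d - 1` have distinct reductions. -/
theorem eq_one_of_closureAbs_sub_lt {d : ℕ} (hd : 0 < d) {x : AlgebraicClosure F}
    (hx : x ^ (residueCard F ^ d - 1) = 1) (h : closureAbs F (x - 1) < 1) : x = 1 := by
  by_contra hne
  set M := residueCard F ^ d - 1 with hM
  have hM0 : M ≠ 0 := residueCard_pow_sub_one_ne_zero hd
  set z : closureIntegers F := ⟨x, (closureAbs_eq_one_of_pow hM0 hx).le⟩ with hz
  have hzsum : ∑ i ∈ Finset.range M, z ^ i = 0 := by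
    have h1 : (∑ i ∈ Finset.range M, z ^ i) * (z - 1) = 0 := by
      rw [geom_sum_mul, sub_eq_zero]
      exact Subtype.ext hx
    refine (mul_eq_zero.1 h1).resolve_right fun h2 => hne ?_
    exact congrArg Subtype.val (sub_eq_zero.1 h2)
  have hred : closureRed F z = 1 := by
    rw [← map_one (closureRed F), closureRed_eq]
    exact h
  have h3 := congrArg (closureRed F) hzsum
  rw [map_sum, map_zero] at h3
  simp only [map_pow, hred, one_pow, Finset.sum_const, Finset.card_range, nsmul_eq_mul,
    mul_one] at h3
  rw [cast_residueCard_pow_sub_one hd] at h3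
  exact neg_ne_zero.2 one_ne_zero h3

theorem eq_of_closureAbs_sub_lt {d : ℕ} (hd : 0 < d) {x y : AlgebraicClosure F}
    (hx : x ^ (residueCard F ^ d - 1) = 1) (hy : y ^ (residueCard F ^ d - 1) = 1)
    (h : closureAbs F (x - y) < 1) : x = y := by
  have hM0 : residueCard F ^ d - 1 ≠ 0 := residueCard_pow_sub_one_ne_zero hd
  have hy1 := closureAbs_eq_one_of_pow hM0 hy
  have hy0 : y ≠ 0 := by
    rintro rfl
    rw [map_zero] at hy1
    exact zero_ne_one hy1
  have h1 : x / y = 1 := by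
    refine eq_one_of_closureAbs_sub_lt hd (by rw [div_pow, hx, hy, div_one]) ?_
    rw [div_sub_one hy0, map_div₀, hy1, div_one]
    exact h
  exact (div_eq_one_iff_eq hy0).1 h1

theorem coeff_minpoly_norm_le {x : AlgebraicClosure F} (hx : closureAbs F x ≤ 1) (i : ℕ) :
    ‖(minpoly F x).coeff i‖ ≤ 1 :=
  (spectralValue_le_one_iff (minpoly.monic (Algebra.IsIntegral.isIntegral x))).1 hx i

/-- The minimal polynomial of an integral element, with coefficients in the ring of integers. -/
theorem exists_monic_lift_minpoly {x : AlgebraicClosure F} (hx : closureAbs F x ≤ 1) :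
    ∃ p : 𝒪[F][X], p.Monic ∧ p.map (𝒪[F]).subtype = minpoly F x := by
  have h : minpoly F x ∈ Polynomial.lifts (𝒪[F]).subtype := by
    rw [Polynomial.lifts_iff_coeff_lifts]
    intro i
    exact ⟨⟨_, Valued.integer.mem_iff.2 (coeff_minpoly_norm_le hx i)⟩, rfl⟩
  obtain ⟨p, hp, -, hmonic⟩ := Polynomial.lifts_and_natDegree_eq_and_monic h
    (minpoly.monic (Algebra.IsIntegral.isIntegral x))
  exact ⟨p, hmonic, hp⟩

theorem closureRed_eval (p : 𝒪[F][X]) (x : closureIntegers F) :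
    closureRed F (p.eval₂ (integersToClosure F) x) =
      aeval (closureRed F x) (p.map (IsLocalRing.residue 𝒪[F])) := by
  rw [hom_eval₂, aeval_def, eval₂_map]
  rfl

theorem coe_eval₂_integersToClosure (p : 𝒪[F][X]) (x : closureIntegers F) :
    ((p.eval₂ (integersToClosure F) x : closureIntegers F) : AlgebraicClosure F) =
      aeval (x : AlgebraicClosure F) (p.map (𝒪[F]).subtype) := by
  change (closureIntegers F).subtype _ = _
  rw [hom_eval₂, aeval_def, eval₂_map]
  rfl

theorem isIntegral_closureRed (x : closureIntegers F) : IsIntegral 𝓀[F] (closureRed F x) := by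
  obtain ⟨p, hp, hpx⟩ := exists_monic_lift_minpoly x.2
  refine ⟨p.map (IsLocalRing.residue 𝒪[F]), hp.map _, ?_⟩
  rw [← aeval_def, ← closureRed_eval]
  have : p.eval₂ (integersToClosure F) x = 0 := by
    apply Subtype.ext
    rw [coe_eval₂_integersToClosure, hpx, minpoly.aeval]
    rfl
  rw [this, map_zero]

/-- An element of absolute value one is congruent to a root of unity. -/
theorem exists_pow_closureRed_eq_one {x : AlgebraicClosure F} (hx : closureAbs F x = 1) :
    ∃ d, 0 < d ∧ closureAbs F (x ^ (residueCard F ^ d - 1) - 1) < 1 := by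
  set u : closureIntegers F := ⟨x, hx.le⟩ with hu
  set v := closureRed F u with hv
  have hv0 : v ≠ 0 := by
    rw [hv, Ne, closureRed_eq_zero]
    exact not_lt.2 hx.ge
  -- the reduction `v` lies in a finite ring, on which the power map by `q` is injective
  have hfin : Finite (Algebra.adjoin 𝓀[F] {v}) := by
    have : Module.Finite 𝓀[F] (Algebra.adjoin 𝓀[F] {v}) :=
      Module.Finite.iff_fg.2 (isIntegral_closureRed u).fg_adjoin_singleton
    exact Module.finite_of_finite 𝓀[F]
  have hmem : ∀ i : ℕ, v ^ residueCard F ^ i ∈ Algebra.adjoin 𝓀[F] {v} := fun i =>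
    Subalgebra.pow_mem _ (Algebra.subset_adjoin (Set.mem_singleton v)) _
  obtain ⟨i, j, hij, h⟩ := Finite.exists_ne_map_eq_of_infinite
    fun i : ℕ => (⟨_, hmem i⟩ : Algebra.adjoin 𝓀[F] {v})
  have h' : v ^ residueCard F ^ i = v ^ residueCard F ^ j := congrArg Subtype.val h
  have key : ∀ i j, i < j → v ^ residueCard F ^ i = v ^ residueCard F ^ j →
      ∃ d, 0 < d ∧ v ^ (residueCard F ^ d - 1) = 1 := by
    intro i j hij h
    refine ⟨j - i, by omega, ?_⟩
    rw [← residueFrobenius_pow_apply, ← residueFrobenius_pow_apply,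
      show j = i + (j - i) by omega, Function.iterate_add_apply] at h
    have h1 := ((residueFrobenius_injective F).iterate i) h
    rw [residueFrobenius_pow_apply] at h1
    have h2 : residueCard F ^ (j - i) = (residueCard F ^ (j - i) - 1) + 1 := by
      have := Nat.one_le_pow (j - i) _ (zero_lt_one.trans (one_lt_residueCard F))
      omega
    rw [h2, pow_succ] at h1
    exact (mul_eq_right₀ hv0).1 h1.symm
  obtain ⟨d, hd, hd'⟩ : ∃ d, 0 < d ∧ v ^ (residueCard F ^ d - 1) = 1 := by
    rcases hij.lt_or_gt with hlt | hlt
    · exact key i j hlt h'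
    · exact key j i hlt h'.symm
  refine ⟨d, hd, ?_⟩
  rw [hv, ← map_pow, ← map_one (closureRed F), closureRed_eq] at hd'
  exact hd'

variable [CharZero F]

theorem exists_isPrimitiveRoot_closure {d : ℕ} (hd : 0 < d) :
    ∃ ζ : AlgebraicClosure F, IsPrimitiveRoot ζ (residueCard F ^ d - 1) := by
  have : NeZero ((residueCard F ^ d - 1 : ℕ) : AlgebraicClosure F) :=
    ⟨Nat.cast_ne_zero.2 (residueCard_pow_sub_one_ne_zero hd)⟩
  exact (HasEnoughRootsOfUnity.exists_primitiveRoot (AlgebraicClosure F)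
    (residueCard F ^ d - 1))

/-- An element of absolute value one is congruent to a unique root of unity of order prime to the
residue characteristic, its Teichmüller representative. -/
theorem exists_root_of_unity_closureAbs_sub_lt {x : AlgebraicClosure F} (hx : closureAbs F x = 1) :
    ∃ d, 0 < d ∧ ∃ ζ : AlgebraicClosure F, ζ ^ (residueCard F ^ d - 1) = 1 ∧
      closureAbs F (x - ζ) < 1 := by
  obtain ⟨d, hd, h⟩ := exists_pow_closureRed_eq_one hx
  refine ⟨d, hd, ?_⟩
  obtain ⟨ω, hω⟩ := exists_isPrimitiveRoot_closure (F := F) hd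
  have hpos : 0 < residueCard F ^ d - 1 := Nat.pos_of_ne_zero (residueCard_pow_sub_one_ne_zero hd)
  have hprod := congrArg (eval x) (X_pow_sub_one_eq_prod hpos hω)
  rw [eval_sub, eval_pow, eval_X, eval_one, eval_prod] at hprod
  -- one of the factors of `x ^ (q ^ d - 1) - 1 = ∏ (x - ζ)` has to be small
  rw [hprod, map_prod] at h
  by_contra! hcon
  refine not_lt.2 ?_ h
  refine Finset.prod_induction _ (fun r : ℝ => 1 ≤ r) (fun _ _ => one_le_mul_of_one_le_of_one_le)
    le_rfl fun ζ hζ => ?_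
  rw [eval_sub, eval_X, eval_C]
  exact hcon ζ ((mem_nthRootsFinset hpos _).1 hζ)

end

end

/-! ### The maximal unramified extension -/

section

open Polynomial
open scoped NormedField Valued

section

variable {F : Type*} [NontriviallyNormedField F] [IsUltrametricDist F] [ProperSpace F]

variable (F) in
/-- The value group of `F` is discrete. -/
theorem exists_norm_le_of_norm_lt_one : ∃ ρ : ℝ, 0 ≤ ρ ∧ ρ < 1 ∧ ∀ b : F, ‖b‖ < 1 → ‖b‖ ≤ ρ := by
  have hcomp : IsCompact (Metric.ball (0 : F) 1) :=
    Metric.isCompact_of_isClosed_isBounded (IsUltrametricDist.isClosed_ball _ _)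
      Metric.isBounded_ball
  obtain ⟨a, ha, hmax⟩ := hcomp.exists_isMaxOn ⟨0, Metric.mem_ball_self one_pos⟩
    continuous_norm.continuousOn
  exact ⟨‖a‖, norm_nonneg a, mem_ball_zero_iff.1 ha, fun b hb => hmax (mem_ball_zero_iff.2 hb)⟩

theorem exists_closureAbs_lt_one_of_prod {s : Multiset (AlgebraicClosure F)}
    (h : closureAbs F s.prod < 1) : ∃ x ∈ s, closureAbs F x < 1 := by
  induction s using Multiset.induction_on with
  | empty =>
    rw [Multiset.prod_zero, map_one] at h
    exact absurd h (lt_irrefl _)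
  | cons a s ih =>
    by_cases ha : closureAbs F a < 1
    · exact ⟨a, Multiset.mem_cons_self a s, ha⟩
    · rw [Multiset.prod_cons, map_mul] at h
      obtain ⟨x, hx, hx'⟩ := ih (lt_of_le_of_lt
        (le_mul_of_one_le_left ((closureAbs F).nonneg _) (not_lt.1 ha)) h)
      exact ⟨x, Multiset.mem_cons_of_mem hx, hx'⟩

variable [CharZero F]

/-- A root of unity which is close to an element of an intermediate field belongs to this field:
it is fixed by all automorphisms fixing the intermediate field. -/
theorem root_of_unity_mem_of_closureAbs_sub_lt {E : IntermediateField F (AlgebraicClosure F)}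
    {u ζ : AlgebraicClosure F} (hu : u ∈ E) {d : ℕ} (hd : 0 < d)
    (hζ : ζ ^ (residueCard F ^ d - 1) = 1) (h : closureAbs F (u - ζ) < 1) : ζ ∈ E := by
  rw [← InfiniteGalois.fixedField_fixingSubgroup E, IntermediateField.mem_fixedField_iff]
  intro τ hτ
  rw [IntermediateField.mem_fixingSubgroup_iff] at hτ
  refine eq_of_closureAbs_sub_lt hd (by rw [← map_pow, hζ, map_one]) hζ ?_
  have h1 : closureAbs F (u - τ ζ) < 1 := by
    rw [← hτ u hu, ← map_sub, closureAbs_algEquiv]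
    exact h
  have := closureAbs_sub_lt F h h1
  rwa [sub_sub_sub_cancel_left] at this

/-- An element of an unramified extension is fixed by all automorphisms fixing the roots of unity
of order prime to the residue characteristic: it is a limit of sums of multiples of such roots
of unity in the extension. -/
theorem algEquiv_apply_eq_of_isFiniteUnramified {E : IntermediateField F (AlgebraicClosure F)}
    (hE : IsFiniteUnramified F E) {σ : AlgebraicClosure F ≃ₐ[F] AlgebraicClosure F}
    (hσ : ∀ d, 0 < d → ∀ ζ : AlgebraicClosure F, ζ ^ (residueCard F ^ d - 1) = 1 → σ ζ = ζ)
    {x : AlgebraicClosure F} (hx : x ∈ E) : σ x = x := by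
  obtain ⟨ρ, hρ0, hρ1, hρ⟩ := exists_norm_le_of_norm_lt_one F
  -- the approximation of `y` is a multiple `a ζ` with `|a| = |y|` and a root of unity `ζ`
  have step : ∀ y ∈ E, ∃ z ∈ E, σ z = z ∧ closureAbs F (y - z) ≤ ρ * closureAbs F y := by
    intro y hy
    by_cases hy0 : y = 0
    · exact ⟨0, zero_mem _, map_zero σ, by rw [hy0, sub_zero, map_zero, mul_zero]⟩
    obtain ⟨a, ha⟩ := hE.2 y hy hy0
    have hypos := (closureAbs F).pos hy0
    have hya : closureAbs F y = ‖a‖ := ha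
    have ha0 : algebraMap F (AlgebraicClosure F) a ≠ 0 := by
      rw [Ne, map_eq_zero]
      rintro rfl
      rw [norm_zero] at hya
      exact hypos.ne' hya
    set u := y / algebraMap F (AlgebraicClosure F) a with hu
    have huE : u ∈ E := div_mem hy (E.algebraMap_mem a)
    have hu1 : closureAbs F u = 1 := by
      rw [hu, map_div₀, closureAbs_algebraMap, ← hya, div_self hypos.ne']
    obtain ⟨d, hd, ζ, hζ, hclose⟩ := exists_root_of_unity_closureAbs_sub_lt hu1
    have hζE := root_of_unity_mem_of_closureAbs_sub_lt huE hd hζ hclose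
    have huζ : closureAbs F (u - ζ) ≤ ρ := by
      by_cases h0 : u - ζ = 0
      · rw [h0, map_zero]
        exact hρ0
      obtain ⟨b, hb⟩ := hE.2 _ (sub_mem huE hζE) h0
      have hb' : closureAbs F (u - ζ) = ‖b‖ := hb
      rw [hb'] at hclose ⊢
      exact hρ b hclose
    refine ⟨algebraMap F (AlgebraicClosure F) a * ζ, mul_mem (E.algebraMap_mem a) hζE, ?_, ?_⟩
    · rw [map_mul, AlgEquiv.commutes, hσ d hd ζ hζ]
    · have : y - algebraMap F (AlgebraicClosure F) a * ζ =
          algebraMap F (AlgebraicClosure F) a * (u - ζ) := by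
        rw [hu, mul_sub, mul_div_cancel₀ _ ha0]
      rw [this, map_mul, closureAbs_algebraMap, hya, mul_comm]
      exact mul_le_mul_of_nonneg_right huζ (norm_nonneg a)
  have approx : ∀ k : ℕ, ∃ z ∈ E, σ z = z ∧ closureAbs F (x - z) ≤ ρ ^ k * closureAbs F x := by
    intro k
    induction k with
    | zero => exact ⟨0, zero_mem _, map_zero σ, by rw [sub_zero, pow_zero, one_mul]⟩
    | succ k ih =>
      obtain ⟨z, hz, hσz, hle⟩ := ih
      obtain ⟨z', hz', hσz', hle'⟩ := step _ (sub_mem hx hz)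
      refine ⟨z + z', add_mem hz hz', by rw [map_add, hσz, hσz'], ?_⟩
      rw [← sub_sub, pow_succ', mul_assoc]
      exact hle'.trans (mul_le_mul_of_nonneg_left hle hρ0)
  have hbound : ∀ k : ℕ, closureAbs F (σ x - x) ≤ ρ ^ k * closureAbs F x := by
    intro k
    obtain ⟨z, -, hσz, hle⟩ := approx k
    have e : σ x - x = σ (x - z) - (x - z) := by rw [map_sub, hσz, sub_sub_sub_cancel_right]
    rw [e]
    refine (closureAbs_sub_le F _ _).trans (max_le ?_ hle)
    rw [closureAbs_algEquiv]
    exact hle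
  have hlim : Filter.Tendsto (fun k : ℕ => ρ ^ k * closureAbs F x) Filter.atTop (nhds 0) := by
    have := (tendsto_pow_atTop_nhds_zero_of_lt_one hρ0 hρ1).mul_const (closureAbs F x)
    rwa [zero_mul] at this
  have h0 : closureAbs F (σ x - x) ≤ 0 := ge_of_tendsto' hlim hbound
  exact sub_eq_zero.1 ((closureAbs F).eq_zero.1 (le_antisymm h0 ((closureAbs F).nonneg _)))

/-- A polynomial over the integers of `F` with nonzero reduction and of degree less than that of
the minimal polynomial of a root of unity of order prime to the residue characteristic does not
have small value at this root: otherwise its reduction would vanish at the reductions of all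
conjugates, which are distinct. -/
theorem closureAbs_aeval_eq_one {d : ℕ} (hd : 0 < d) {ζ : AlgebraicClosure F}
    (hζ : ζ ^ (residueCard F ^ d - 1) = 1) {p : 𝒪[F][X]}
    (hp : p.map (IsLocalRing.residue 𝒪[F]) ≠ 0) (hdeg : p.natDegree < (minpoly F ζ).natDegree) :
    closureAbs F (aeval ζ (p.map (𝒪[F]).subtype)) = 1 := by
  have hζint : closureAbs F ζ ≤ 1 :=
    (closureAbs_eq_one_of_pow (residueCard_pow_sub_one_ne_zero hd) hζ).le
  refine le_antisymm ?_ (not_lt.1 fun hlt => hp ?_)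
  · rw [← coe_eval₂_integersToClosure p ⟨ζ, hζint⟩]
    exact (p.eval₂ (integersToClosure F) (⟨ζ, hζint⟩ : closureIntegers F)).2
  have hroot : ∀ ξ : (minpoly F ζ).rootSet (AlgebraicClosure F),
      ∃ σ : AlgebraicClosure F ≃ₐ[F] AlgebraicClosure F, σ ζ = ξ := fun ξ =>
    minpoly.exists_algEquiv_of_root' (Algebra.IsAlgebraic.isAlgebraic ζ) (mem_rootSet.1 ξ.2).2
  have hpow : ∀ ξ : (minpoly F ζ).rootSet (AlgebraicClosure F),
      (ξ : AlgebraicClosure F) ^ (residueCard F ^ d - 1) = 1 := by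
    intro ξ
    obtain ⟨σ, hσ⟩ := hroot ξ
    rw [← hσ, ← map_pow, hζ, map_one]
  obtain ⟨r, hr⟩ : ∃ r : (minpoly F ζ).rootSet (AlgebraicClosure F) → closureIntegers F,
      ∀ ξ, (r ξ : AlgebraicClosure F) = ξ :=
    ⟨fun ξ => ⟨ξ, (closureAbs_eq_one_of_pow (residueCard_pow_sub_one_ne_zero hd)
      (hpow ξ)).le⟩, fun _ => rfl⟩
  have hfinj : Function.Injective fun ξ => closureRed F (r ξ) := by
    intro ξ ξ' h
    have h1 := (closureRed_eq (x := r ξ) (y := r ξ')).1 h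
    rw [hr, hr] at h1
    exact Subtype.ext (eq_of_closureAbs_sub_lt hd (hpow ξ) (hpow ξ') h1)
  rw [← Polynomial.map_eq_zero_iff (algebraMap_residue_injective F)]
  refine eq_zero_of_natDegree_lt_card_of_eval_eq_zero _ hfinj (fun ξ => ?_) ?_
  · rw [eval_map_algebraMap, ← closureRed_eval, closureRed_eq_zero,
      coe_eval₂_integersToClosure]
    obtain ⟨σ, hσ⟩ := hroot ξ
    rw [hr, ← hσ, aeval_algHom_apply, closureAbs_algEquiv]
    exact hlt
  · rw [card_rootSet_eq_natDegree (minpoly.irreducible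
      (Algebra.IsIntegral.isIntegral ζ)).separable (IsAlgClosed.splits _)]
    exact (natDegree_map_le.trans natDegree_map_le).trans_lt hdeg

/-- Roots of unity of order prime to the residue characteristic generate unramified extensions. -/
theorem isFiniteUnramified_adjoin {d : ℕ} (hd : 0 < d) {ζ : AlgebraicClosure F}
    (hζ : ζ ^ (residueCard F ^ d - 1) = 1) :
    IsFiniteUnramified F (IntermediateField.adjoin F {ζ}) := by
  have hint : IsIntegral F ζ := Algebra.IsIntegral.isIntegral ζ
  refine ⟨IntermediateField.adjoin.finiteDimensional hint, fun x hx hx0 => ?_⟩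
  obtain ⟨A, hA, hdeg⟩ : ∃ A : F[X], aeval ζ A = x ∧ A.natDegree < (minpoly F ζ).natDegree := by
    rw [← IntermediateField.mem_toSubalgebra,
      IntermediateField.adjoin_simple_toSubalgebra_of_isAlgebraic hint.isAlgebraic,
      Algebra.adjoin_singleton_eq_range_aeval] at hx
    obtain ⟨A, hA⟩ := hx
    have hA' : aeval ζ A = x := hA
    refine ⟨A %ₘ minpoly F ζ, ?_, natDegree_modByMonic_lt _ (minpoly.monic hint)
      (minpoly.ne_one F ζ)⟩
    rw [← hA', aeval_modByMonic_eq_self_of_root (minpoly.aeval F ζ)]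
  have hA0 : A ≠ 0 := by
    rintro rfl
    exact hx0 (by rw [← hA, map_zero])
  obtain ⟨i, hi, hmax⟩ := Finset.exists_max_image A.support (fun i => ‖A.coeff i‖)
    (support_nonempty.2 hA0)
  -- dividing `A` by its largest coefficient `a` gives an integral polynomial with nonzero reduction,
  -- so that `|x| = |a|`
  set a := A.coeff i with ha
  have ha0 : a ≠ 0 := mem_support_iff.1 hi
  have hle : ∀ j, ‖A.coeff j‖ ≤ ‖a‖ := by
    intro j
    by_cases hj : A.coeff j = 0
    · rw [hj, norm_zero]
      exact norm_nonneg a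
    · exact hmax j (mem_support_iff.2 hj)
  have hcoeff : ∀ j, (C a⁻¹ * A).coeff j = A.coeff j / a := fun j => by
    rw [coeff_C_mul, div_eq_inv_mul]
  obtain ⟨p, hp, hpdeg⟩ : ∃ p : 𝒪[F][X], p.map (𝒪[F]).subtype = C a⁻¹ * A ∧
      p.natDegree = (C a⁻¹ * A).natDegree := by
    have h : C a⁻¹ * A ∈ Polynomial.lifts (𝒪[F]).subtype := by
      rw [Polynomial.lifts_iff_coeff_lifts]
      intro j
      refine ⟨⟨_, Valued.integer.mem_iff.2 (?_ : ‖(C a⁻¹ * A).coeff j‖ ≤ 1)⟩, rfl⟩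
      rw [hcoeff, norm_div]
      exact div_le_one_of_le₀ (hle j) (norm_nonneg a)
    exact Polynomial.exists_natDegree_eq_of_mem_lifts h
  have hred : p.map (IsLocalRing.residue 𝒪[F]) ≠ 0 := by
    intro h0
    have h1 : p.coeff i = 1 := by
      apply Subtype.ext
      have := congrArg (fun r => coeff r i) hp
      simp only [coeff_map, hcoeff] at this
      rw [← ha, div_self ha0] at this
      exact this
    have h2 := congrArg (fun r => coeff r i) h0
    simp only [coeff_map, h1, map_one, coeff_zero] at h2
    exact one_ne_zero h2
  have h1 := closureAbs_aeval_eq_one hd hζ hred (by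
    rw [hpdeg, natDegree_C_mul (inv_ne_zero ha0)]
    exact hdeg)
  rw [hp, map_mul, aeval_C, hA, map_mul, closureAbs_algebraMap, norm_inv] at h1
  refine ⟨a, ?_⟩
  exact (inv_mul_eq_one₀ (norm_ne_zero_iff.2 ha0)).1 h1 |>.symm

theorem root_of_unity_mem_maxUnramified {d : ℕ} (hd : 0 < d) {ζ : AlgebraicClosure F}
    (hζ : ζ ^ (residueCard F ^ d - 1) = 1) : ζ ∈ maxUnramified F :=
  le_sSup (a := IntermediateField.adjoin F {ζ}) (isFiniteUnramified_adjoin hd hζ)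
    (IntermediateField.mem_adjoin_simple_self F ζ)

variable (F) in
/-- The maximal unramified extension is generated by the roots of unity of order prime to the
residue characteristic. -/
theorem maxUnramified_eq_adjoin : maxUnramified F = IntermediateField.adjoin F
    {ζ : AlgebraicClosure F | ∃ d, 0 < d ∧ ζ ^ (residueCard F ^ d - 1) = 1} := by
  apply le_antisymm
  · refine sSup_le fun E hE => ?_
    rw [← InfiniteGalois.fixedField_fixingSubgroup (IntermediateField.adjoin F _)]
    intro x hx
    rw [IntermediateField.mem_fixedField_iff]
    intro σ hσ
    rw [IntermediateField.mem_fixingSubgroup_iff] at hσ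
    exact algEquiv_apply_eq_of_isFiniteUnramified hE
      (fun d hd ζ hζ => hσ ζ (IntermediateField.subset_adjoin _ _ ⟨d, hd, hζ⟩)) hx
  · rw [IntermediateField.adjoin_le_iff]
    rintro ζ ⟨d, hd, hζ⟩
    exact root_of_unity_mem_maxUnramified hd hζ

instance normal_maxUnramified : Normal F (maxUnramified F) := by
  rw [IntermediateField.normal_iff_forall_map_le']
  intro σ
  rw [maxUnramified_eq_adjoin, IntermediateField.adjoin_map]
  refine IntermediateField.adjoin.mono _ _ _ ?_
  rintro _ ⟨ζ, ⟨d, hd, hζ⟩, rfl⟩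
  exact ⟨d, hd, by rw [AlgEquiv.coe_toAlgHom, ← map_pow, hζ, map_one]⟩

/-- Each element of the maximal unramified extension lies in the field generated by the roots of
unity of order `q ^ d - 1` for some `d`. -/
theorem exists_forall_apply_eq {x : AlgebraicClosure F} (hx : x ∈ maxUnramified F) :
    ∃ d, 0 < d ∧ ∀ s : AlgebraicClosure F ≃ₐ[F] AlgebraicClosure F,
      (∀ ζ : AlgebraicClosure F, ζ ^ (residueCard F ^ d - 1) = 1 → s ζ = ζ) → s x = x := by
  rw [maxUnramified_eq_adjoin] at hx
  induction hx using IntermediateField.adjoin_induction with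
  | mem x hx =>
    obtain ⟨d, hd, h⟩ := hx
    exact ⟨d, hd, fun s hs => hs x h⟩
  | algebraMap x => exact ⟨1, one_pos, fun s _ => s.commutes x⟩
  | add x y _ _ hx hy =>
    obtain ⟨d, hd, h⟩ := hx
    obtain ⟨e, he, h'⟩ := hy
    refine ⟨d * e, Nat.mul_pos hd he, fun s hs => ?_⟩
    rw [map_add, h s fun ζ hζ => hs ζ (pow_residueCard_eq_one_of_dvd (dvd_mul_right d e) hζ),
      h' s fun ζ hζ => hs ζ (pow_residueCard_eq_one_of_dvd (dvd_mul_left e d) hζ)]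
  | inv x _ hx =>
    obtain ⟨d, hd, h⟩ := hx
    exact ⟨d, hd, fun s hs => by rw [map_inv₀, h s hs]⟩
  | mul x y _ _ hx hy =>
    obtain ⟨d, hd, h⟩ := hx
    obtain ⟨e, he, h'⟩ := hy
    refine ⟨d * e, Nat.mul_pos hd he, fun s hs => ?_⟩
    rw [map_mul, h s fun ζ hζ => hs ζ (pow_residueCard_eq_one_of_dvd (dvd_mul_right d e) hζ),
      h' s fun ζ hζ => hs ζ (pow_residueCard_eq_one_of_dvd (dvd_mul_left e d) hζ)]

/-- The conjugates of a root of unity of order prime to the residue characteristic include its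
`q`-th power. -/
theorem exists_algEquiv_apply_eq_pow {d : ℕ} (hd : 0 < d) {ζ : AlgebraicClosure F}
    (hζ : ζ ^ (residueCard F ^ d - 1) = 1) :
    ∃ s : AlgebraicClosure F ≃ₐ[F] AlgebraicClosure F, s ζ = ζ ^ residueCard F := by
  have hζint : closureAbs F ζ ≤ 1 :=
    (closureAbs_eq_one_of_pow (residueCard_pow_sub_one_ne_zero hd) hζ).le
  set z : closureIntegers F := ⟨ζ, hζint⟩ with hz
  obtain ⟨p, hp, hpζ⟩ := exists_monic_lift_minpoly hζint
  have h1 : aeval (closureRed F z) (p.map (IsLocalRing.residue 𝒪[F])) = 0 := by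
    rw [← closureRed_eval, closureRed_eq_zero, coe_eval₂_integersToClosure, hpζ]
    rw [show (z : AlgebraicClosure F) = ζ from rfl, minpoly.aeval, map_zero]
    exact one_pos
  have h2 : aeval (closureRed F (z ^ residueCard F)) (p.map (IsLocalRing.residue 𝒪[F])) = 0 := by
    rw [map_pow, ← residueFrobenius_apply, aeval_algHom_apply, h1, map_zero]
  rw [← closureRed_eval, closureRed_eq_zero, coe_eval₂_integersToClosure, hpζ,
    Splits.aeval_eq_prod_aroots_of_monic (IsAlgClosed.splits _)
      (minpoly.monic (Algebra.IsIntegral.isIntegral ζ))] at h2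
  -- the reduction of the minimal polynomial of `ζ` vanishes at the reduction of `ζ ^ q`, so that some
  -- conjugate of `ζ` is congruent to `ζ ^ q`
  obtain ⟨_, hmem, hlt⟩ := exists_closureAbs_lt_one_of_prod h2
  obtain ⟨ξ, hξ, rfl⟩ := Multiset.mem_map.1 hmem
  obtain ⟨s, hs⟩ := minpoly.exists_algEquiv_of_root' (Algebra.IsAlgebraic.isAlgebraic ζ)
    (mem_aroots.1 hξ).2
  refine ⟨s, ?_⟩
  refine (eq_of_closureAbs_sub_lt hd ?_ (by rw [← map_pow, hζ, map_one]) ?_).symm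
  · rw [← pow_mul, mul_comm, pow_mul, hζ, one_pow]
  · rw [hs]
    exact hlt

omit [CharZero F] in
/-- The residue field is the set of fixed points of the `q`-power map. -/
theorem exists_algebraMap_residue_eq {c : ClosureResidue F} (hc : c ^ residueCard F = c) :
    ∃ a, algebraMap 𝓀[F] (ClosureResidue F) a = c := by
  let := Fintype.ofFinite 𝓀[F]
  by_contra! hcon
  have h1 : (X ^ residueCard F - X : (ClosureResidue F)[X]) = 0 := by
    have hinj := algebraMap_residue_injective F
    refine eq_zero_of_natDegree_lt_card_of_eval_eq_zero _
      (f := fun o : Option 𝓀[F] => o.elim c (algebraMap 𝓀[F] (ClosureResidue F))) ?_ ?_ ?_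
    · rintro (_ | a) (_ | b) h
      · rfl
      · exact absurd h.symm (hcon b)
      · exact absurd h (hcon a)
      · exact congrArg some (hinj h)
    · rintro (_ | a)
      · simp [hc]
      · simp only [Option.elim_some, eval_sub, eval_pow, eval_X]
        rw [← map_pow, ← card_residueField, FiniteField.pow_card, sub_self]
    · rw [Fintype.card_option, card_residueField, Nat.lt_succ_iff]
      exact natDegree_sub_le_of_le (natDegree_X_pow_le _)
        (natDegree_X_le.trans (one_lt_residueCard F).le) |>.trans (max_self _).le
  exact (monic_X_pow_sub (degree_X_le.trans_lt
    (by exact_mod_cast one_lt_residueCard F))).ne_zero h1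

omit [CharZero F] in
/-- The conjugates of a root of unity of order prime to the residue characteristic are among the
`q ^ i`-th powers. -/
theorem algEquiv_apply_eq_pow {d : ℕ} (hd : 0 < d) {ζ : AlgebraicClosure F}
    (hζ : ζ ^ (residueCard F ^ d - 1) = 1)
    (s : AlgebraicClosure F ≃ₐ[F] AlgebraicClosure F) :
    ∃ i, s ζ = ζ ^ residueCard F ^ i := by
  have hM0 := residueCard_pow_sub_one_ne_zero (F := F) hd
  have hpow : ∀ k, (ζ ^ k) ^ (residueCard F ^ d - 1) = 1 := fun k => by
    rw [← pow_mul, mul_comm, pow_mul, hζ, one_pow]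
  have hsζ : (s ζ) ^ (residueCard F ^ d - 1) = 1 := by rw [← map_pow, hζ, map_one]
  set z : closureIntegers F := ⟨ζ, (closureAbs_eq_one_of_pow hM0 hζ).le⟩ with hz
  set z' : closureIntegers F := ⟨s ζ, (closureAbs_eq_one_of_pow hM0 hsζ).le⟩ with hz'
  set v := closureRed F z with hv
  have hvd : v ^ residueCard F ^ d = v := by
    have h1 : z ^ (residueCard F ^ d - 1) = 1 := Subtype.ext hζ
    have h2 : residueCard F ^ d = (residueCard F ^ d - 1) + 1 := by omega
    rw [h2, hv, ← map_pow, pow_succ, h1, one_mul]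
  -- the product over the orbit of `v` under the `q`-power map has coefficients in the residue field
  set G : (ClosureResidue F)[X] := ∏ i ∈ Finset.range d, (X - C (v ^ residueCard F ^ i)) with hG
  have hGfrob : G.map (residueFrobenius F : ClosureResidue F →+* ClosureResidue F) = G := by
    have h1 : G.map (residueFrobenius F : ClosureResidue F →+* ClosureResidue F) =
        ∏ i ∈ Finset.range d, (X - C (v ^ residueCard F ^ (i + 1))) := by
      rw [hG, Polynomial.map_prod]
      refine Finset.prod_congr rfl fun i _ => ?_
      rw [Polynomial.map_sub, map_X, map_C]
      congr 2
      refine (residueFrobenius_apply F _).trans ?_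
      rw [← pow_mul, ← pow_succ]
    have h2 := Finset.prod_range_succ (fun i => (X - C (v ^ residueCard F ^ i))) d
    have h3 := Finset.prod_range_succ' (fun i => (X - C (v ^ residueCard F ^ i))) d
    rw [h2, hvd, pow_zero, pow_one] at h3
    rw [h1]
    exact (mul_right_cancel₀ (X_sub_C_ne_zero v) h3).symm
  obtain ⟨g, hg⟩ : ∃ g : 𝓀[F][X], g.map (algebraMap 𝓀[F] (ClosureResidue F)) = G := by
    have : G ∈ Polynomial.lifts (algebraMap 𝓀[F] (ClosureResidue F)) := by
      rw [Polynomial.lifts_iff_coeff_lifts]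
      intro j
      refine exists_algebraMap_residue_eq ?_
      have h1 := congrArg (fun r => coeff r j) hGfrob
      rw [coeff_map] at h1
      exact (residueFrobenius_apply F _).symm.trans h1
    exact this
  obtain ⟨p, hp⟩ := Polynomial.map_surjective (IsLocalRing.residue 𝒪[F])
    IsLocalRing.residue_surjective g
  have heval : ∀ x : closureIntegers F, eval (closureRed F x) G =
      closureRed F (p.eval₂ (integersToClosure F) x) := by
    intro x
    rw [closureRed_eval, hp, ← hg, eval_map_algebraMap]
  -- `G` lifts to a polynomial over the integers of `F`, whose value at `ζ` is small; hence so is its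
  -- value at `s ζ`
  have h1 : eval v G = 0 := by
    rw [hG, eval_prod]
    refine Finset.prod_eq_zero (Finset.mem_range.2 hd) ?_
    rw [pow_zero, pow_one, eval_sub, eval_X, eval_C, sub_self]
  have h2 : eval (closureRed F z') G = 0 := by
    rw [hv, heval, closureRed_eq_zero, coe_eval₂_integersToClosure] at h1
    rw [heval, closureRed_eq_zero, coe_eval₂_integersToClosure]
    change closureAbs F (aeval (s ζ) _) < 1
    rw [aeval_algHom_apply, closureAbs_algEquiv]
    exact h1
  rw [hG, eval_prod, Finset.prod_eq_zero_iff] at h2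
  obtain ⟨i, -, hi⟩ := h2
  rw [eval_sub, eval_X, eval_C, sub_eq_zero, hv, ← map_pow, closureRed_eq] at hi
  exact ⟨i, eq_of_closureAbs_sub_lt hd hsζ (hpow _) hi⟩

end

end

/-! ### The Galois group of the maximal unramified extension -/

section

variable {F : Type*} [NontriviallyNormedField F] [IsUltrametricDist F] [ProperSpace F] [CharZero F]

variable (F) in
theorem exists_isPrimitiveRoot_maxUnramified {d : ℕ} (hd : 0 < d) :
    ∃ ζ : maxUnramified F, IsPrimitiveRoot ζ (residueCard F ^ d - 1) := by
  obtain ⟨ζ, hζ⟩ := exists_isPrimitiveRoot_closure (F := F) hd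
  refine ⟨⟨ζ, root_of_unity_mem_maxUnramified hd hζ.pow_eq_one⟩, ?_⟩
  exact IsPrimitiveRoot.of_map_of_injective
    (f := algebraMap (maxUnramified F) (AlgebraicClosure F)) hζ Subtype.val_injective

omit [IsUltrametricDist F] [ProperSpace F] [CharZero F] in
/-- A Galois element acts on roots of unity as on a primitive one. -/
theorem apply_eq_pow_of_isPrimitiveRoot {M k : ℕ} [NeZero M] {ω : maxUnramified F}
    (hω : IsPrimitiveRoot ω M) {s : GalU F} (hs : s ω = ω ^ k) {ζ : maxUnramified F}
    (hζ : ζ ^ M = 1) : s ζ = ζ ^ k := by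
  obtain ⟨i, -, rfl⟩ := hω.eq_pow_of_pow_eq_one hζ
  rw [map_pow, hs, ← pow_mul, ← pow_mul, mul_comm]

variable (F) in
/-- There is a Galois element acting as the `q`-th power on the roots of unity of order dividing
`q ^ d - 1`. -/
theorem exists_galU_apply_eq_pow {d : ℕ} (hd : 0 < d) :
    ∃ φ : GalU F, ∀ ζ : maxUnramified F, ζ ^ (residueCard F ^ d - 1) = 1 →
      φ ζ = ζ ^ residueCard F := by
  have : NeZero (residueCard F ^ d - 1) := ⟨residueCard_pow_sub_one_ne_zero hd⟩
  obtain ⟨ω, hω⟩ := exists_isPrimitiveRoot_maxUnramified F hd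
  have hω' : (ω : AlgebraicClosure F) ^ (residueCard F ^ d - 1) = 1 :=
    congrArg Subtype.val hω.pow_eq_one
  obtain ⟨s, hs⟩ := exists_algEquiv_apply_eq_pow hd hω'
  refine ⟨s.restrictNormal (maxUnramified F), fun ζ hζ =>
    apply_eq_pow_of_isPrimitiveRoot hω ?_ hζ⟩
  apply Subtype.ext
  have := AlgEquiv.restrictNormal_commutes s (maxUnramified F) ω
  exact this.trans hs

/-- Every Galois element acts on the roots of unity of order dividing `q ^ d - 1` as a power of
the Frobenius automorphism. -/
theorem exists_pow_inv_mul_apply_eq {d : ℕ} (hd : 0 < d) {φ : GalU F}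
    (hφ : ∀ ζ : maxUnramified F, ζ ^ (residueCard F ^ d - 1) = 1 → φ ζ = ζ ^ residueCard F)
    (s : GalU F) :
    ∃ i : ℕ, ∀ ζ : maxUnramified F, ζ ^ (residueCard F ^ d - 1) = 1 → ((φ ^ i)⁻¹ * s) ζ = ζ := by
  have : NeZero (residueCard F ^ d - 1) := ⟨residueCard_pow_sub_one_ne_zero hd⟩
  obtain ⟨ω, hω⟩ := exists_isPrimitiveRoot_maxUnramified F hd
  have hω' : (ω : AlgebraicClosure F) ^ (residueCard F ^ d - 1) = 1 :=
    congrArg Subtype.val hω.pow_eq_one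
  obtain ⟨i, hi⟩ := algEquiv_apply_eq_pow hd hω' (s.liftNormal (AlgebraicClosure F))
  have hs : s ω = ω ^ residueCard F ^ i :=
    Subtype.ext ((AlgEquiv.liftNormal_commutes s (AlgebraicClosure F) ω).symm.trans hi)
  have hφi : ∀ (i : ℕ) (ζ : maxUnramified F), ζ ^ (residueCard F ^ d - 1) = 1 →
      (φ ^ i) ζ = ζ ^ residueCard F ^ i := by
    intro i ζ hζ
    induction i with
    | zero => simp
    | succ i ih =>
      rw [pow_succ', AlgEquiv.mul_apply, ih, map_pow, hφ ζ hζ, ← pow_mul, ← pow_succ']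
  refine ⟨i, fun ζ hζ => ?_⟩
  have h1 : s ζ = (φ ^ i) ζ := by
    rw [hφi i ζ hζ, apply_eq_pow_of_isPrimitiveRoot hω hs hζ]
  rw [AlgEquiv.mul_apply, h1, ← AlgEquiv.mul_apply, inv_mul_cancel, AlgEquiv.one_apply]

/-- Finitely many elements of `F^u` lie in the field generated by the roots of unity of order
`q ^ d - 1`, for a suitable `d`. -/
theorem exists_forall_galU_apply_eq {κ : Type*} [Finite κ] (x : κ → maxUnramified F) :
    ∃ d, 0 < d ∧ ∀ s : GalU F,
      (∀ ζ : maxUnramified F, ζ ^ (residueCard F ^ d - 1) = 1 → s ζ = ζ) → ∀ k, s (x k) = x k := by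
  have := Fintype.ofFinite κ
  choose d hd h using fun k => exists_forall_apply_eq (x k).2
  refine ⟨∏ k, d k, Finset.prod_pos fun k _ => hd k, fun s hs k => ?_⟩
  have h1 := h k (s.liftNormal (AlgebraicClosure F)) fun ζ hζ => by
    have h2 := AlgEquiv.liftNormal_commutes s (AlgebraicClosure F)
      ⟨ζ, root_of_unity_mem_maxUnramified (hd k) hζ⟩
    refine h2.trans ?_
    rw [hs]
    · rfl
    · exact pow_residueCard_eq_one_of_dvd (Finset.dvd_prod_of_mem d (Finset.mem_univ k))
        (Subtype.ext hζ)
  exact Subtype.ext ((AlgEquiv.liftNormal_commutes s (AlgebraicClosure F) (x k)).symm.trans h1)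

omit [CharZero F] in
theorem IsFrobenius.apply_eq_pow {φ : GalU F} (hφ : IsFrobenius φ) {d : ℕ} (hd : 0 < d)
    {ζ : maxUnramified F} (hζ : ζ ^ (residueCard F ^ d - 1) = 1) : φ ζ = ζ ^ residueCard F := by
  have hζ' : (ζ : AlgebraicClosure F) ^ (residueCard F ^ d - 1) = 1 := congrArg Subtype.val hζ
  have h1 := hφ ζ (closureAbs_eq_one_of_pow (residueCard_pow_sub_one_ne_zero hd) hζ').le
  have h2 : (φ ζ) ^ (residueCard F ^ d - 1) = 1 := by rw [← map_pow, hζ, map_one]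
  apply Subtype.ext
  refine eq_of_closureAbs_sub_lt hd (congrArg Subtype.val h2) ?_ h1
  change ((ζ : AlgebraicClosure F) ^ residueCard F) ^ (residueCard F ^ d - 1) = 1
  rw [← pow_mul, mul_comm, pow_mul, hζ', one_pow]

end

/-! ### Characters of finite commutative groups -/

section

/-- The characters of a finite commutative group which are trivial on a given element `g` form a
proportion `1 / r` of all characters, where `r` is a multiple of the order of `g`. -/
theorem exists_card_mul_eq_card_monoidHom {G R : Type*} [CommGroup G] [Finite G] [CommRing R]
    [IsDomain R] [hM : HasEnoughRootsOfUnity R (Monoid.exponent G)] [Finite (G →* Rˣ)] (g : G) :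
    ∃ r : ℕ, 0 < r ∧ g ^ r = 1 ∧
      Nat.card {ψ : G →* Rˣ // ψ g = 1} * r = Nat.card (G →* Rˣ) := by
  set ev : (G →* Rˣ) →* Rˣ := MonoidHom.eval g with hev
  have : Finite ev.range := Finite.of_surjective _ ev.rangeRestrict_surjective
  refine ⟨Nat.card ev.range, Nat.card_pos, ?_, ?_⟩
  · by_contra hne
    obtain ⟨ψ, hψ⟩ := CommGroup.exists_apply_ne_one_of_hasEnoughRootsOfUnity G R hne
    refine hψ ?_
    have h1 : (⟨ev ψ, ψ, rfl⟩ : ev.range) ^ Nat.card ev.range = 1 := pow_card_eq_one'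
    rw [map_pow]
    exact congrArg Subtype.val h1
  · have h1 := Subgroup.card_eq_card_quotient_mul_card_subgroup ev.ker
    rw [Nat.card_congr (QuotientGroup.quotientKerEquivRange ev).toEquiv, mul_comm] at h1
    exact h1.symm

/-- A nonempty sum of characters does not vanish identically outside a small set. -/
theorem exists_sum_ne_zero {H W : Type*} [Group H] [Finite H] [Fintype W] [Nonempty W]
    (ψ : W → H →* ℂˣ) (B : Set H) (hB : Fintype.card W * B.ncard < Nat.card H) :
    ∃ h ∉ B, ∑ w, ((ψ w h : ℂˣ) : ℂ) ≠ 0 := by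
  classical
  have := Fintype.ofFinite H
  by_contra! hcon
  obtain ⟨w₀⟩ := ‹Nonempty W›
  set f : W → H →* ℂ := fun w => (Units.coeHom ℂ).comp (ψ w * (ψ w₀)⁻¹) with hf
  -- by orthogonality, the sum over `H` of `ψ_{w₀}⁻¹ ∑_w ψ_w` is at least `|H|`; but each value on `B`
  -- is at most `|W|` in absolute value, and the values outside `B` would vanish
  have h1 : ∑ h, ∑ w, f w h = ∑ w, (if f w = 1 then (Fintype.card H : ℂ) else 0) := by
    rw [Finset.sum_comm]
    exact Finset.sum_congr rfl fun w _ => by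
      rw [sum_hom_units]
      split_ifs <;> simp
  have h2 : ∑ w, (if f w = 1 then (Fintype.card H : ℂ) else 0) =
      (((Finset.univ.filter fun w => f w = 1).card * Fintype.card H : ℕ) : ℂ) := by
    rw [← Finset.sum_filter, Finset.sum_const, nsmul_eq_mul]
    push_cast
    rfl
  have hfw : f w₀ = 1 := by
    ext h
    simp [hf]
  have h3 : 1 ≤ (Finset.univ.filter fun w => f w = 1).card :=
    Finset.card_pos.2 ⟨w₀, Finset.mem_filter.2 ⟨Finset.mem_univ _, hfw⟩⟩
  have h4 : (Fintype.card H : ℝ) ≤ ‖∑ h, ∑ w, f w h‖ := by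
    rw [h1, h2, Complex.norm_natCast]
    exact_mod_cast Nat.le_mul_of_pos_left _ h3
  have hnorm : ∀ w h, ‖f w h‖ = 1 := by
    intro w h
    have : f w h ^ Nat.card H = 1 := by rw [← map_pow, pow_card_eq_one', map_one]
    exact (pow_eq_one_iff_of_nonneg (norm_nonneg _) Nat.card_pos.ne').1
      (by rw [← norm_pow, this, norm_one])
  have h5 : ∑ h, ∑ w, f w h = ∑ h ∈ B.toFinset, ∑ w, f w h := by
    refine (Finset.sum_subset (Finset.subset_univ _) fun h _ hh => ?_).symm
    rw [Set.mem_toFinset] at hh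
    have h6 : ∑ w, f w h = (∑ w, ((ψ w h : ℂˣ) : ℂ)) * (((ψ w₀)⁻¹ h : ℂˣ) : ℂ) := by
      rw [Finset.sum_mul]
      rfl
    rw [h6, hcon h hh, zero_mul]
  have h6 : ‖∑ h ∈ B.toFinset, ∑ w, f w h‖ ≤ (Fintype.card W * B.ncard : ℕ) := by
    refine (norm_sum_le_of_le _ (f := fun h => ∑ w, f w h) (n := fun _ => (Fintype.card W : ℝ))
      fun h _ => ?_).trans ?_
    · refine (norm_sum_le_of_le _ fun w _ => (hnorm w h).le).trans ?_
      simp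
    · rw [Finset.sum_const, nsmul_eq_mul, Set.ncard_eq_toFinset_card', mul_comm]
      push_cast
      exact le_rfl
  rw [← h5] at h6
  have h7 := h4.trans h6
  rw [Nat.card_eq_fintype_card] at hB
  exact absurd (by exact_mod_cast h7) (not_le.2 hB)

end

/-! ### The character group of the finite torus -/

section

variable {X : Type*} [AddCommGroup X]

/-- The quotient `X / (g - q) X` of a lattice. If `X` is the character lattice of a torus over a
finite field with `q` elements, on which the Frobenius acts by `g`, this is the group of characters
of the finite group of rational points of the torus. -/
abbrev FrobCoinvariants (g : X ≃ₗ[ℤ] X) (q : ℕ) : Type _ :=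
  X ⧸ LinearMap.range ((g : Module.End ℤ X) - (q : ℤ) • LinearMap.id)

namespace FrobCoinvariants

variable (g : X ≃ₗ[ℤ] X) (q : ℕ)

/-- The class of a lattice element in the coinvariants. -/
def mk : X →+ FrobCoinvariants g q :=
  (LinearMap.range ((g : Module.End ℤ X) - (q : ℤ) • LinearMap.id)).mkQ.toAddMonoidHom

variable {g q}

theorem mk_surjective : Function.Surjective (mk g q) := Submodule.mkQ_surjective _

theorem mk_eq_zero_iff {x : X} : mk g q x = 0 ↔ ∃ y, g y - (q : ℤ) • y = x :=
  (Submodule.Quotient.mk_eq_zero _).trans Iff.rfl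

theorem mk_apply (x : X) : mk g q (g x) = q • mk g q x := by
  rw [← sub_eq_zero, ← map_nsmul, ← map_sub, mk_eq_zero_iff]
  exact ⟨x, by rw [natCast_zsmul]⟩

theorem mk_pow_apply (i : ℕ) (x : X) : mk g q ((g ^ i) x) = q ^ i • mk g q x := by
  induction i with
  | zero => simp
  | succ i ih => rw [pow_succ', LinearEquiv.mul_apply, mk_apply, ih, smul_smul, pow_succ']

/-- If `g ^ d = 1`, the coinvariants are killed by `q ^ d - 1`, since `g` acts on them as `q`. -/
theorem nsmul_eq_zero {d : ℕ} (hq : 0 < q) (hg : g ^ d = 1) (a : FrobCoinvariants g q) :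
    (q ^ d - 1) • a = 0 := by
  obtain ⟨x, rfl⟩ := mk_surjective a
  have h := mk_pow_apply (g := g) (q := q) d x
  rw [hg, show (1 : X ≃ₗ[ℤ] X) x = x from rfl] at h
  have h1 : q ^ d = (q ^ d - 1) + 1 := (Nat.sub_add_cancel (Nat.pow_pos hq)).symm
  rw [h1, add_smul, one_smul] at h
  exact right_eq_add.1 h

theorem finite [Module.Finite ℤ X] {d : ℕ} (hM : q ^ d - 1 ≠ 0) (hq : 0 < q) (hg : g ^ d = 1) :
    Finite (FrobCoinvariants g q) := by
  refine Module.finite_of_fg_torsion _ fun a => ?_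
  refine ⟨⟨((q ^ d - 1 : ℕ) : ℤ), mem_nonZeroDivisors_of_ne_zero (by exact_mod_cast hM)⟩, ?_⟩
  change ((q ^ d - 1 : ℕ) : ℤ) • a = 0
  rw [natCast_zsmul, nsmul_eq_zero hq hg]

/-- The characters of the coinvariants, restricted to the lattice. -/
noncomputable def restrict (K : Type*) [Field K] :
    (Multiplicative (FrobCoinvariants g q) →* Kˣ) →* (Multiplicative X →* Kˣ) :=
  MonoidHom.compHom' (AddMonoidHom.toMultiplicative (mk g q))

theorem restrict_apply {K : Type*} [Field K]
    (ψ : Multiplicative (FrobCoinvariants g q) →* Kˣ) (x : X) :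
    restrict K ψ (Multiplicative.ofAdd x) = ψ (Multiplicative.ofAdd (mk g q x)) := rfl

theorem restrict_pow_eq_one {K : Type*} [Field K] {d : ℕ} (hq : 0 < q) (hg : g ^ d = 1)
    (ψ : Multiplicative (FrobCoinvariants g q) →* Kˣ) (x : Multiplicative X) :
    restrict K ψ x ^ (q ^ d - 1) = 1 := by
  rw [← Multiplicative.ofAdd.apply_symm_apply x, restrict_apply, ← map_pow, ← ofAdd_nsmul,
    nsmul_eq_zero hq hg, ofAdd_zero, map_one]

theorem restrict_apply_apply {K : Type*} [Field K]
    (ψ : Multiplicative (FrobCoinvariants g q) →* Kˣ) (x : X) :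
    restrict K ψ (Multiplicative.ofAdd (g x)) = restrict K ψ (Multiplicative.ofAdd x) ^ q := by
  rw [restrict_apply, restrict_apply, mk_apply, ofAdd_nsmul, map_pow]

section Card

variable {K : Type*} [Field K] [Module.Finite ℤ X] {d : ℕ} {ζ : K}

omit [Module.Finite ℤ X] in
theorem hasEnoughRootsOfUnity (hM : q ^ d - 1 ≠ 0) (hq : 0 < q) (hg : g ^ d = 1)
    (hζ : IsPrimitiveRoot ζ (q ^ d - 1)) :
    HasEnoughRootsOfUnity K (Monoid.exponent (Multiplicative (FrobCoinvariants g q))) := by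
  have : NeZero (q ^ d - 1) := ⟨hM⟩
  have : HasEnoughRootsOfUnity K (q ^ d - 1) := ⟨⟨ζ, hζ⟩, inferInstance⟩
  refine HasEnoughRootsOfUnity.of_dvd K (m := _) (n := q ^ d - 1) ?_
  exact Monoid.exponent_dvd_of_forall_pow_eq_one fun a => nsmul_eq_zero (d := d) hq hg a.toAdd

theorem finite_characters (hM : q ^ d - 1 ≠ 0) (hq : 0 < q) (hg : g ^ d = 1)
    (hζ : IsPrimitiveRoot ζ (q ^ d - 1)) :
    Finite (Multiplicative (FrobCoinvariants g q) →* Kˣ) := by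
  have := finite (g := g) hM hq hg
  have := hasEnoughRootsOfUnity hM hq hg hζ
  obtain ⟨e⟩ := CommGroup.monoidHom_mulEquiv_of_hasEnoughRootsOfUnity
    (Multiplicative (FrobCoinvariants g q)) K
  exact Finite.of_equiv _ e.symm.toEquiv

/-- The characters which are trivial on the class of `x` form a proportion `1 / r` of all
characters, where `r • x` lies in `(g - q) X`. -/
theorem exists_card_mul_eq (hM : q ^ d - 1 ≠ 0) (hq : 0 < q) (hg : g ^ d = 1)
    (hζ : IsPrimitiveRoot ζ (q ^ d - 1)) (x : X) :
    ∃ r : ℕ, 0 < r ∧ (∃ y, g y - (q : ℤ) • y = r • x) ∧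
      {ψ : Multiplicative (FrobCoinvariants g q) →* Kˣ |
        restrict K ψ (Multiplicative.ofAdd x) = 1}.ncard * r =
      Nat.card (Multiplicative (FrobCoinvariants g q) →* Kˣ) := by
  have := finite (g := g) hM hq hg
  have := hasEnoughRootsOfUnity hM hq hg hζ
  have := finite_characters hM hq hg hζ
  obtain ⟨r, hr, h1, h2⟩ := exists_card_mul_eq_card_monoidHom (R := K)
    (Multiplicative.ofAdd (mk g q x))
  refine ⟨r, hr, mk_eq_zero_iff.1 ?_, h2⟩
  rw [map_nsmul]
  exact h1

end Card

end FrobCoinvariants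

end

/-! ### Nonvanishing of the Weyl sum -/

section

open Matrix

section

namespace SplitReductive

variable {ι X Y : Type*} [AddCommGroup X] [AddCommGroup Y] {P : RootDatum ι X Y}
  {K L : Type*} [Field K] [Field L] [Algebra K L] [CharZero L] {n : ℕ} {S : SplitReductive P K n}

/-- The permutation of the roots induced by an element of the Weyl group. -/
noncomputable def rootPerm [Finite ι] (w : S.weylSet L) (i : ι) : ι :=
  (exists_root_eq_of_mem_weylSet w.2 i).choose

theorem root_rootPerm [Finite ι] (w : S.weylSet L) (i : ι) :
    P.root (rootPerm w i) = (w : X ≃ₗ[ℤ] X) (P.root i) :=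
  (exists_root_eq_of_mem_weylSet w.2 i).choose_spec

variable (S L) in
theorem rootPerm_injective [Finite ι] [Module.Finite ℤ X] :
    Function.Injective (rootPerm : S.weylSet L → ι → ι) := fun w w' h =>
  Subtype.ext (eq_of_mem_weylSet w.2 w'.2 fun i => by
    rw [← root_rootPerm w, ← root_rootPerm w', h])

variable (S L) in
theorem finite_weylSet [Finite ι] [Module.Finite ℤ X] : Finite (S.weylSet L) :=
  Finite.of_injective _ (rootPerm_injective L S)

variable (S L) in
theorem card_weylSet_le [Finite ι] [Module.Finite ℤ X] :
    Nat.card (S.weylSet L) ≤ Nat.card ι ^ Nat.card ι := by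
  rw [← Nat.card_fun]
  exact Nat.card_le_card_of_injective _ (rootPerm_injective L S)

end SplitReductive

namespace UnramifiedPair

open SplitReductive FrobCoinvariants

variable {ι X Y : Type*} [AddCommGroup X] [AddCommGroup Y] {P : RootDatum ι X Y}
  {F : Type*} [NontriviallyNormedField F] [CharZero F] {n : ℕ} (D : UnramifiedPair P F n)

section Weyl

/-- The Weyl group of the torus over `F` embeds into the set of automorphisms of the character
lattice induced by the elements of the group. -/
theorem exists_weyl_injective [Finite ι] [Module.Finite ℤ X] [P.IsReduced] :
    ∃ f : D.Weyl → D.weylSet (AlgebraicClosure F), Function.Injective f := by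
  have h := fun m : D.ratNormalizer =>
    D.exists_mem_weylSet (AlgebraicClosure F) m.2.2.1 m.2.1
  choose w hw htype using h
  refine ⟨fun c => ⟨w (Quotient.out c), hw _⟩, fun c c' hcc => ?_⟩
  have h1 : w (Quotient.out c) = w (Quotient.out c') := congrArg Subtype.val hcc
  have h2 := (htype (Quotient.out c)).inv.mul (htype (Quotient.out c'))
  rw [h1, inv_mul_cancel] at h2
  rw [← Quotient.out_eq' c, ← Quotient.out_eq' c']
  refine QuotientGroup.eq.2 ?_
  rw [Subgroup.mem_subgroupOf]
  refine ⟨D.mem_torus_of_hasType_one (AlgebraicClosure F) ?_ ?_, ?_⟩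
  · exact Subgroup.mul_mem _ (Subgroup.inv_mem _ (Quotient.out c).2.2.1)
      (Quotient.out c').2.2.1
  · rw [Subgroup.coe_mul, Subgroup.coe_inv, map_mul, map_inv]
    exact h2
  · exact Subgroup.mul_mem _ (Subgroup.inv_mem _ (Quotient.out c).2.2.2)
      (Quotient.out c').2.2.2

/-- Conjugation by the inverse of an element of the normalizer, on the rational points of the
torus. -/
noncomputable def conjHom (m : D.ratNormalizer) : D.ratTorus →* D.ratTorus where
  toFun t := ⟨_, D.conj_mem_ratTorus m t⟩
  map_one' := Subtype.ext (by simp)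
  map_mul' t u := Subtype.ext (by simp [mul_assoc])

theorem weylSum_eq [Fintype D.Weyl] (χ : D.ratTorus →* ℂˣ) (t : D.ratTorus) :
    D.weylSum χ t = ∑ w : D.Weyl, (((χ.comp (D.conjHom (Quotient.out w))) t : ℂˣ) : ℂ) := by
  rw [weylSum, finsum_eq_sum_of_fintype]
  refine Finset.sum_congr rfl fun w _ => ?_
  conv_lhs => rw [← Quotient.out_eq' w]
  rfl

end Weyl

variable [IsUltrametricDist F] [ProperSpace F] {φ : GalU F} {d : ℕ}

/-- If the weight basis is defined over the field of roots of unity of order `q ^ d - 1`, then the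
`d`-th power of the Frobenius acts trivially on the character lattice. -/
theorem gal_pow_eq_one
    (hφ : ∀ ζ : maxUnramified F, ζ ^ (residueCard F ^ d - 1) = 1 → φ ζ = ζ ^ residueCard F)
    (hfix : ∀ s : GalU F, (∀ ζ : maxUnramified F, ζ ^ (residueCard F ^ d - 1) = 1 → s ζ = ζ) →
      ∀ a b, s (D.basis.val a b) = D.basis.val a b) : D.gal φ ^ d = 1 := by
  rw [← map_pow]
  refine D.gal_eq_one (hfix _ fun ζ hζ => ?_)
  have h1 : ∀ i : ℕ, (φ ^ i) ζ = ζ ^ residueCard F ^ i := by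
    intro i
    induction i with
    | zero => simp
    | succ i ih =>
      rw [pow_succ', AlgEquiv.mul_apply, ih, map_pow, hφ ζ hζ, ← pow_mul, ← pow_succ']
  have h2 : residueCard F ^ d = (residueCard F ^ d - 1) + 1 :=
    (Nat.sub_add_cancel (Nat.pow_pos (one_lt_residueCard F).le)).symm
  rw [h1, h2, pow_succ, hζ, one_mul]

/-- The points of the finite torus, lifted to rational points of finite order: a character of the
coinvariants with values in the roots of unity is a rational point of the torus. -/
theorem restrict_mem_ratTorus (hd : 0 < d)
    (hφ : ∀ ζ : maxUnramified F, ζ ^ (residueCard F ^ d - 1) = 1 → φ ζ = ζ ^ residueCard F)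
    (hfix : ∀ s : GalU F, (∀ ζ : maxUnramified F, ζ ^ (residueCard F ^ d - 1) = 1 → s ζ = ζ) →
      ∀ a b, s (D.basis.val a b) = D.basis.val a b)
    (ψ : Multiplicative (FrobCoinvariants (D.gal φ) (residueCard F)) →* (maxUnramified F)ˣ) :
    D.torusHom (maxUnramified F) (restrict (maxUnramified F) ψ) ∈ D.ratTorus := by
  have hroot : ∀ x, ((restrict (maxUnramified F) ψ x : (maxUnramified F)ˣ) : maxUnramified F) ^
      (residueCard F ^ d - 1) = 1 := fun x => by
    rw [← Units.val_pow_eq_pow_val, restrict_pow_eq_one (one_lt_residueCard F).le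
      (D.gal_pow_eq_one hφ hfix), Units.val_one]
  refine D.torusHom_mem_ratTorus (φ := φ) (fun x => ?_) fun s => ?_
  · rw [restrict_apply_apply]
    exact Units.ext (by rw [Units.val_pow_eq_pow_val]; exact (hφ _ (hroot _)).symm)
  · obtain ⟨i, hi⟩ := exists_pow_inv_mul_apply_eq hd hφ s
    exact ⟨i, hfix _ hi, fun x => Units.ext (hi _ (hroot x))⟩

/-- The Weyl sum of any character of the torus is nonzero at some strongly regular element of finite
order, as soon as the finite torus has few elements which are not in general position. -/
theorem exists_weylSum_ne_zero [Finite ι] [Module.Finite ℤ X] [P.IsReduced] (hd : 0 < d)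
    (hφ : ∀ ζ : maxUnramified F, ζ ^ (residueCard F ^ d - 1) = 1 → φ ζ = ζ ^ residueCard F)
    (hfix : ∀ s : GalU F, (∀ ζ : maxUnramified F, ζ ^ (residueCard F ^ d - 1) = 1 → s ζ = ζ) →
      ∀ a b, s (D.basis.val a b) = D.basis.val a b) (χ : D.ratTorus →* ℂˣ)
    (B : Set (Multiplicative (FrobCoinvariants (D.gal φ) (residueCard F)) →* (maxUnramified F)ˣ))
    (hB : ∀ ψ ∉ B, (∀ i, restrict _ ψ (Multiplicative.ofAdd (P.root i)) ≠ 1) ∧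
      ∀ w ∈ D.weylSet (AlgebraicClosure F), w ≠ 1 → ∃ x,
        restrict _ ψ (Multiplicative.ofAdd (w x)) ≠ restrict _ ψ (Multiplicative.ofAdd x))
    (hcard : Nat.card (D.weylSet (AlgebraicClosure F)) * B.ncard <
      Nat.card (Multiplicative (FrobCoinvariants (D.gal φ) (residueCard F)) →*
        (maxUnramified F)ˣ)) :
    ∃ t ∈ D.centralRegularSet, D.weylSum χ t ≠ 0 := by
  have hq := (one_lt_residueCard F).le
  have hM := residueCard_pow_sub_one_ne_zero (F := F) hd
  have hg := D.gal_pow_eq_one hφ hfix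
  obtain ⟨ζ, hζ⟩ := exists_isPrimitiveRoot_maxUnramified F hd
  have := finite_characters hM hq hg hζ
  have := finite_weylSet (AlgebraicClosure F) D.toSplitReductive
  obtain ⟨f, hf⟩ := D.exists_weyl_injective
  have : Finite D.Weyl := Finite.of_injective f hf
  have := Fintype.ofFinite D.Weyl
  set τ := ((D.torusHom (maxUnramified F)).comp (restrict (maxUnramified F))).codRestrict
    D.ratTorus (D.restrict_mem_ratTorus hd hφ hfix) with hτ
  obtain ⟨ψ, hψ, hsum⟩ := exists_sum_ne_zero
    (fun w : D.Weyl => (χ.comp (D.conjHom (Quotient.out w))).comp τ) B (by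
      refine lt_of_le_of_lt (Nat.mul_le_mul_right _ ?_) hcard
      rw [← Nat.card_eq_fintype_card]
      exact Nat.card_le_card_of_injective f hf)
  -- the central factor can be taken to be trivial
  refine ⟨τ ψ, ⟨1, Subgroup.one_mem _, fun g _ => Commute.one_left g, τ ψ, ⟨?_, ?_⟩,
    (one_mul _).symm⟩, ?_⟩
  · intro g hgp hcomm
    exact mem_torus_of_commute (hB ψ hψ).1 (hB ψ hψ).2 hgp hcomm
  · have h1 : τ ψ ^ (residueCard F ^ d - 1) = 1 := by
      rw [← map_pow, show ψ ^ (residueCard F ^ d - 1) = 1 from ?_, map_one]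
      refine MonoidHom.ext fun a => ?_
      obtain ⟨x, hx⟩ := mk_surjective a.toAdd
      have h2 := restrict_pow_eq_one hq hg ψ (Multiplicative.ofAdd x)
      rw [restrict_apply, hx] at h2
      exact h2
    refine ⟨isOfFinOrder_iff_pow_eq_one.2 ⟨_, Nat.pos_of_ne_zero hM, h1⟩, ?_⟩
    refine Nat.Coprime.coprime_dvd_left (orderOf_dvd_of_pow_eq_one h1) ?_
    refine Nat.Coprime.coprime_dvd_right (dvd_pow_self _ hd.ne') ?_
    have h2 : residueCard F ^ d = (residueCard F ^ d - 1) + 1 :=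
      (Nat.sub_add_cancel (Nat.pow_pos hq)).symm
    conv => congr; rfl; rw [h2]
    simp
  · rw [weylSum_eq]
    exact hsum

end UnramifiedPair

end

end

/-! ### Few elements of the finite torus are trivial on a difference of roots -/

section

open FrobCoinvariants

variable {ι X Y : Type*} [AddCommGroup X] [AddCommGroup Y] {P : RootDatum ι X Y}

/-- If a multiple `r • v` of a nonzero difference of roots lies in `(g - q) X`, where `g` permutes
the roots and has finite order, then `r` is at least a constant times `q - 1`. -/
theorem sub_one_le_mul_of_eq [Finite ι] [Module.Finite ℤ X] {g : X ≃ₗ[ℤ] X} {q d r C : ℕ} (hd : 0 < d) (hq : 1 < q) (hr : 0 < r)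
    (hg : g ^ d = 1) (hroot : ∀ i, ∃ j, P.root j = g (P.root i))
    (hC : ∀ i j k, (P.toLinearMap (P.root i - P.root j) (P.coroot k)).natAbs ≤ C)
    {i j : ι} (hij : P.root i ≠ P.root j) {y : X}
    (hy : g y - (q : ℤ) • y = r • (P.root i - P.root j)) : q - 1 ≤ r * C := by
  by_contra! hlt
  set v := P.root i - P.root j with hv
  have hroot' : ∀ (m : ℕ) i, ∃ j, P.root j = (g ^ m) (P.root i) := by
    intro m
    induction m with
    | zero => exact fun i => ⟨i, rfl⟩
    | succ m ih =>
      intro i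
      obtain ⟨j, hj⟩ := ih i
      obtain ⟨k, hk⟩ := hroot j
      exact ⟨k, by rw [hk, hj, pow_succ', LinearEquiv.mul_apply]⟩
  -- the sum of the geometric series `(g ^ d - q ^ d) / (g - q)`
  set N : Module.End ℤ X :=
    ∑ m ∈ Finset.range d, (g : Module.End ℤ X) ^ m * ((q : ℤ) • 1) ^ (d - 1 - m) with hN
  have hcomm : Commute (g : Module.End ℤ X) ((q : ℤ) • 1) := (Commute.one_right _).smul_right _
  have hpow : ∀ (m : ℕ) x, ((g : Module.End ℤ X) ^ m) x = (g ^ m) x := by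
    intro m x
    induction m with
    | zero => rfl
    | succ m ih => rw [pow_succ', pow_succ', Module.End.mul_apply, ih]; rfl
  have hgd : (g : Module.End ℤ X) ^ d = 1 := LinearMap.ext fun x => by rw [hpow, hg]; rfl
  have hN1 : ∀ x, N (g x - (q : ℤ) • x) = x - ((q : ℤ) ^ d) • x := by
    intro x
    have h := LinearMap.congr_fun (hcomm.geom_sum₂_mul d) x
    rw [hgd, smul_pow, one_pow] at h
    exact h
  have hN2 : ∀ x, g (N x) - (q : ℤ) • N x = x - ((q : ℤ) ^ d) • x := by
    intro x
    have h := LinearMap.congr_fun (hcomm.mul_geom_sum₂ d) x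
    rw [hgd, smul_pow, one_pow] at h
    exact h
  have hNv : N v = ∑ m ∈ Finset.range d, ((q : ℤ) ^ (d - 1 - m)) • (g ^ m) v := by
    rw [hN, LinearMap.sum_apply]
    refine Finset.sum_congr rfl fun m _ => ?_
    rw [smul_pow, one_pow, mul_smul_comm, mul_one, LinearMap.smul_apply, hpow]
  have hgv : ∀ m : ℕ, ∃ a b, (g ^ m) v = P.root a - P.root b := by
    intro m
    obtain ⟨a, ha⟩ := hroot' m i
    obtain ⟨b, hb⟩ := hroot' m j
    exact ⟨a, b, by rw [ha, hb, hv, map_sub]⟩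
  have hq1 : (1 : ℤ) < q := by exact_mod_cast hq
  have hqd : (1 : ℤ) < (q : ℤ) ^ d := one_lt_pow₀ hq1 hd.ne'
  have hgeom : (∑ m ∈ Finset.range d, (q : ℤ) ^ (d - 1 - m)) * (q - 1) = (q : ℤ) ^ d - 1 := by
    rw [Finset.sum_range_reflect (fun m => (q : ℤ) ^ m) d, geom_sum_mul]
  have hlt' : (r : ℤ) * C < q - 1 := by
    have : r * C + 1 < q := by omega
    have : (r : ℤ) * C + 1 < q := by exact_mod_cast this
    linarith
  have hNv0 : N v = 0 := by
    refine P.eq_zero_of_forall_coroot _ (fun k => ?_) fun f hf => ?_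
    -- `r ⟨N v, k^∨⟩ = (1 - q ^ d) ⟨y, k^∨⟩` is a multiple of `q ^ d - 1` which is too small to be nonzero
    · have h1 : |P.toLinearMap (N v) (P.coroot k)| * (q - 1) ≤ C * ((q : ℤ) ^ d - 1) := by
        rw [hNv, map_sum, LinearMap.sum_apply, ← hgeom, ← mul_assoc]
        refine mul_le_mul_of_nonneg_right ?_ (by linarith)
        refine (Finset.abs_sum_le_sum_abs _ _).trans ?_
        rw [Finset.mul_sum]
        refine Finset.sum_le_sum fun m _ => ?_
        rw [map_smul, LinearMap.smul_apply, smul_eq_mul, abs_mul, mul_comm,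
          abs_of_nonneg (by positivity : (0 : ℤ) ≤ (q : ℤ) ^ (d - 1 - m))]
        refine mul_le_mul_of_nonneg_right ?_ (by positivity)
        obtain ⟨a, b, hab⟩ := hgv m
        rw [hab, Int.abs_eq_natAbs]
        exact_mod_cast hC a b k
      have h2 : (r : ℤ) * P.toLinearMap (N v) (P.coroot k) =
          (1 - (q : ℤ) ^ d) * P.toLinearMap y (P.coroot k) := by
        have h := hN1 y
        rw [hy, map_nsmul] at h
        have h' := congrArg (fun x => P.toLinearMap x (P.coroot k)) h
        simp only [map_nsmul, map_sub, map_smul, LinearMap.smul_apply, LinearMap.sub_apply,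
          smul_eq_mul, nsmul_eq_mul] at h'
        rw [h']
        ring
      set u := P.toLinearMap y (P.coroot k)
      set z := P.toLinearMap (N v) (P.coroot k)
      have h3 : ((q : ℤ) ^ d - 1) * |u| = r * |z| := by
        have := congrArg abs h2
        rw [abs_mul, abs_mul, abs_of_nonneg (by positivity : (0 : ℤ) ≤ (r : ℤ)),
          abs_of_neg (by linarith : 1 - (q : ℤ) ^ d < 0)] at this
        linarith
      have h4 : |u| < 1 := by
        by_contra! hu
        nlinarith [mul_le_mul_of_nonneg_left h1 (by positivity : (0 : ℤ) ≤ (r : ℤ)),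
          mul_lt_mul_of_pos_right hlt' (by linarith : (0 : ℤ) < (q : ℤ) ^ d - 1),
          mul_le_mul_of_nonneg_left hu (by nlinarith : (0 : ℤ) ≤ ((q : ℤ) ^ d - 1) * (q - 1))]
      rw [Int.abs_lt_one_iff.1 h4, abs_zero, mul_zero, eq_comm, mul_eq_zero, abs_eq_zero] at h3
      exact h3.resolve_left (by exact_mod_cast hr.ne')
    · rw [hNv, map_sum]
      refine Finset.sum_eq_zero fun m _ => ?_
      obtain ⟨a, b, hab⟩ := hgv m
      rw [map_smul, hab, map_sub, hf, hf, sub_zero, smul_zero]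
  have := P.isTorsionFree_left
  have h := hN2 v
  rw [hNv0, map_zero, smul_zero, sub_zero] at h
  have h5 : (1 - (q : ℤ) ^ d) • v = 0 := by rw [sub_smul, one_smul, ← h]
  rcases smul_eq_zero.1 h5 with h6 | h6
  · linarith
  · exact hij (sub_eq_zero.1 h6)

end

/-! ### Local fields with a large residue field -/

section

open FrobCoinvariants

namespace UnramifiedPair

variable {ι X Y : Type*} [Finite ι] [AddCommGroup X] [AddCommGroup Y] [Module.Finite ℤ X]
  {P : RootDatum ι X Y} [P.IsReduced]

omit [P.IsReduced] in
/-- A character of the lattice which separates the roots is regular and is fixed by no nontrivial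
element of the Weyl group. -/
theorem inGeneralPosition_of_separates_roots {K L : Type*} [Field K] [Field L] [CharZero L]
    [Algebra K L] {n : ℕ} {S : SplitReductive P K n} {t : Multiplicative X →* Kˣ}
    (ht : ∀ i j, P.root i ≠ P.root j → t (Multiplicative.ofAdd (P.root i - P.root j)) ≠ 1) :
    (∀ i, t (Multiplicative.ofAdd (P.root i)) ≠ 1) ∧
      ∀ w ∈ S.weylSet L, w ≠ 1 → ∃ x,
        t (Multiplicative.ofAdd (w x)) ≠ t (Multiplicative.ofAdd x) := by
  have := P.isTorsionFree_left
  refine ⟨fun i hi => ?_, fun w hw hw1 => ?_⟩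
  · have hneg : P.root (P.reflectionPerm i i) = -P.root i := by simp
    refine ht i (P.reflectionPerm i i) (fun h => P.ne_zero i ?_) ?_
    · rw [hneg] at h
      exact self_eq_neg.1 h
    · rw [hneg, sub_neg_eq_add, ofAdd_add, map_mul, hi, one_mul]
  · by_contra! hcon
    refine hw1 (SplitReductive.eq_one_of_mem_weylSet hw fun i => ?_)
    by_contra hne
    obtain ⟨j, hj⟩ := SplitReductive.exists_root_eq_of_mem_weylSet hw i
    rw [← hj] at hne
    refine ht j i hne ?_
    rw [ofAdd_sub, map_div, hj, hcon, div_self']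

variable (P) in
/-- For a given root datum and a large residue field, the Weyl sum of a character does not
vanish on all strongly regular elements of finite order. -/
theorem exists_forall_exists_weylSum_ne_zero : ∃ q₀ : ℕ, ∀ (F : Type*) [NontriviallyNormedField F]
    [IsUltrametricDist F] [ProperSpace F] [CharZero F], q₀ < residueCard F →
      ∀ (n : ℕ) (D : UnramifiedPair P F n) (χ : D.ratTorus →* ℂˣ),
        ∃ t ∈ D.centralRegularSet, D.weylSum χ t ≠ 0 := by
  have := Fintype.ofFinite ι
  classical
  obtain ⟨C, hC⟩ := Finite.exists_le fun p : ι × ι × ι =>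
    (P.toLinearMap (P.root p.1 - P.root p.2.1) (P.coroot p.2.2)).natAbs
  -- the Weyl group has at most `|ι| ^ |ι|` elements, and each of the `|ι| ^ 2` kernels to be avoided
  -- is at most a proportion `C / (q - 1)` of the finite torus
  refine ⟨Nat.card ι ^ Nat.card ι * (Nat.card (ι × ι) * C) + 1, fun F _ _ _ _ hF n D χ => ?_⟩
  obtain ⟨d, hd, hfix⟩ := exists_forall_galU_apply_eq fun p : Fin n × Fin n =>
    D.basis.val p.1 p.2
  obtain ⟨φ, hφ⟩ := exists_galU_apply_eq_pow F hd
  have hfix' : ∀ s : GalU F, (∀ ζ : maxUnramified F, ζ ^ (residueCard F ^ d - 1) = 1 → s ζ = ζ) →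
      ∀ a b, s (D.basis.val a b) = D.basis.val a b := fun s hs a b => hfix s hs (a, b)
  have hq := one_lt_residueCard F
  have hM := residueCard_pow_sub_one_ne_zero (F := F) hd
  have hg := D.gal_pow_eq_one hφ hfix'
  obtain ⟨ζ, hζ⟩ := exists_isPrimitiveRoot_maxUnramified F hd
  have := finite_characters hM hq.le hg hζ
  set H := Multiplicative (FrobCoinvariants (D.gal φ) (residueCard F)) →* (maxUnramified F)ˣ
  -- the characters which do not separate a given pair of roots
  let B : ι × ι → Set H := fun p => if P.root p.1 = P.root p.2 then ∅ else
    {ψ | restrict _ ψ (Multiplicative.ofAdd (P.root p.1 - P.root p.2)) = 1}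
  have hBcard : ∀ p, (B p).ncard * (residueCard F - 1) ≤ Nat.card H * C := by
    intro p
    by_cases hp : P.root p.1 = P.root p.2
    · simp only [B, if_pos hp, Set.ncard_empty, zero_mul]
      exact Nat.zero_le _
    · obtain ⟨r, hr, ⟨y, hy⟩, h⟩ := exists_card_mul_eq hM hq.le hg hζ (P.root p.1 - P.root p.2)
      have h1 := sub_one_le_mul_of_eq hd hq hr hg (D.exists_root_eq_gal φ)
        (fun i j k => hC (i, j, k)) hp hy
      simp only [B, hp, if_false]
      rw [← h, mul_assoc]
      exact Nat.mul_le_mul_left _ h1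
  refine D.exists_weylSum_ne_zero hd hφ hfix' χ (⋃ p, B p) (fun ψ hψ => ?_) ?_
  · refine inGeneralPosition_of_separates_roots fun i j hij h1 => hψ ?_
    refine Set.mem_iUnion.2 ⟨(i, j), ?_⟩
    simp only [B, hij, if_false]
    exact h1
  · have h1 : (⋃ p, B p).ncard * (residueCard F - 1) ≤ Nat.card (ι × ι) * (Nat.card H * C) := by
      have h2 : (⋃ p, B p).ncard ≤ ∑ p, (B p).ncard := by
        simpa using Finset.set_ncard_biUnion_le Finset.univ B
      refine (Nat.mul_le_mul_right _ h2).trans ?_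
      rw [Finset.sum_mul, Nat.card_eq_fintype_card]
      exact Finset.sum_le_card_nsmul _ _ _ fun p _ => hBcard p
    have h3 := SplitReductive.card_weylSet_le (AlgebraicClosure F) D.toSplitReductive
    have h4 : 0 < Nat.card H := Nat.card_pos
    refine lt_of_mul_lt_mul_right (a := residueCard F - 1) ?_ (Nat.zero_le _)
    calc _ = Nat.card (D.weylSet (AlgebraicClosure F)) *
          ((⋃ p, B p).ncard * (residueCard F - 1)) := by ring
      _ ≤ Nat.card ι ^ Nat.card ι * (Nat.card (ι × ι) * (Nat.card H * C)) :=
          Nat.mul_le_mul h3 h1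
      _ = Nat.card H * (Nat.card ι ^ Nat.card ι * (Nat.card (ι × ι) * C)) := by ring
      _ < Nat.card H * (residueCard F - 1) := Nat.mul_lt_mul_of_pos_left (by omega) h4

end UnramifiedPair

end

/-! ### The root datum of `PGSp(4)` -/

section

open FrobCoinvariants

/-- The roots of `PGSp(4)`, in coordinates with respect to the orthogonal basis of the character
lattice which consists of two short roots. -/
def rootsPGSp4 : Finset (ℤ × ℤ) :=
  {(0, 1), (0, -1), (1, -1), (-1, 1), (1, 0), (-1, 0), (1, 1), (-1, -1)}

/-- The images of the two basis vectors under the eight automorphisms of `ℤ × ℤ` which preserve the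
roots of `PGSp(4)`. -/
def autPGSp4 : Finset ((ℤ × ℤ) × (ℤ × ℤ)) :=
  (rootsPGSp4 ×ˢ rootsPGSp4).filter fun p => p.1 + p.2 ∈ rootsPGSp4 ∧ p.1 - p.2 ∈ rootsPGSp4

theorem card_autPGSp4 : autPGSp4.card = 8 := by decide

variable {ι X Y : Type*} [AddCommGroup X] [AddCommGroup Y] {P : RootDatum ι X Y}

/-- In coordinates with respect to `α + β` and `α`, the roots are the vectors with entries in
`{-1, 0, 1}` other than zero. -/
theorem IsRootDatumPGSp4.exists_coordinates (h : IsRootDatumPGSp4 P) :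
    ∃ E : (ℤ × ℤ) ≃ₗ[ℤ] X, Set.range P.root = E '' rootsPGSp4 := by
  obtain ⟨α, β, hli, hspan, hroot⟩ := h
  let f : (ℤ × ℤ) →ₗ[ℤ] X :=
    (LinearMap.toSpanSingleton ℤ X (α + β)).coprod (LinearMap.toSpanSingleton ℤ X α)
  have hf : ∀ a b, f (a, b) = a • (α + β) + b • α := fun a b => rfl
  have hR : Set.range P.root = f '' rootsPGSp4 := by
    rw [hroot]
    simp only [rootsPGSp4, Finset.coe_insert, Finset.coe_singleton, Set.image_insert_eq,
      Set.image_singleton, hf]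
    have h1 : (0 : ℤ) • (α + β) + (1 : ℤ) • α = α := by module
    have h2 : (0 : ℤ) • (α + β) + (-1 : ℤ) • α = -α := by module
    have h3 : (1 : ℤ) • (α + β) + (-1 : ℤ) • α = β := by module
    have h4 : (-1 : ℤ) • (α + β) + (1 : ℤ) • α = -β := by module
    have h5 : (1 : ℤ) • (α + β) + (0 : ℤ) • α = α + β := by module
    have h6 : (-1 : ℤ) • (α + β) + (0 : ℤ) • α = -(α + β) := by module
    have h7 : (1 : ℤ) • (α + β) + (1 : ℤ) • α = (2 : ℤ) • α + β := by module
    have h8 : (-1 : ℤ) • (α + β) + (-1 : ℤ) • α = -((2 : ℤ) • α + β) := by module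
    rw [h1, h2, h3, h4, h5, h6, h7, h8]
  refine ⟨LinearEquiv.ofBijective f ⟨?_, ?_⟩, hR⟩
  · rw [injective_iff_map_eq_zero]
    rintro ⟨a, b⟩ hab
    rw [hf] at hab
    have := LinearIndependent.pair_iff.1 hli (a + b) a (by rw [← hab]; module)
    ext <;> simp <;> omega
  · intro x
    have hx : x ∈ Submodule.span ℤ {α, β} := hspan ▸ Submodule.mem_top
    obtain ⟨a, b, rfl⟩ := Submodule.mem_span_pair.1 hx
    exact ⟨(b, a - b), by rw [hf, sub_smul, smul_add]; abel⟩

section Aut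

variable {E : (ℤ × ℤ) ≃ₗ[ℤ] X} (hE : Set.range P.root = E '' rootsPGSp4)

include hE in
theorem exists_root_eq_of_mem_rootsPGSp4 {p : ℤ × ℤ} (hp : p ∈ rootsPGSp4) :
    ∃ i, P.root i = E p := by
  have : E p ∈ Set.range P.root := hE ▸ ⟨p, hp, rfl⟩
  exact this

include hE in
theorem symm_root_mem_rootsPGSp4 (i : ι) : E.symm (P.root i) ∈ rootsPGSp4 := by
  have : P.root i ∈ E '' rootsPGSp4 := hE ▸ ⟨i, rfl⟩
  obtain ⟨p, hp, h⟩ := this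
  rw [← h, E.symm_apply_apply]
  exact hp

/-- The images of the two basis vectors under an automorphism of the character lattice. -/
def coordImages (E : (ℤ × ℤ) ≃ₗ[ℤ] X) (w : X ≃ₗ[ℤ] X) : (ℤ × ℤ) × (ℤ × ℤ) :=
  (E.symm (w (E (1, 0))), E.symm (w (E (0, 1))))

theorem apply_eq_coordImages (w : X ≃ₗ[ℤ] X) (a b : ℤ) :
    w (E (a, b)) = E (a • (coordImages E w).1 + b • (coordImages E w).2) := by
  have : ((a, b) : ℤ × ℤ) = a • ((1, 0) : ℤ × ℤ) + b • ((0, 1) : ℤ × ℤ) := by simp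
  rw [this]
  simp only [coordImages, map_add, map_smul, E.apply_symm_apply]

theorem coordImages_injective : Function.Injective (coordImages E) := by
  intro w w' h
  ext x
  obtain ⟨⟨a, b⟩, rfl⟩ := E.surjective x
  rw [apply_eq_coordImages, apply_eq_coordImages, h]

include hE in
theorem coordImages_mem_autPGSp4 {w : X ≃ₗ[ℤ] X}
    (hw : ∀ i, ∃ j, P.root j = w (P.root i)) : coordImages E w ∈ autPGSp4 := by
  have h : ∀ p ∈ rootsPGSp4, E.symm (w (E p)) ∈ rootsPGSp4 := by
    intro p hp
    obtain ⟨i, hi⟩ := exists_root_eq_of_mem_rootsPGSp4 hE hp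
    obtain ⟨j, hj⟩ := hw i
    rw [← hi, ← hj]
    exact symm_root_mem_rootsPGSp4 hE j
  have h1 := h (1, 1) (by decide)
  have h2 := h (1, -1) (by decide)
  rw [apply_eq_coordImages, E.symm_apply_apply] at h1 h2
  refine Finset.mem_filter.2 ⟨Finset.mem_product.2 ⟨h _ (by decide), h _ (by decide)⟩, ?_, ?_⟩
  · simpa using h1
  · simpa [sub_eq_add_neg] using h2

include hE in
theorem card_weylSet_le_eight {K L : Type*} [Field K] [Field L] [CharZero L] [Algebra K L] {n : ℕ}
    (S : SplitReductive P K n) [Finite ι] : Nat.card (S.weylSet L) ≤ 8 := by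
  rw [← card_autPGSp4, ← Fintype.card_coe, ← Nat.card_eq_fintype_card]
  refine Nat.card_le_card_of_injective (fun w : S.weylSet L => (⟨coordImages E w,
    coordImages_mem_autPGSp4 hE (SplitReductive.exists_root_eq_of_mem_weylSet w.2)⟩ : autPGSp4))
    fun w w' h => Subtype.ext (coordImages_injective (congrArg Subtype.val h))

/-- A point of the torus is regular, and fixed by no nontrivial element of the Weyl group, if the
doubles of the short roots and the long roots are nontrivial on it. -/
theorem inGeneralPosition_of_PGSp4 (hE : Set.range P.root = E '' rootsPGSp4)
    {K L : Type*} [Field K] [Field L] [CharZero L]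
    [Algebra K L] {n : ℕ} {S : SplitReductive P K n} [Finite ι] {t : Multiplicative X →* Kˣ}
    (h₁ : t (Multiplicative.ofAdd (E (2, 0))) ≠ 1) (h₂ : t (Multiplicative.ofAdd (E (0, 2))) ≠ 1)
    (h₃ : t (Multiplicative.ofAdd (E (1, 1))) ≠ 1)
    (h₄ : t (Multiplicative.ofAdd (E (1, -1))) ≠ 1) :
    (∀ i, t (Multiplicative.ofAdd (P.root i)) ≠ 1) ∧
      ∀ w ∈ S.weylSet L, w ≠ 1 → ∃ x,
        t (Multiplicative.ofAdd (w x)) ≠ t (Multiplicative.ofAdd x) := by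
  -- the kernel of `t`, in coordinates
  let Λ : AddSubgroup (ℤ × ℤ) := AddMonoidHom.ker (M := Additive Kˣ)
    ((MonoidHom.toAdditiveRight t).comp (E : (ℤ × ℤ) →ₗ[ℤ] X).toAddMonoidHom)
  have hΛ : ∀ p, p ∈ Λ ↔ t (Multiplicative.ofAdd (E p)) = 1 := fun p => Iff.rfl
  rw [Ne, ← hΛ] at h₁ h₂ h₃ h₄
  have hΛ' : ∀ p ∈ Λ, -p ∈ Λ ∧ p + p ∈ Λ ∧ -(p + p) ∈ Λ := fun p hp =>
    ⟨neg_mem hp, add_mem hp hp, neg_mem (add_mem hp hp)⟩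
  constructor
  · intro i hi
    have h1 := symm_root_mem_rootsPGSp4 hE i
    rw [← E.apply_symm_apply (P.root i), ← hΛ] at hi
    obtain ⟨h2, h3, h4⟩ := hΛ' _ hi
    have hdec : ∀ p ∈ rootsPGSp4, (p + p = (2, 0) ∨ -(p + p) = (2, 0)) ∨
        (p + p = (0, 2) ∨ -(p + p) = (0, 2)) ∨ (p = (1, 1) ∨ -p = (1, 1)) ∨
        (p = (1, -1) ∨ -p = (1, -1)) := by decide
    rcases hdec _ h1 with (h | h) | (h | h) | (h | h) | (h | h) <;> simp_all
  · intro w hw hw1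
    by_contra! hcon
    have h1 := coordImages_mem_autPGSp4 hE (SplitReductive.exists_root_eq_of_mem_weylSet hw)
    have hmem : ∀ p, p - E.symm (w (E p)) ∈ Λ := by
      intro p
      rw [hΛ, map_sub, E.apply_symm_apply, ofAdd_sub, map_div, hcon, div_self']
    have h2 := hmem (1, 0)
    have h3 := hmem (0, 1)
    change (1, 0) - (coordImages E w).1 ∈ Λ at h2
    change (0, 1) - (coordImages E w).2 ∈ Λ at h3
    have hdec : ∀ p ∈ autPGSp4, p = ((1, 0), (0, 1)) ∨ (1, 0) - p.1 = (2, 0) ∨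
        (0, 1) - p.2 = (0, 2) ∨ (1, 0) - p.1 = (1, 1) ∨ (1, 0) - p.1 = (1, -1) := by decide
    rcases hdec _ h1 with h | h | h | h | h
    · refine hw1 (coordImages_injective (E := E) (h.trans ?_))
      simp [coordImages]
    all_goals simp_all

end Aut

end

/-! ### The two unramified elliptic tori of `PGSp(4)` -/

section

open FrobCoinvariants

/-- A union of two sets with a common element has fewer elements than their sizes add up to. -/
theorem Set.ncard_union_add_one_le {α : Type*} [Finite α] {A B : Set α} {a : α} (hA : a ∈ A)
    (hB : a ∈ B) : (A ∪ B).ncard + 1 ≤ A.ncard + B.ncard := by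
  rw [← Set.ncard_union_add_ncard_inter A B]
  exact Nat.add_le_add_left ((Set.ncard_pos (s := A ∩ B) (Set.toFinite _)).2 ⟨a, hA, hB⟩) _

namespace UnramifiedPair

variable {ι X Y : Type*} [Finite ι] [AddCommGroup X] [AddCommGroup Y] [Module.Finite ℤ X]
  {P : RootDatum ι X Y} [P.IsReduced] {F : Type*} [NontriviallyNormedField F]
  [IsUltrametricDist F] [ProperSpace F] [CharZero F] {n : ℕ} {D : UnramifiedPair P F n}
  {φ : GalU F}

/-- The torus of `PGSp(4)` on which the Frobenius acts by `-1`. -/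
theorem exists_weylSum_ne_zero_of_gal_eq_neg (hP : IsRootDatumPGSp4 P) (hφ : IsFrobenius φ)
    (hgal : ∀ x, D.gal φ x = -x) (hF : 46 < residueCard F) (χ : D.ratTorus →* ℂˣ) :
    ∃ t ∈ D.centralRegularSet, D.weylSum χ t ≠ 0 := by
  obtain ⟨E, hE⟩ := hP.exists_coordinates
  obtain ⟨d, hd, hfix⟩ := exists_forall_galU_apply_eq fun p : Fin n × Fin n =>
    D.basis.val p.1 p.2
  have hφ' : ∀ ζ : maxUnramified F, ζ ^ (residueCard F ^ d - 1) = 1 →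
      φ ζ = ζ ^ residueCard F := fun ζ hζ => hφ.apply_eq_pow hd hζ
  have hfix' : ∀ s : GalU F, (∀ ζ : maxUnramified F, ζ ^ (residueCard F ^ d - 1) = 1 → s ζ = ζ) →
      ∀ a b, s (D.basis.val a b) = D.basis.val a b := fun s hs a b => hfix s hs (a, b)
  have hM := residueCard_pow_sub_one_ne_zero (F := F) hd
  have hg := D.gal_pow_eq_one hφ' hfix'
  obtain ⟨ζ, hζ⟩ := exists_isPrimitiveRoot_maxUnramified F hd
  have := finite_characters hM (by omega) hg hζ
  set q := residueCard F
  set H := Multiplicative (FrobCoinvariants (D.gal φ) q) →* (maxUnramified F)ˣ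
  let B : ℤ × ℤ → Set H := fun p => {ψ | restrict _ ψ (Multiplicative.ofAdd (E p)) = 1}
  -- here `(φ - q) X = (q + 1) X`
  have hcard : ∀ p : ℤ × ℤ, ∃ r : ℕ, 0 < r ∧ (∃ z : ℤ × ℤ, ((q : ℤ) + 1) • z = (r : ℤ) • p) ∧
      (B p).ncard * r = Nat.card H := by
    intro p
    obtain ⟨r, hr, ⟨y, hy⟩, h⟩ := exists_card_mul_eq hM (by omega) hg hζ (E p)
    refine ⟨r, hr, ⟨-E.symm y, E.injective ?_⟩, h⟩
    rw [map_smul, map_smul, map_neg, E.apply_symm_apply, natCast_zsmul, ← hy, hgal]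
    module
  have hlong : ∀ p : ℤ × ℤ, p.1 = 1 → (B p).ncard * (q + 1) ≤ Nat.card H := by
    intro p hp
    obtain ⟨r, hr, ⟨z, hz⟩, h⟩ := hcard p
    have h1 := congrArg Prod.fst hz
    simp only [Prod.smul_fst, smul_eq_mul, hp, mul_one] at h1
    rw [← h]
    exact Nat.mul_le_mul_left _ (Nat.le_of_dvd hr (Int.natCast_dvd_natCast.1 ⟨_, by
      push_cast
      exact h1.symm⟩))
  have hshort : ∀ p : ℤ × ℤ, p.1 + p.2 = 2 → (B p).ncard * (q + 1) ≤ 2 * Nat.card H := by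
    intro p hp
    obtain ⟨r, hr, ⟨z, hz⟩, h⟩ := hcard p
    have h1 := congrArg Prod.fst hz
    have h2 := congrArg Prod.snd hz
    simp only [Prod.smul_fst, Prod.smul_snd, smul_eq_mul] at h1 h2
    have h3 : q + 1 ≤ 2 * r := Nat.le_of_dvd (by omega) (Int.natCast_dvd_natCast.1
      ⟨z.1 + z.2, by push_cast; rw [mul_add, h1, h2, ← mul_add, hp, mul_comm]⟩)
    calc (B p).ncard * (q + 1) ≤ (B p).ncard * (2 * r) := Nat.mul_le_mul_left _ h3
      _ = 2 * Nat.card H := by rw [← h]; ring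
  have h1 := hshort (2, 0) rfl
  have h2 := hshort (0, 2) rfl
  have h3 := hlong (1, 1) rfl
  have h4 := hlong (1, -1) rfl
  refine D.exists_weylSum_ne_zero hd hφ' hfix' χ
    (((B (2, 0) ∪ B (0, 2)) ∪ B (1, 1)) ∪ B (1, -1)) (fun ψ hψ => ?_) ?_
  · simp only [Set.mem_union, not_or] at hψ
    exact inGeneralPosition_of_PGSp4 hE hψ.1.1.1 hψ.1.1.2 hψ.1.2 hψ.2
  · have hone : ∀ p, (1 : H) ∈ B p := fun p => rfl
    -- all four sets contain the trivial character
    have h5 := Set.ncard_union_add_one_le (hone (2, 0)) (hone (0, 2))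
    have h6 := Set.ncard_union_add_one_le (A := B (2, 0) ∪ B (0, 2)) (Or.inl (hone (2, 0)))
      (hone (1, 1))
    have h7 := Set.ncard_union_add_one_le (A := (B (2, 0) ∪ B (0, 2)) ∪ B (1, 1))
      (Or.inl (Or.inl (hone (2, 0)))) (hone (1, -1))
    have h8 := card_weylSet_le_eight (L := AlgebraicClosure F) hE D.toSplitReductive
    set U := ((B (2, 0) ∪ B (0, 2)) ∪ B (1, 1)) ∪ B (1, -1)
    have h9 : (U.ncard + 3) * (q + 1) ≤ 6 * Nat.card H := by
      refine (Nat.mul_le_mul_right _ (?_ : _ ≤ (B (2, 0)).ncard + (B (0, 2)).ncard +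
        (B (1, 1)).ncard + (B (1, -1)).ncard)).trans ?_
      · omega
      · rw [add_mul, add_mul, add_mul]
        omega
    refine lt_of_mul_lt_mul_right (a := q + 1) ?_ (Nat.zero_le _)
    calc _ ≤ 8 * U.ncard * (q + 1) := Nat.mul_le_mul_right _ (Nat.mul_le_mul_right _ h8)
      _ < 8 * ((U.ncard + 3) * (q + 1)) := by nlinarith
      _ ≤ Nat.card H * 48 := by omega
      _ ≤ Nat.card H * (q + 1) := Nat.mul_le_mul_left _ (by omega)

/-- The torus of `PGSp(4)` on which the square of the Frobenius acts by `-1`. -/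
theorem exists_weylSum_ne_zero_of_gal_gal_eq_neg (hP : IsRootDatumPGSp4 P) (hφ : IsFrobenius φ)
    (hgal : ∀ x, D.gal φ (D.gal φ x) = -x) (hF : 3 < residueCard F) (χ : D.ratTorus →* ℂˣ) :
    ∃ t ∈ D.centralRegularSet, D.weylSum χ t ≠ 0 := by
  obtain ⟨E, hE⟩ := hP.exists_coordinates
  obtain ⟨d, hd, hfix⟩ := exists_forall_galU_apply_eq fun p : Fin n × Fin n =>
    D.basis.val p.1 p.2
  have hφ' : ∀ ζ : maxUnramified F, ζ ^ (residueCard F ^ d - 1) = 1 →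
      φ ζ = ζ ^ residueCard F := fun ζ hζ => hφ.apply_eq_pow hd hζ
  have hfix' : ∀ s : GalU F, (∀ ζ : maxUnramified F, ζ ^ (residueCard F ^ d - 1) = 1 → s ζ = ζ) →
      ∀ a b, s (D.basis.val a b) = D.basis.val a b := fun s hs a b => hfix s hs (a, b)
  have hM := residueCard_pow_sub_one_ne_zero (F := F) hd
  have hg := D.gal_pow_eq_one hφ' hfix'
  obtain ⟨ζ, hζ⟩ := exists_isPrimitiveRoot_maxUnramified F hd
  have := finite_characters hM (by omega) hg hζ
  -- the Frobenius acts by a rotation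
  obtain ⟨ε, hε, hrot⟩ : ∃ ε : ℤ, (ε = 1 ∨ ε = -1) ∧
      ∀ a b : ℤ, D.gal φ (E (a, b)) = E (-ε * b, ε * a) := by
    have h1 := coordImages_mem_autPGSp4 hE (D.exists_root_eq_gal φ)
    have h2 := hgal (E (1, 0))
    have hdec : ∀ p ∈ autPGSp4, p.1.1 • p.1 + p.1.2 • p.2 = (-1, 0) →
        p = ((0, 1), (-1, 0)) ∨ p = ((0, -1), (1, 0)) := by decide
    rw [apply_eq_coordImages, one_smul, zero_smul, add_zero, apply_eq_coordImages, ← map_neg] at h2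
    rcases hdec _ h1 (E.injective h2) with h | h
    · exact ⟨1, Or.inl rfl, fun a b => by rw [apply_eq_coordImages, h]; simp⟩
    · exact ⟨-1, Or.inr rfl, fun a b => by rw [apply_eq_coordImages, h]; simp⟩
  set q := residueCard F
  set H := Multiplicative (FrobCoinvariants (D.gal φ) q) →* (maxUnramified F)ˣ
  let B : Set H := {ψ | restrict _ ψ (Multiplicative.ofAdd (E (2, 0))) = 1}
  refine D.exists_weylSum_ne_zero hd hφ' hfix' χ B (fun ψ hψ => ?_) ?_
  · -- the kernel of `ψ` is stable under the rotation
    have hker : ∀ a b : ℤ, restrict _ ψ (Multiplicative.ofAdd (E (a, b))) = 1 →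
        restrict _ ψ (Multiplicative.ofAdd (E (-ε * b, ε * a))) = 1 := by
      intro a b h
      rw [← hrot, restrict_apply_apply, h, one_pow]
    have hadd : ∀ a b a' b' : ℤ, restrict _ ψ (Multiplicative.ofAdd (E (a, b))) = 1 →
        restrict _ ψ (Multiplicative.ofAdd (E (a', b'))) = 1 →
        restrict _ ψ (Multiplicative.ofAdd (E (a + a', b + b'))) = 1 := by
      intro a b a' b' h h'
      rw [← Prod.mk_add_mk, map_add, ofAdd_add, map_mul, h, h', one_mul]
    have hneg : ∀ a b : ℤ, restrict _ ψ (Multiplicative.ofAdd (E (a, b))) = 1 →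
        restrict _ ψ (Multiplicative.ofAdd (E (-a, -b))) = 1 := by
      intro a b h
      rw [← Prod.neg_mk, map_neg, ofAdd_neg, map_inv, h, inv_one]
    refine inGeneralPosition_of_PGSp4 hE hψ (fun h => hψ ?_) (fun h => hψ ?_) (fun h => hψ ?_)
    all_goals
      have h' := hker _ _ h
      have h'' := hneg _ _ h'
      have h3 := hadd _ _ _ _ h h'
      have h4 := hadd _ _ _ _ h h''
      rcases hε with rfl | rfl
      all_goals
        norm_num at h' h'' h3 h4
        first
          | exact h'
          | exact h''
          | exact h3
          | exact h4
  · obtain ⟨r, hr, ⟨y, hy⟩, h⟩ := exists_card_mul_eq hM (by omega) hg hζ (E (2, 0))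
    obtain ⟨⟨a, b⟩, rfl⟩ := E.surjective y
    have h1 : (-ε * b - q * a, ε * a - q * b) = ((r : ℤ) * 2, (0 : ℤ)) := by
      refine E.injective ?_
      have h2 : ((r : ℤ) * 2, (0 : ℤ)) = (r : ℤ) • ((2, 0) : ℤ × ℤ) := by simp
      have h3 : (-ε * b - q * a, ε * a - q * b) =
          (-ε * b, ε * a) - (q : ℤ) • ((a, b) : ℤ × ℤ) := by simp
      rw [h2, h3, map_sub, map_smul, map_smul, ← hrot, hy, natCast_zsmul]
    obtain ⟨h2, h3⟩ := Prod.mk.inj h1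
    -- applying `φ + q` to `(φ - q) y = r (2, 0)` shows that `q ^ 2 + 1` divides `2 r`
    have h4 : q ^ 2 + 1 ≤ r * 2 := by
      refine Nat.le_of_dvd (by omega) (Int.natCast_dvd_natCast.1 ⟨-ε * b, ?_⟩)
      have hε2 : ε * ε = 1 := by rcases hε with rfl | rfl <;> rfl
      have h5 : a = ε * (q * b) := by linear_combination ε * h3 - a * hε2
      push_cast
      rw [← h2, h5]
      ring
    have h5 := card_weylSet_le_eight (L := AlgebraicClosure F) hE D.toSplitReductive
    have h6 : 0 < Nat.card H := Nat.card_pos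
    change B.ncard * r = Nat.card H at h
    have h7 : 0 < B.ncard := Nat.pos_of_ne_zero fun h0 => by rw [h0, zero_mul] at h; omega
    have h8 : 4 ^ 2 ≤ q ^ 2 := Nat.pow_le_pow_left hF 2
    calc _ ≤ 8 * B.ncard := Nat.mul_le_mul_right _ h5
      _ < B.ncard * r := by nlinarith
      _ = Nat.card H := h

end UnramifiedPair

end

/-- Nonvanishing of the Weyl sum of a depth-zero character on the set of products of central
elements and strongly regular topologically semisimple elements of an unramified elliptic maximal
torus, for all local fields whose residue cardinality `q` exceeds a bound depending only on the
root datum; and explicit bounds for the two unramified elliptic tori of `PGSp(4)`, on whose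
character lattices the Frobenius acts by `-1` (the torus `T₁`), respectively by an automorphism
with square `-1` (the torus `T₂`). -/
theorem lemma9p7 {ι X Y : Type*} [Finite ι] [AddCommGroup X] [AddCommGroup Y]
    [Module.Finite ℤ X] [Module.Finite ℤ Y] (P : RootDatum ι X Y) [P.IsReduced] :
    (∃ q₀ : ℕ, ∀ (F : Type*) [NontriviallyNormedField F] [IsUltrametricDist F] [ProperSpace F]
      [CharZero F], q₀ < residueCard F →
      ∀ (n : ℕ) (D : UnramifiedPair P F n), D.IsElliptic →
      ∀ χ : D.ratTorus →* ℂˣ, D.IsDepthZero χ →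
        ∃ t ∈ D.centralRegularSet, D.weylSum χ t ≠ 0) ∧
    (IsRootDatumPGSp4 P →
      ∀ (F : Type*) [NontriviallyNormedField F] [IsUltrametricDist F] [ProperSpace F]
      [CharZero F] (n : ℕ) (D : UnramifiedPair P F n) (φ : GalU F), IsFrobenius φ →
      ∀ χ : D.ratTorus →* ℂˣ, D.IsDepthZero χ →
        ((∀ x, D.gal φ x = -x) → 46 < residueCard F →
          ∃ t ∈ D.centralRegularSet, D.weylSum χ t ≠ 0) ∧
        ((∀ x, D.gal φ (D.gal φ x) = -x) → 3 < residueCard F →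
          ∃ t ∈ D.centralRegularSet, D.weylSum χ t ≠ 0)) := by
  refine ⟨?_, fun hP F _ _ _ _ n D φ hφ χ _ => ⟨fun hgal hF => ?_, fun hgal hF => ?_⟩⟩
  · obtain ⟨q₀, h⟩ := UnramifiedPair.exists_forall_exists_weylSum_ne_zero P
    exact ⟨q₀, fun F _ _ _ _ hF n D _ χ _ => h F hF n D χ⟩
  · exact UnramifiedPair.exists_weylSum_ne_zero_of_gal_eq_neg hP hφ hgal hF χ
  · exact UnramifiedPair.exists_weylSum_ne_zero_of_gal_gal_eq_neg hP hφ hgal hF χ
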